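/- Let $E$ be a smooth manifold of dimension $n+m$ with a smooth torsion-free linear connection $\Gamma$, and let $M$ be a smooth manifold of dimension $n$ with a smooth torsion-free linear connection $\Theta$. \textbf{Notation.} For a manifold $N$ of dimension $n+k$ let $J^r(N,n)$, $r=1,2$, be the manifold of $r$-jets $[L]^r_p$ of embedded $n$-dimensional submanifolds $L\subset N$ at points $p\in L$, and $\pi_{2,1}:[L]^2_p\mapsto[L]^1_p$. For a submanifold $L$ put $L^{(r)}=\{[L]^r_p : p\in L\}$. An $R$-plane at $\theta\in J^r(N,n)$ is a plane $T_\theta L^{(r)}$ with $\theta \in L^{(r)}$; the Cartan distribution $\mathcal C^r$ is at each point the span of the $R$-planes there. A contact transformation is a diffeomorphism preserving $\mathcal C^r$. For a torsion-free linear connection $\nabla$ on $N$, let $\operatorname{II}$ be the second fundamental form of $L$, $\operatorname{II}(v,w)=\nabla_v w \bmod TL$ (for $v, w$ tangent to $L$), which at $p$ depends only on $[L]^2_p$, and let $\mathcal S=\{[L]^2_p : \operatorname{II}=0 \text{ at } p\}\subset J^2(N,n)$. Each $\theta\in J^1(N,n)$ has exactly one point $\ddot\Gamma(\theta)=[L]^2_p$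 of $\mathcal S$ over it, and $R\circ\ddot\Gamma$ denotes the $n$-dimensional distribution $\theta\mapsto T_\theta L^{(1)}$ on $J^1(N,n)$. We consider the following three situations $(N,\nabla,U_1,U_2)$, where $U_r\subset J^r(N,n)$ is open: (i) $N=E$, $\nabla=\Gamma$, $U_r=J^r(E,n)$, so $k=m$; here $\mathcal S\subset J^2(E,n)$ is the equation of totally geodesic submanifolds. (ii) $N=M\times E$, $\nabla=\Gamma\oplus\Theta$, so $k=n+m$, and $U_r=\operatorname{Imm}J^r\mathrm{pr}_M$, the $r$-jets of the graphs of local immersions $M\supset O\to E$; here $\mathcal S_{\mathrm{pr}_M}=\mathcal S\cap U_2$ is the equation of parametrized totally geodesic submanifolds. (iii) The same with $U_r=J^r\mathrm{pr}_M$, the $r$-jets of the graphs of all smooth local maps $M\supset O\to E$. A classical external symmetry is a diffeomorphism of $U_2$ which preserves $\mathcal C^2$ and maps $\mathcal S\cap U_2$ onto itself. A classical internal symmetry is a diffeomorphism of $\mathcal S\cap U_2$ which preserves the induced distribution $\mathcal C^2\cap T\mathcal S$. \textbf{Theorem.} In each of the three situations: 1. Restriction to $\mathcal S\cap U_2$ is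 a well-defined injective homomorphism from the group of classical external symmetries to the group of classical internal symmetries; thus the former is a subgroup of the latter. 2. Via $\pi_{2,1}$ the group of classical internal symmetries is isomorphic to the group of diffeomorphisms of $U_1$ preserving the distribution $R\circ\ddot\Gamma$. 3. Every classical external symmetry projects via $\pi_{2,1}$ to a transformation of $U_1$, this projection is an injective homomorphism, and its image consists exactly of the contact transformations of $U_1$ which preserve $R\circ\ddot\Gamma$ and which, together with their inverses, map $R$-planes to $R$-planes. If $k\neq1$, the condition on $R$-planes can be omitted: the image consists exactly of the contact transformations of $U_1$ which preserve $R\circ\ddot\Gamma$. -/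

import Mathlib

open Set Filter Topology
open scoped Manifold ContDiff

noncomputable section
namespace SubmanifoldJet

section Coordinates

theorem two_le_infty : (2 : ℕ∞ω) ≤ ∞ := WithTop.coe_le_coe.2 (le_top : (2 : ℕ∞) ≤ ⊤)

variable {X Y : Type*} [NormedAddCommGroup X] [NormedSpace ℝ X]
  [NormedAddCommGroup Y] [NormedSpace ℝ Y]

/-- First derivative of `t ↦ ψ (t, f t)`, in terms of the value and slope `m` of `f`. -/
def graphDeriv (ψ : X × Y → X × Y) (m : (X × Y) × (X →L[ℝ] Y)) : X →L[ℝ] X × Y :=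
  (fderiv ℝ ψ m.1).comp ((ContinuousLinearMap.id ℝ X).prod m.2)

def graphDerivH (ψ : X × Y → X × Y) (m : (X × Y) × (X →L[ℝ] Y)) : X →L[ℝ] X :=
  (ContinuousLinearMap.fst ℝ X Y).comp (graphDeriv ψ m)

def graphDerivV (ψ : X × Y → X × Y) (m : (X × Y) × (X →L[ℝ] Y)) : X →L[ℝ] Y :=
  (ContinuousLinearMap.snd ℝ X Y).comp (graphDeriv ψ m)

variable (X Y) in
/-- Coordinates on the `r`-jets of functions `f : X → Y` beyond the point and the value: the
quantity `D f x` in `K`, with a smooth representative `P` of each coordinate value and the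
transformation rule `tr` under a change of variables `ψ`. It serves to build the charts of the
spaces of first and second jets below. -/
structure JetCoord (r : ℕ) (K : Type*) [NormedAddCommGroup K] [NormedSpace ℝ K] where
  D : (X → Y) → X → K
  lin : K →L[ℝ] X →L[ℝ] Y
  P : X × Y → K → X → Y
  tr : (X × Y → X × Y) → (X × Y) × K → K
  lin_D : ∀ {f x}, lin (D f x) = fderiv ℝ f x
  P_smooth : ∀ z k, ContDiff ℝ ∞ (P z k)
  P_val : ∀ z k, P z k z.1 = z.2
  P_D : ∀ z k, D (P z k) z.1 = k
  D_iff : ∀ {f g x}, ContDiffAt ℝ ∞ f x → ContDiffAt ℝ ∞ g x → f x = g x →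
    ((∀ k ≤ r, iteratedFDeriv ℝ k f x = iteratedFDeriv ℝ k g x) ↔ D f x = D g x)
  D_tr : ∀ {ψ : X × Y → X × Y} {f g x}, ContDiffAt ℝ ∞ ψ (x, f x) → ContDiffAt ℝ ∞ f x →
    ContDiffAt ℝ ∞ g (ψ (x, f x)).1 → (∀ᶠ t in 𝓝 x, g (ψ (t, f t)).1 = (ψ (t, f t)).2) →
    (graphDerivH ψ ((x, f x), fderiv ℝ f x)).IsInvertible →
    D g (ψ (x, f x)).1 = tr ψ ((x, f x), D f x)
  tr_smooth : ∀ {ψ : X × Y → X × Y} {m : (X × Y) × K}, ContDiffAt ℝ ∞ ψ m.1 →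
    (graphDerivH ψ (m.1, lin m.2)).IsInvertible → ContDiffAt ℝ ∞ (tr ψ) m

theorem hasFDerivAt_graph {ψ : X × Y → X × Y} {f : X → Y} {x : X}
    (hψ : DifferentiableAt ℝ ψ (x, f x)) (hf : DifferentiableAt ℝ f x) :
    HasFDerivAt (fun t => ψ (t, f t)) (graphDeriv ψ ((x, f x), fderiv ℝ f x)) x := by
  have h1 : HasFDerivAt (fun t => (t, f t)) ((ContinuousLinearMap.id ℝ X).prod (fderiv ℝ f x)) x :=
    (hasFDerivAt_id x).prodMk hf.hasFDerivAt
  exact HasFDerivAt.comp x (f := fun t => (t, f t)) hψ.hasFDerivAt h1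

theorem graph_chain {ψ : X × Y → X × Y} {f g : X → Y} {x : X}
    (hψ : DifferentiableAt ℝ ψ (x, f x)) (hf : DifferentiableAt ℝ f x)
    (hg : DifferentiableAt ℝ g (ψ (x, f x)).1)
    (h : ∀ᶠ t in 𝓝 x, g (ψ (t, f t)).1 = (ψ (t, f t)).2) :
    (fderiv ℝ g (ψ (x, f x)).1).comp (graphDerivH ψ ((x, f x), fderiv ℝ f x)) =
      graphDerivV ψ ((x, f x), fderiv ℝ f x) := by
  have h0 := hasFDerivAt_graph hψ hf
  have h1 : HasFDerivAt (fun t => (ψ (t, f t)).1) _ x := h0.fst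
  have h2 : HasFDerivAt (fun t => (ψ (t, f t)).2) _ x := h0.snd
  have h3 := (HasFDerivAt.comp x (f := fun t => (ψ (t, f t)).1) hg.hasFDerivAt h1).congr_of_eventuallyEq
    (f₁ := fun t => (ψ (t, f t)).2) (by filter_upwards [h] with t ht; simp [ht])
  exact h3.unique h2

theorem graphDeriv_smooth {ψ : X × Y → X × Y} {m : (X × Y) × (X →L[ℝ] Y)}
    (hψ : ContDiffAt ℝ ∞ ψ m.1) : ContDiffAt ℝ ∞ (graphDeriv ψ) m := by
  have h1 : ContDiffAt ℝ ∞ (fun m : (X × Y) × (X →L[ℝ] Y) => fderiv ℝ ψ m.1) m :=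
    ContDiffAt.comp m (hψ.fderiv_right (m := ∞) (by simp)) contDiffAt_fst
  have h2 : ContDiffAt ℝ ∞ (fun m : (X × Y) × (X →L[ℝ] Y) =>
      (ContinuousLinearMap.id ℝ X).prod m.2) m := by
    have : (fun m : (X × Y) × (X →L[ℝ] Y) => (ContinuousLinearMap.id ℝ X).prod m.2) =
      fun m => (ContinuousLinearMap.inl ℝ X Y) + (ContinuousLinearMap.inr ℝ X Y).comp m.2 := by
      ext m v <;> simp
    rw [this]
    exact contDiffAt_const.add (contDiffAt_const.clm_comp contDiffAt_snd)
  exact h1.clm_comp h2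

theorem graphDerivH_smooth {ψ : X × Y → X × Y} {m : (X × Y) × (X →L[ℝ] Y)}
    (hψ : ContDiffAt ℝ ∞ ψ m.1) : ContDiffAt ℝ ∞ (graphDerivH ψ) m :=
  contDiffAt_const.clm_comp (graphDeriv_smooth hψ)

theorem graphDerivV_smooth {ψ : X × Y → X × Y} {m : (X × Y) × (X →L[ℝ] Y)}
    (hψ : ContDiffAt ℝ ∞ ψ m.1) : ContDiffAt ℝ ∞ (graphDerivV ψ) m :=
  contDiffAt_const.clm_comp (graphDeriv_smooth hψ)

/-- Slope of the function whose graph is the image under `ψ` of a graph, in terms of the value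
and slope of the latter. -/
def slopeTr (ψ : X × Y → X × Y) (m : (X × Y) × (X →L[ℝ] Y)) : X →L[ℝ] Y :=
  (graphDerivV ψ m).comp (graphDerivH ψ m).inverse

theorem slopeTr_smooth [CompleteSpace X] {ψ : X × Y → X × Y} {m : (X × Y) × (X →L[ℝ] Y)}
    (hψ : ContDiffAt ℝ ∞ ψ m.1) (h : (graphDerivH ψ m).IsInvertible) :
    ContDiffAt ℝ ∞ (slopeTr ψ) m :=
  (graphDerivV_smooth hψ).clm_comp
    (ContDiffAt.comp m h.contDiffAt_map_inverse (graphDerivH_smooth hψ))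

theorem slope_tr {ψ : X × Y → X × Y} {f g : X → Y} {x : X}
    (hψ : DifferentiableAt ℝ ψ (x, f x)) (hf : DifferentiableAt ℝ f x)
    (hg : DifferentiableAt ℝ g (ψ (x, f x)).1)
    (h : ∀ᶠ t in 𝓝 x, g (ψ (t, f t)).1 = (ψ (t, f t)).2)
    (hi : (graphDerivH ψ ((x, f x), fderiv ℝ f x)).IsInvertible) :
    fderiv ℝ g (ψ (x, f x)).1 = slopeTr ψ ((x, f x), fderiv ℝ f x) := by
  obtain ⟨a, ha⟩ := hi
  have := graph_chain hψ hf hg h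
  rw [slopeTr, ← this, ← ha]
  ext v; simp

variable (X Y) in
/-- First jets: `D f x` is the derivative of `f`. -/
def firstJetCoord [CompleteSpace X] : JetCoord X Y 1 (X →L[ℝ] Y) where
  D f x := fderiv ℝ f x
  lin := ContinuousLinearMap.id ℝ _
  P z k x := z.2 + k (x - z.1)
  tr := slopeTr
  lin_D := rfl
  P_smooth z k := by fun_prop
  P_val z k := by simp
  P_D z k := by
    have : HasFDerivAt (fun x => z.2 + k (x - z.1)) k z.1 := by
      simpa using (k.hasFDerivAt.comp z.1 ((hasFDerivAt_id z.1).sub_const z.1)).const_add z.2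
    exact this.fderiv
  D_iff {f g x} hf hg h := by
    constructor
    · intro H
      ext v
      simpa using congrArg (fun T => T (fun _ => v)) (H 1 le_rfl)
    · intro H k hk
      interval_cases k
      · ext; simp [h]
      · ext v; simp [H]
  D_tr hψ hf hg h hi := slope_tr (hψ.differentiableAt (by simp)) (hf.differentiableAt (by simp))
    (hg.differentiableAt (by simp)) h hi
  tr_smooth hψ hi := slopeTr_smooth hψ hi

section Fixed

variable {W : Type*} [NormedAddCommGroup W] [NormedSpace ℝ W]

/-- The fixed vectors of a continuous linear endomorphism. -/
def fixedSubmodule (σ : W →L[ℝ] W) : Submodule ℝ W where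
  carrier := {q | σ q = q}
  add_mem' ha hb := by simp_all
  zero_mem' := by simp
  smul_mem' c q hq := by simp_all

/-- The space of fixed vectors of a continuous linear endomorphism. -/
def Fixed (σ : W →L[ℝ] W) : Type _ := fixedSubmodule σ

instance (σ : W →L[ℝ] W) : NormedAddCommGroup (Fixed σ) :=
  inferInstanceAs (NormedAddCommGroup (fixedSubmodule σ))

instance (σ : W →L[ℝ] W) : NormedSpace ℝ (Fixed σ) :=
  inferInstanceAs (NormedSpace ℝ (fixedSubmodule σ))

/-- The inclusion of the fixed vectors. -/
def Fixed.incl (σ : W →L[ℝ] W) : Fixed σ →L[ℝ] W := (fixedSubmodule σ).subtypeL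

/-- The projection `(id + σ) / 2` onto the fixed vectors of an involution. -/
def Fixed.proj (σ : W →L[ℝ] W) (hσ : ∀ w, σ (σ w) = w) : W →L[ℝ] Fixed σ :=
  ContinuousLinearMap.codRestrict ((2⁻¹ : ℝ) • (ContinuousLinearMap.id ℝ W + σ)) (fixedSubmodule σ)
    (fun w => by simp [fixedSubmodule, hσ, add_comm])

theorem Fixed.incl_fixed (σ : W →L[ℝ] W) (q : Fixed σ) : σ (incl σ q) = incl σ q := q.2

theorem Fixed.incl_proj (σ : W →L[ℝ] W) (hσ : ∀ w, σ (σ w) = w) {q : W} (h : σ q = q) :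
    incl σ (proj σ hσ q) = q := by
  change (2⁻¹ : ℝ) • (q + σ q) = q
  rw [h, ← two_smul ℝ, smul_smul]; norm_num

theorem Fixed.proj_incl (σ : W →L[ℝ] W) (hσ : ∀ w, σ (σ w) = w) (q : Fixed σ) :
    proj σ hσ (incl σ q) = q :=
  Subtype.ext (incl_proj σ hσ (incl_fixed σ q))

end Fixed

variable (X Y) in
/-- The space of bilinear maps from `X` to `Y`. -/
def Bilin : Type _ := X →L[ℝ] X →L[ℝ] Y

instance : NormedAddCommGroup (Bilin X Y) :=
  inferInstanceAs (NormedAddCommGroup (X →L[ℝ] X →L[ℝ] Y))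

instance : NormedSpace ℝ (Bilin X Y) :=
  inferInstanceAs (NormedSpace ℝ (X →L[ℝ] X →L[ℝ] Y))

variable (X Y) in
/-- Exchange of the two arguments of a bilinear map. -/
def flipBilin : Bilin X Y →L[ℝ] Bilin X Y :=
  LinearMap.mkContinuous (𝕜 := ℝ)
    { toFun := fun q : X →L[ℝ] X →L[ℝ] Y => q.flip
      map_add' := fun _ _ => rfl
      map_smul' := fun _ _ => rfl } 1 (fun q => by
        rw [one_mul]; exact (ContinuousLinearMap.opNorm_flip (𝕜₃ := ℝ) q).le)

theorem flipBilin_flipBilin (q : Bilin X Y) : flipBilin X Y (flipBilin X Y q) = q := rfl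

variable (X Y) in
/-- The space of symmetric bilinear maps from `X` to `Y`. -/
abbrev SymBilin : Type _ := Fixed (flipBilin X Y)

/-- A symmetric bilinear map as a bilinear map. -/
def SymBilin.incl (q : SymBilin X Y) : X →L[ℝ] X →L[ℝ] Y := Fixed.incl (flipBilin X Y) q

/-- The symmetrization of a bilinear map. -/
def symmetrize (q : X →L[ℝ] X →L[ℝ] Y) : SymBilin X Y :=
  Fixed.proj (flipBilin X Y) flipBilin_flipBilin q

theorem SymBilin.symm (q : SymBilin X Y) (u v : X) : q.incl u v = q.incl v u :=
  congrArg (fun T : X →L[ℝ] X →L[ℝ] Y => T v u) q.2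

theorem symmetrize_incl (q : SymBilin X Y) : symmetrize q.incl = q :=
  Fixed.proj_incl (flipBilin X Y) flipBilin_flipBilin q

theorem incl_symmetrize {q : X →L[ℝ] X →L[ℝ] Y} (h : ∀ u v, q u v = q v u) :
    (symmetrize q).incl = q :=
  Fixed.incl_proj (flipBilin X Y) flipBilin_flipBilin (q := q)
    (ContinuousLinearMap.ext fun u => ContinuousLinearMap.ext fun v => h v u)

theorem SymBilin.incl_contDiff : ContDiff ℝ ∞ (SymBilin.incl : SymBilin X Y → _) :=
  (Fixed.incl (flipBilin X Y)).contDiff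

theorem symmetrize_contDiff :
    ContDiff ℝ ∞ (symmetrize : (X →L[ℝ] X →L[ℝ] Y) → SymBilin X Y) :=
  (Fixed.proj (flipBilin X Y) flipBilin_flipBilin).contDiff

section Bilinear

variable {U V W Z P : Type*} [NormedAddCommGroup U] [NormedSpace ℝ U] [NormedAddCommGroup V]
  [NormedSpace ℝ V] [NormedAddCommGroup W] [NormedSpace ℝ W] [NormedAddCommGroup Z]
  [NormedSpace ℝ Z] [NormedAddCommGroup P] [NormedSpace ℝ P]

/-- The bilinear map `(u, v) ↦ B (j u) (j v)`. -/
def bilPull (B : V →L[ℝ] V →L[ℝ] W) (j : U →L[ℝ] V) : U →L[ℝ] U →L[ℝ] W :=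
  ((ContinuousLinearMap.compL ℝ U V W).flip j).comp (B.comp j)

/-- The bilinear map `(u, v) ↦ T (B u v)`. -/
def bilPush (T : W →L[ℝ] Z) (B : V →L[ℝ] V →L[ℝ] W) : V →L[ℝ] V →L[ℝ] Z :=
  (ContinuousLinearMap.compL ℝ V W Z T).comp B

theorem bilPull_apply (B : V →L[ℝ] V →L[ℝ] W) (j : U →L[ℝ] V) (u v : U) :
    bilPull B j u v = B (j u) (j v) := rfl

theorem bilPush_apply (T : W →L[ℝ] Z) (B : V →L[ℝ] V →L[ℝ] W) (u v : V) :
    bilPush T B u v = T (B u v) := rfl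

theorem bilPull_contDiffAt {B : P → V →L[ℝ] V →L[ℝ] W} {j : P → U →L[ℝ] V} {x : P}
    (hB : ContDiffAt ℝ ∞ B x) (hj : ContDiffAt ℝ ∞ j x) :
    ContDiffAt ℝ ∞ (fun x => bilPull (B x) (j x)) x :=
  (contDiffAt_const.clm_apply hj).clm_comp (hB.clm_comp hj)

theorem bilPush_contDiffAt {T : P → W →L[ℝ] Z} {B : P → V →L[ℝ] V →L[ℝ] W} {x : P}
    (hT : ContDiffAt ℝ ∞ T x) (hB : ContDiffAt ℝ ∞ B x) :
    ContDiffAt ℝ ∞ (fun x => bilPush (T x) (B x)) x :=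
  (contDiffAt_const.clm_apply hT).clm_comp hB

end Bilinear

/-- Second derivative of `t ↦ ψ (t, f t)`, in terms of the value, slope and second derivative
of `f`. -/
def graphDeriv₂ (ψ : X × Y → X × Y) (m : (X × Y) × (X →L[ℝ] Y) × SymBilin X Y) :
    X →L[ℝ] X →L[ℝ] X × Y :=
  bilPull (fderiv ℝ (fderiv ℝ ψ) m.1) ((ContinuousLinearMap.id ℝ X).prod m.2.1) +
  bilPush ((fderiv ℝ ψ m.1).comp (ContinuousLinearMap.inr ℝ X Y)) (SymBilin.incl m.2.2)

/-- Second derivative of the function whose graph is the image under `ψ` of a graph. -/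
def curvTr (ψ : X × Y → X × Y) (m : (X × Y) × (X →L[ℝ] Y) × SymBilin X Y) :
    X →L[ℝ] X →L[ℝ] Y :=
  bilPush (ContinuousLinearMap.snd ℝ X Y -
      (slopeTr ψ (m.1, m.2.1)).comp (ContinuousLinearMap.fst ℝ X Y))
    (bilPull (graphDeriv₂ ψ m) (graphDerivH ψ (m.1, m.2.1)).inverse)

theorem curvTr_smooth [CompleteSpace X] {ψ : X × Y → X × Y}
    {m : (X × Y) × (X →L[ℝ] Y) × SymBilin X Y}
    (hψ : ContDiffAt ℝ ∞ ψ m.1) (h : (graphDerivH ψ (m.1, m.2.1)).IsInvertible) :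
    ContDiffAt ℝ ∞ (curvTr ψ) m := by
  have hp : ContDiffAt ℝ ∞ (fun m : (X × Y) × (X →L[ℝ] Y) × SymBilin X Y => (m.1, m.2.1)) m := by
    fun_prop
  have hinv : ContDiffAt ℝ ∞ (fun m : (X × Y) × (X →L[ℝ] Y) × SymBilin X Y =>
      (graphDerivH ψ (m.1, m.2.1)).inverse) m :=
    ContDiffAt.comp m (g := ContinuousLinearMap.inverse)
      (f := fun m : (X × Y) × (X →L[ℝ] Y) × SymBilin X Y => graphDerivH ψ (m.1, m.2.1))
      h.contDiffAt_map_inverse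
      (ContDiffAt.comp m (f := fun m : (X × Y) × (X →L[ℝ] Y) × SymBilin X Y => (m.1, m.2.1))
        (graphDerivH_smooth (m := (m.1, m.2.1)) hψ) hp)
  have hs : ContDiffAt ℝ ∞ (fun m : (X × Y) × (X →L[ℝ] Y) × SymBilin X Y =>
      slopeTr ψ (m.1, m.2.1)) m :=
    ContDiffAt.comp m (f := fun m : (X × Y) × (X →L[ℝ] Y) × SymBilin X Y => (m.1, m.2.1))
        (slopeTr_smooth (m := (m.1, m.2.1)) hψ h) hp
  have h1 : ContDiffAt ℝ ∞ (fun m : (X × Y) × (X →L[ℝ] Y) × SymBilin X Y => fderiv ℝ ψ m.1) m :=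
    ContDiffAt.comp m (hψ.fderiv_right (m := ∞) (by simp)) contDiffAt_fst
  have h2 : ContDiffAt ℝ ∞ (fun m : (X × Y) × (X →L[ℝ] Y) × SymBilin X Y =>
      fderiv ℝ (fderiv ℝ ψ) m.1) m :=
    ContDiffAt.comp m ((hψ.fderiv_right (m := ∞) (by simp)).fderiv_right (m := ∞) (by simp))
      contDiffAt_fst
  have hj : ContDiffAt ℝ ∞ (fun m : (X × Y) × (X →L[ℝ] Y) × SymBilin X Y =>
      (ContinuousLinearMap.id ℝ X).prod m.2.1) m := by
    have : (fun m : (X × Y) × (X →L[ℝ] Y) × SymBilin X Y =>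
        (ContinuousLinearMap.id ℝ X).prod m.2.1) =
      fun m => (ContinuousLinearMap.inl ℝ X Y) + (ContinuousLinearMap.inr ℝ X Y).comp m.2.1 := by
      ext m v <;> simp
    rw [this]
    exact contDiffAt_const.add (contDiffAt_const.clm_comp (by fun_prop))
  have hq : ContDiffAt ℝ ∞ (fun m : (X × Y) × (X →L[ℝ] Y) × SymBilin X Y =>
      SymBilin.incl m.2.2) m :=
    SymBilin.incl_contDiff.contDiffAt.comp m (by fun_prop)
  have h3 : ContDiffAt ℝ ∞ (graphDeriv₂ ψ) m := by
    unfold graphDeriv₂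
    exact (bilPull_contDiffAt h2 hj).add (bilPush_contDiffAt (h1.clm_comp contDiffAt_const) hq)
  unfold curvTr
  exact bilPush_contDiffAt (contDiffAt_const.sub (hs.clm_comp contDiffAt_const))
    (bilPull_contDiffAt h3 hinv)

theorem curv_tr {ψ : X × Y → X × Y} {f g : X → Y} {x : X}
    (hψ : ContDiffAt ℝ ∞ ψ (x, f x)) (hf : ContDiffAt ℝ ∞ f x)
    (hg : ContDiffAt ℝ ∞ g (ψ (x, f x)).1)
    (h : ∀ᶠ t in 𝓝 x, g (ψ (t, f t)).1 = (ψ (t, f t)).2)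
    (hi : (graphDerivH ψ ((x, f x), fderiv ℝ f x)).IsInvertible) (q : SymBilin X Y)
    (hq : (SymBilin.incl q) = fderiv ℝ (fderiv ℝ f) x) :
    fderiv ℝ (fderiv ℝ g) (ψ (x, f x)).1 = curvTr ψ ((x, f x), fderiv ℝ f x, q) := by
  have hF : ContinuousAt (fun t => (t, f t)) x := continuousAt_id.prodMk hf.continuousAt
  have hc : ContinuousAt (fun t => (ψ (t, f t)).1) x :=
    (ContinuousAt.comp (f := fun t => (t, f t)) (g := ψ) hψ.continuousAt hF).fst
  have eψ : ∀ᶠ t in 𝓝 x, DifferentiableAt ℝ ψ (t, f t) := by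
    have := (hψ.of_le (m := 2) two_le_infty).eventually (by simp)
    filter_upwards [hF.eventually this] with t ht using ht.differentiableAt (by simp)
  have ef : ∀ᶠ t in 𝓝 x, DifferentiableAt ℝ f t := by
    have := (hf.of_le (m := 2) two_le_infty).eventually (by simp)
    filter_upwards [this] with t ht using ht.differentiableAt (by simp)
  have eg : ∀ᶠ t in 𝓝 x, DifferentiableAt ℝ g (ψ (t, f t)).1 := by
    have := (hg.of_le (m := 2) two_le_infty).eventually (by simp)
    filter_upwards [hc.eventually this] with t ht using ht.differentiableAt (by simp)
  have key : ∀ᶠ t in 𝓝 x,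
      (fderiv ℝ g (ψ (t, f t)).1).comp (graphDerivH ψ ((t, f t), fderiv ℝ f t)) =
      graphDerivV ψ ((t, f t), fderiv ℝ f t) := by
    filter_upwards [eψ, ef, eg, h.eventually_nhds] with t h1 h2 h3 h4
    exact graph_chain h1 h2 h3 h4
  -- derivative of the slope of the image
  have hdf : HasFDerivAt (fderiv ℝ f) (SymBilin.incl q) x := by
    rw [hq]
    exact ((hf.fderiv_right (m := ∞) (by simp)).differentiableAt (by simp)).hasFDerivAt
  have hf1 : HasFDerivAt f (fderiv ℝ f x) x := ef.self_of_nhds.hasFDerivAt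
  have hdψ : HasFDerivAt (fderiv ℝ ψ) (fderiv ℝ (fderiv ℝ ψ) (x, f x)) (x, f x) :=
    ((hψ.fderiv_right (m := ∞) (by simp)).differentiableAt (by simp)).hasFDerivAt
  have hdg : HasFDerivAt (fderiv ℝ g) (fderiv ℝ (fderiv ℝ g) (ψ (x, f x)).1) (ψ (x, f x)).1 :=
    ((hg.fderiv_right (m := ∞) (by simp)).differentiableAt (by simp)).hasFDerivAt
  have hgr : HasFDerivAt (fun t => graphDeriv ψ ((t, f t), fderiv ℝ f t))
      (graphDeriv₂ ψ ((x, f x), fderiv ℝ f x, q)) x := by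
    have a1 : HasFDerivAt (fun t => fderiv ℝ ψ (t, f t)) _ x :=
      HasFDerivAt.comp x (f := fun t => (t, f t)) hdψ ((hasFDerivAt_id x).prodMk hf1)
    have a2 : HasFDerivAt (fun t => (ContinuousLinearMap.id ℝ X).prod (fderiv ℝ f t))
        (bilPush (ContinuousLinearMap.inr ℝ X Y) (SymBilin.incl q)) x := by
      have : (fun t => (ContinuousLinearMap.id ℝ X).prod (fderiv ℝ f t)) =
        fun t => (ContinuousLinearMap.inl ℝ X Y) +
          ContinuousLinearMap.compL ℝ X Y (X × Y) (ContinuousLinearMap.inr ℝ X Y)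
            (fderiv ℝ f t) := by
        ext m v <;> simp
      rw [this]
      exact (HasFDerivAt.comp x (ContinuousLinearMap.hasFDerivAt _) hdf).const_add _
    refine (a1.clm_comp a2).congr_fderiv ?_
    ext u v <;> simp [graphDeriv₂, bilPull_apply, bilPush_apply, add_comm]
  have hH : HasFDerivAt (fun t => graphDerivH ψ ((t, f t), fderiv ℝ f t)) _ x :=
    (hasFDerivAt_const (ContinuousLinearMap.fst ℝ X Y) x).clm_comp hgr
  have hV : HasFDerivAt (fun t => graphDerivV ψ ((t, f t), fderiv ℝ f t)) _ x :=
    (hasFDerivAt_const (ContinuousLinearMap.snd ℝ X Y) x).clm_comp hgr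
  have hG : HasFDerivAt (fun t => fderiv ℝ g (ψ (t, f t)).1) _ x :=
    HasFDerivAt.comp x (f := fun t => (ψ (t, f t)).1) hdg
      (hasFDerivAt_graph eψ.self_of_nhds ef.self_of_nhds).fst
  have hu := ((hG.clm_comp hH).congr_of_eventuallyEq (key.mono fun t ht => ht.symm)).unique hV
  have hs := slope_tr eψ.self_of_nhds ef.self_of_nhds eg.self_of_nhds h hi
  obtain ⟨a, ha⟩ := hi
  have ha' : ∀ u, (graphDeriv ψ ((x, f x), fderiv ℝ f x) u).1 = a u := fun u => by
    have := congrArg (fun T : X →L[ℝ] X => T u) ha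
    simpa [graphDerivH] using this.symm
  ext u v
  have hu' := congrArg (fun T : X →L[ℝ] X →L[ℝ] Y => T (a.symm u) (a.symm v)) hu
  have hav : graphDerivH ψ ((x, f x), fderiv ℝ f x) (a.symm v) = v := by
    rw [← ha]; simp
  simp [ha', hav] at hu'
  simp [curvTr, bilPull_apply, bilPush_apply, ← ha, ← hs]
  rw [← hu']
  simp

theorem snd_symm {f : X → Y} {x : X} (hf : ContDiffAt ℝ ∞ f x) :
    SymBilin.incl (symmetrize (fderiv ℝ (fderiv ℝ f) x)) = fderiv ℝ (fderiv ℝ f) x :=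
  incl_symmetrize (hf.isSymmSndFDerivAt (by simp [two_le_infty]))

variable (X Y) in
/-- Second jets: `D f x` is the pair of the first and second derivatives of `f`. -/
def secondJetCoord [CompleteSpace X] : JetCoord X Y 2 ((X →L[ℝ] Y) × SymBilin X Y) where
  D f x := (fderiv ℝ f x, symmetrize (fderiv ℝ (fderiv ℝ f) x))
  lin := ContinuousLinearMap.fst ℝ _ _
  P z k x := z.2 + k.1 (x - z.1) + (2⁻¹ : ℝ) • (SymBilin.incl k.2) (x - z.1) (x - z.1)
  tr ψ m := (slopeTr ψ (m.1, m.2.1), symmetrize (curvTr ψ m))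
  lin_D := rfl
  P_smooth z k := by
    have h1 : ContDiff ℝ ∞ (fun x : X => x - z.1) := contDiff_id.sub contDiff_const
    exact (contDiff_const.add (contDiff_const.clm_apply h1)).add
      (contDiff_const.smul ((contDiff_const.clm_apply h1).clm_apply h1))
  P_val z k := by simp
  P_D z k := by
    have h1 : ∀ y : X, HasFDerivAt (fun x : X => x - z.1) (ContinuousLinearMap.id ℝ X) y :=
      fun y => (hasFDerivAt_id y).sub_const z.1
    have h2 : ∀ y, HasFDerivAt (fun x => z.2 + k.1 (x - z.1) +
        (2⁻¹ : ℝ) • (SymBilin.incl k.2) (x - z.1) (x - z.1))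
        (k.1 + (SymBilin.incl k.2) (y - z.1)) y := by
      intro y
      have a1 := (HasFDerivAt.comp y (k.1.hasFDerivAt) (h1 y)).const_add z.2
      have a2 := ((HasFDerivAt.comp y ((SymBilin.incl k.2).hasFDerivAt) (h1 y)).clm_apply
        (h1 y)).const_smul (2⁻¹ : ℝ)
      refine (a1.add a2).congr_fderiv ?_
      ext v
      have := SymBilin.symm k.2 v (y - z.1)
      simp only [map_sub, sub_apply] at this
      simp [this]
      rw [← add_smul]; norm_num
    have h3 : fderiv ℝ (fun x => z.2 + k.1 (x - z.1) +
        (2⁻¹ : ℝ) • (SymBilin.incl k.2) (x - z.1) (x - z.1)) =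
        fun y => k.1 + (SymBilin.incl k.2) (y - z.1) := funext fun y => (h2 y).fderiv
    have h4 : HasFDerivAt (fun y => k.1 + (SymBilin.incl k.2) (y - z.1))
        (SymBilin.incl k.2) z.1 := by
      simpa using (HasFDerivAt.comp z.1 ((SymBilin.incl k.2).hasFDerivAt)
        (h1 z.1)).const_add k.1
    rw [h3, h4.fderiv, symmetrize_incl]
    simp
  D_iff {f g x} hf hg h := by
    constructor
    · intro H
      have e1 : fderiv ℝ f x = fderiv ℝ g x := by
        ext v
        simpa using congrArg (fun T => T (fun _ => v)) (H 1 (by norm_num))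
      have e2 : fderiv ℝ (fderiv ℝ f) x = fderiv ℝ (fderiv ℝ g) x := by
        ext u v
        simpa [iteratedFDeriv_two_apply] using congrArg (fun T => T ![u, v]) (H 2 le_rfl)
      rw [e1, e2]
    · intro H k hk
      have e1 : fderiv ℝ f x = fderiv ℝ g x := congrArg Prod.fst H
      have e2 : fderiv ℝ (fderiv ℝ f) x = fderiv ℝ (fderiv ℝ g) x := by
        rw [← snd_symm hf, ← snd_symm hg]
        exact congrArg (fun k => SymBilin.incl k.2) H
      interval_cases k
      · ext; simp [h]
      · ext v; simp [e1]
      · ext v; simp [iteratedFDeriv_two_apply, e2]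
  D_tr {ψ f g x} hψ hf hg h hi := by
    refine Prod.ext ?_ ?_
    · exact slope_tr (hψ.differentiableAt (by simp)) (hf.differentiableAt (by simp))
        (hg.differentiableAt (by simp)) h hi
    · exact congrArg (symmetrize) (curv_tr hψ hf hg h hi _ (snd_symm hf))
  tr_smooth {ψ m} hψ hi := by
    refine ContDiffAt.prodMk ?_ ?_
    · exact ContDiffAt.comp m
        (f := fun m : (X × Y) × (X →L[ℝ] Y) × SymBilin X Y => (m.1, m.2.1))
        (slopeTr_smooth (m := (m.1, m.2.1)) hψ hi) (by fun_prop)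
    · exact symmetrize_contDiff.contDiffAt.comp m (curvTr_smooth hψ hi)

end Coordinates

section Jets

variable {X Y : Type*} [NormedAddCommGroup X] [NormedSpace ℝ X]
  [NormedAddCommGroup Y] [NormedSpace ℝ Y]
  {E : Type*} [TopologicalSpace E] [ChartedSpace (X × Y) E]

/-- In the divided chart `e` of `E`, which splits the coordinates into `X` and `Y`, the set `L` is
near its point `p` the graph of the smooth function `f`. -/
structure IsGraphAt (e : OpenPartialHomeomorph E (X × Y)) (L : Set E) (p : E) (f : X → Y) :
    Prop where
  chart : e ∈ IsManifold.maximalAtlas 𝓘(ℝ, X × Y) ∞ E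
  source : p ∈ e.source
  mem : p ∈ L
  smooth : ∀ᶠ x in 𝓝 (e p).1, ContDiffAt ℝ ∞ f x
  graph : ∀ᶠ q in 𝓝 p, q ∈ L ↔ (e q).2 = f (e q).1

variable (X Y E) in
/-- An embedded submanifold of `E` of dimension `dim X`, which is locally a graph in suitable
divided charts, with a point of it. -/
structure PointedSubmanifold where
  carrier : Set E
  isSubmanifold : ∀ p ∈ carrier, ∃ (e : OpenPartialHomeomorph E (X × Y)) (f : X → Y),
    IsGraphAt e carrier p f
  pt : E
  mem : pt ∈ carrier

/-- The submanifolds `A` and `B` have contact of order `r` at their common marked point. -/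
def Contact (r : ℕ) (A B : PointedSubmanifold X Y E) : Prop :=
  A.pt = B.pt ∧ ∃ (e : OpenPartialHomeomorph E (X × Y)) (f g : X → Y),
    IsGraphAt e A.carrier A.pt f ∧ IsGraphAt e B.carrier B.pt g ∧
    ∀ k ≤ r, iteratedFDeriv ℝ k f (e A.pt).1 = iteratedFDeriv ℝ k g (e A.pt).1

variable (X Y E) in
/-- The space `J^r(E, n)` of `r`-jets of `n`-dimensional submanifolds of `E`, with `n = dim X`. -/
def Jet (r : ℕ) : Type _ := Quot (Contact (X := X) (Y := Y) (E := E) r)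

/-- The `r`-jet `[L]^r_p` of a pointed submanifold. -/
def jet (r : ℕ) (A : PointedSubmanifold X Y E) : Jet X Y E r := Quot.mk _ A

namespace IsGraphAt

variable {e e' : OpenPartialHomeomorph E (X × Y)} {L : Set E} {p : E} {f g : X → Y}

theorem val (h : IsGraphAt e L p f) : f (e p).1 = (e p).2 :=
  ((h.graph.self_of_nhds).1 h.mem).symm

theorem pair (h : IsGraphAt e L p f) : ((e p).1, f (e p).1) = e p := by rw [h.val]

theorem smoothAt (h : IsGraphAt e L p f) : ContDiffAt ℝ ∞ f (e p).1 := h.smooth.self_of_nhds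

/-- points of the graph lie in the submanifold -/
theorem tendsto_symm (h : IsGraphAt e L p f) :
    Tendsto (fun t => e.symm (t, f t)) (𝓝 (e p).1) (𝓝 p) := by
  have h1 : Tendsto (fun t => (t, f t)) (𝓝 (e p).1) (𝓝 (e p)) := by
    have := (continuousAt_id.prodMk h.smoothAt.continuousAt :
      ContinuousAt (fun t => (t, f t)) (e p).1)
    simpa [ContinuousAt, h.val] using this
  have h2 := e.continuousAt_symm (e.map_source h.source)
  rw [ContinuousAt, e.left_inv h.source] at h2
  exact h2.comp h1

theorem eventually_target (h : IsGraphAt e L p f) :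
    ∀ᶠ t in 𝓝 (e p).1, (t, f t) ∈ e.target := by
  have h1 : Tendsto (fun t => (t, f t)) (𝓝 (e p).1) (𝓝 (e p)) := by
    have := (continuousAt_id.prodMk h.smoothAt.continuousAt :
      ContinuousAt (fun t => (t, f t)) (e p).1)
    simpa [ContinuousAt, h.val] using this
  exact h1 (e.open_target.mem_nhds (e.map_source h.source))

theorem eventually_mem (h : IsGraphAt e L p f) :
    ∀ᶠ t in 𝓝 (e p).1, e.symm (t, f t) ∈ L := by
  filter_upwards [h.eventually_target, h.tendsto_symm.eventually h.graph] with t h1 h2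
  rw [h2, e.right_inv h1]

/-- The transition map -/
theorem transition_smooth (he : e ∈ IsManifold.maximalAtlas 𝓘(ℝ, X × Y) ∞ E)
    (he' : e' ∈ IsManifold.maximalAtlas 𝓘(ℝ, X × Y) ∞ E) {z : X × Y}
    (hz : z ∈ (e.symm.trans e').source) : ContDiffAt ℝ ∞ (fun w => e' (e.symm w)) z := by
  have h := (contDiffGroupoid ∞ 𝓘(ℝ, X × Y)).compatible_of_mem_maximalAtlas he he'
  rw [contDiffGroupoid, mem_groupoid_of_pregroupoid] at h
  have h1 := h.1
  simp only [contDiffPregroupoid, modelWithCornersSelf_coe, modelWithCornersSelf_coe_symm,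
    Set.range_id, Set.inter_univ, Set.preimage_id, Function.comp_id, Function.id_comp] at h1
  exact h1.contDiffAt ((e.symm.trans e').open_source.mem_nhds hz)

/-- The change of divided charts. -/
theorem mem_trans_source (hs : p ∈ e.source) (hs' : p ∈ e'.source) :
    e p ∈ (e.symm.trans e').source := by
  simp [hs, hs', e.map_source hs]

theorem trans_eq (h : IsGraphAt e L p f) (h' : IsGraphAt e' L p g) :
    ∀ᶠ t in 𝓝 (e p).1, g (e' (e.symm (t, f t))).1 = (e' (e.symm (t, f t))).2 := by
  filter_upwards [h.eventually_mem, h.tendsto_symm.eventually h'.graph] with t h1 h2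
  exact (h2.1 h1).symm

theorem smooth_trans (h : IsGraphAt e L p f)
    (he' : e' ∈ IsManifold.maximalAtlas 𝓘(ℝ, X × Y) ∞ E) (hs' : p ∈ e'.source) :
    ContDiffAt ℝ ∞ (fun w => e' (e.symm w)) ((e p).1, f (e p).1) := by
  rw [h.pair]
  exact transition_smooth h.chart he' (mem_trans_source h.source hs')

theorem trans_val (h : IsGraphAt e L p f) : e' (e.symm ((e p).1, f (e p).1)) = e' p := by
  rw [h.pair, e.left_inv h.source]

theorem hasFDerivAt_trans (h : IsGraphAt e L p f)
    (he' : e' ∈ IsManifold.maximalAtlas 𝓘(ℝ, X × Y) ∞ E) (hs' : p ∈ e'.source) :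
    HasFDerivAt (fun t => (e' (e.symm (t, f t))).1)
      (graphDerivH (fun w => e' (e.symm w)) (e p, fderiv ℝ f (e p).1)) (e p).1 := by
  have := (hasFDerivAt_graph ((h.smooth_trans he' hs').differentiableAt (by simp))
    (h.smoothAt.differentiableAt (by simp))).fst
  rw [h.pair] at this
  exact this

theorem inverse_aux (h : IsGraphAt e L p f) (h' : IsGraphAt e' L p g) :
    (graphDerivH (fun w => e (e'.symm w)) (e' p, fderiv ℝ g (e' p).1)).comp
      (graphDerivH (fun w => e' (e.symm w)) (e p, fderiv ℝ f (e p).1)) =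
      ContinuousLinearMap.id ℝ X := by
  have h1 := h.hasFDerivAt_trans h'.chart h'.source
  have h2 := h'.hasFDerivAt_trans h.chart h.source
  have h3 : HasFDerivAt (fun t => (e (e'.symm ((e' (e.symm (t, f t))).1,
      g (e' (e.symm (t, f t))).1))).1) _ (e p).1 :=
    HasFDerivAt.comp (e p).1 (g := fun t => (e (e'.symm (t, g t))).1)
      (f := fun t => (e' (e.symm (t, f t))).1) (by simpa [h.trans_val] using h2) h1
  refine (h3.congr_of_eventuallyEq (f₁ := fun t => t) ?_).unique (hasFDerivAt_id _)
  filter_upwards [h.trans_eq h', h.eventually_target,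
    h.tendsto_symm.eventually (e'.open_source.mem_nhds h'.source)] with t h4 h5 h6
  rw [h4, Prod.mk.eta, e'.left_inv h6, e.right_inv h5]

theorem invertible (h : IsGraphAt e L p f) (h' : IsGraphAt e' L p g) :
    (graphDerivH (fun w => e' (e.symm w)) (e p, fderiv ℝ f (e p).1)).IsInvertible :=
  ⟨ContinuousLinearEquiv.equivOfInverse
    (graphDerivH (fun w => e' (e.symm w)) (e p, fderiv ℝ f (e p).1))
    (graphDerivH (fun w => e (e'.symm w)) (e' p, fderiv ℝ g (e' p).1))
    (fun v => congrArg (fun T : X →L[ℝ] X => T v) (inverse_aux h h'))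
    (fun v => congrArg (fun T : X →L[ℝ] X => T v) (inverse_aux h' h)), rfl⟩

theorem D_trans {r : ℕ} {K : Type*} [NormedAddCommGroup K] [NormedSpace ℝ K]
    (J : JetCoord X Y r K) (h : IsGraphAt e L p f) (h' : IsGraphAt e' L p g) :
    J.D g (e' p).1 = J.tr (fun w => e' (e.symm w)) (e p, J.D f (e p).1) := by
  have := J.D_tr (ψ := fun w => e' (e.symm w)) (f := f) (g := g) (x := (e p).1)
    (h.smooth_trans h'.chart h'.source) h.smoothAt (by simpa [h.trans_val] using h'.smoothAt)
    (h.trans_eq h') (by rw [h.pair]; exact h.invertible h')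
  rw [h.pair, e.left_inv h.source] at this
  exact this

theorem exists_graph [CompleteSpace X] (h : IsGraphAt e L p f)
    (he' : e' ∈ IsManifold.maximalAtlas 𝓘(ℝ, X × Y) ∞ E) (hs' : p ∈ e'.source)
    (hi : (graphDerivH (fun w => e' (e.symm w)) (e p, fderiv ℝ f (e p).1)).IsInvertible) :
    ∃ g, IsGraphAt e' L p g := by
  obtain ⟨a, ha⟩ := hi
  have hd := h.hasFDerivAt_trans he' hs'
  rw [← ha] at hd
  have hg : ContDiffAt ℝ ∞ (fun t => (t, f t)) (e p).1 := contDiffAt_id.prodMk h.smoothAt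
  have hΦ : ContDiffAt ℝ ∞ (fun t => e' (e.symm (t, f t))) (e p).1 :=
    ContDiffAt.comp (e p).1 (g := fun w => e' (e.symm w)) (f := fun t => (t, f t))
      (h.smooth_trans he' hs') hg
  have hΦ1 : ContDiffAt ℝ ∞ (fun t => (e' (e.symm (t, f t))).1) (e p).1 := hΦ.fst
  set Φ : OpenPartialHomeomorph X X := hΦ1.toOpenPartialHomeomorph _ hd (by simp) with hΦdef
  have hΦc : ∀ t, Φ t = (e' (e.symm (t, f t))).1 := fun t => rfl
  have hx : (e p).1 ∈ Φ.source := hΦ1.mem_toOpenPartialHomeomorph_source hd (by simp)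
  have hΦp : Φ (e p).1 = (e' p).1 := by rw [hΦc, h.trans_val]
  have hy : (e' p).1 ∈ Φ.target := hΦp ▸ Φ.map_source hx
  have hsy : Φ.symm (e' p).1 = (e p).1 := by rw [← hΦp, Φ.left_inv hx]
  -- smoothness of the inverse near the point
  have evS : ∀ᶠ t in 𝓝 (e p).1, t ∈ Φ.source ∧ ContDiffAt ℝ ∞ f t ∧
      (t, f t) ∈ (e.symm.trans e').source ∧
      (graphDerivH (fun w => e' (e.symm w)) ((t, f t), fderiv ℝ f t)).IsInvertible := by
    have e1 := Φ.open_source.mem_nhds hx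
    have e2 : ∀ᶠ t in 𝓝 (e p).1, (t, f t) ∈ (e.symm.trans e').source := by
      have : Tendsto (fun t => (t, f t)) (𝓝 (e p).1) (𝓝 (e p)) := by
        simpa [ContinuousAt, h.val] using hg.continuousAt
      exact this ((e.symm.trans e').open_source.mem_nhds (mem_trans_source h.source hs'))
    have e3 : ∀ᶠ t in 𝓝 (e p).1,
        (graphDerivH (fun w => e' (e.symm w)) ((t, f t), fderiv ℝ f t)).IsInvertible := by
      have c1 : ContinuousAt (fun t => ((t, f t), fderiv ℝ f t)) (e p).1 :=
        hg.continuousAt.prodMk (h.smoothAt.fderiv_right (m := ∞) (by simp)).continuousAt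
      have c2 : ContinuousAt (fun t => graphDerivH (fun w => e' (e.symm w))
          ((t, f t), fderiv ℝ f t)) (e p).1 :=
        ContinuousAt.comp (f := fun t => ((t, f t), fderiv ℝ f t))
          (graphDerivH_smooth (h.smooth_trans he' hs')).continuousAt c1
      have hm : graphDerivH (fun w => e' (e.symm w)) (((e p).1, f (e p).1), fderiv ℝ f (e p).1)
          ∈ range ((↑) : (X ≃L[ℝ] X) → (X →L[ℝ] X)) := ⟨a, by rw [h.pair]; exact ha⟩
      filter_upwards [c2 (ContinuousLinearEquiv.isOpen.mem_nhds hm)] with t ht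
      obtain ⟨b, hb⟩ := ht
      exact ⟨b, hb⟩
    filter_upwards [e1, h.smooth, e2, e3] with t h1 h2 h3 h4 using ⟨h1, h2, h3, h4⟩
  have evT : ∀ᶠ y in 𝓝 (e' p).1, y ∈ Φ.target ∧ (Φ.symm y ∈ Φ.source ∧
      ContDiffAt ℝ ∞ f (Φ.symm y) ∧
      (Φ.symm y, f (Φ.symm y)) ∈ (e.symm.trans e').source ∧
      (graphDerivH (fun w => e' (e.symm w))
        ((Φ.symm y, f (Φ.symm y)), fderiv ℝ f (Φ.symm y))).IsInvertible) := by
    refine (Φ.open_target.eventually_mem hy).and ?_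
    have := Φ.continuousAt_symm hy
    rw [ContinuousAt, hsy] at this
    exact this.eventually evS
  have hge : Tendsto (fun q => (e' q).1) (𝓝 p) (𝓝 (e' p).1) :=
    (e'.continuousAt hs').fst
  have hee : Tendsto (fun q => (e q).1) (𝓝 p) (𝓝 (e p).1) :=
    (e.continuousAt h.source).fst
  refine ⟨fun y => (e' (e.symm (Φ.symm y, f (Φ.symm y)))).2, he', hs', h.mem, ?_, ?_⟩
  · filter_upwards [evT] with y hy
    obtain ⟨h1, h2, h3, h4, b, hb⟩ := hy
    have s1 : ContDiffAt ℝ ∞ (fun w => e' (e.symm w)) (Φ.symm y, f (Φ.symm y)) :=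
      transition_smooth h.chart he' h4
    have s2 : ContDiffAt ℝ ∞ (fun t => e' (e.symm (t, f t))) (Φ.symm y) :=
      ContDiffAt.comp (Φ.symm y) (g := fun w => e' (e.symm w)) (f := fun t => (t, f t)) s1
        (contDiffAt_id.prodMk h3)
    have s3 : HasFDerivAt Φ (b : X →L[ℝ] X) (Φ.symm y) := by
      rw [hb]
      exact (hasFDerivAt_graph (ψ := fun w => e' (e.symm w)) (s1.differentiableAt (by simp))
        (h3.differentiableAt (by simp))).fst
    have s4 : ContDiffAt ℝ ∞ Φ.symm y := Φ.contDiffAt_symm h1 s3 s2.fst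
    exact (ContDiffAt.comp y (f := Φ.symm) s2 s4).snd
  · filter_upwards [h.graph, e.open_source.mem_nhds h.source, e'.open_source.mem_nhds hs',
      hee.eventually (Φ.open_source.mem_nhds hx), hge.eventually evT] with q h1 h2 h3 h4 h5
    obtain ⟨h5, h6, -, h7, -⟩ := h5
    rw [h1]
    constructor
    · intro hq
      have e1 : e.symm ((e q).1, f (e q).1) = q := by rw [← hq, Prod.mk.eta, e.left_inv h2]
      have e2 : Φ (e q).1 = (e' q).1 := by rw [hΦc, e1]
      have e3 : Φ.symm (e' q).1 = (e q).1 := by rw [← e2, Φ.left_inv h4]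
      simp only [e3, e1]
    · intro hq
      have e1 : Φ (Φ.symm (e' q).1) = (e' q).1 := Φ.right_inv h5
      rw [hΦc] at e1
      have e2 : e' (e.symm (Φ.symm (e' q).1, f (Φ.symm (e' q).1))) = e' q := Prod.ext e1 hq.symm
      simp only [OpenPartialHomeomorph.trans_source, OpenPartialHomeomorph.symm_source, mem_inter_iff,
        mem_preimage] at h7
      have e3 := e'.injOn h7.2 h3 e2
      have e4 : e q = (Φ.symm (e' q).1, f (Φ.symm (e' q).1)) := by
        have := e.right_inv h7.1
        rwa [e3] at this
      rw [e4]

end IsGraphAt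

section Charts

variable {r : ℕ} {K : Type*} [NormedAddCommGroup K] [NormedSpace ℝ K]

/-- `m` are the coordinates of the `r`-jet of `A` in the divided chart `e`. -/
def IsCoord (J : JetCoord X Y r K) (e : OpenPartialHomeomorph E (X × Y))
    (A : PointedSubmanifold X Y E) (m : (X × Y) × K) : Prop :=
  ∃ f, IsGraphAt e A.carrier A.pt f ∧ m = (e A.pt, J.D f (e A.pt).1)

theorem Contact.symm {A B : PointedSubmanifold X Y E} (h : Contact r A B) : Contact r B A := by
  obtain ⟨hp, e, f, g, hf, hg, hk⟩ := h
  exact ⟨hp.symm, e, g, f, hg, hf, fun k hkr => by rw [← hp]; exact (hk k hkr).symm⟩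

theorem IsCoord.of_contact [CompleteSpace X] {J : JetCoord X Y r K}
    {e' : OpenPartialHomeomorph E (X × Y)}
    {A B : PointedSubmanifold X Y E} (h : Contact r A B) {m : (X × Y) × K}
    (hm : IsCoord J e' A m) : IsCoord J e' B m := by
  obtain ⟨hp, e, f, g, hf, hg, hk⟩ := h
  obtain ⟨f', hf', rfl⟩ := hm
  have hD : J.D f (e A.pt).1 = J.D g (e A.pt).1 :=
    (J.D_iff hf.smoothAt (by simpa [hp] using hg.smoothAt)
      (by rw [hf.val, hp, hg.val])).1 hk
  have hinv := hf.invertible hf'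
  rw [← J.lin_D, hD, J.lin_D, hp] at hinv
  obtain ⟨g', hg'⟩ := hg.exists_graph hf'.chart (hp ▸ hf'.source) hinv
  refine ⟨g', hg', ?_⟩
  rw [hf.D_trans J hf', hg.D_trans J hg', hD, hp]

theorem IsCoord.unique {J : JetCoord X Y r K} {e : OpenPartialHomeomorph E (X × Y)}
    {A : PointedSubmanifold X Y E} {m m' : (X × Y) × K}
    (h : IsCoord J e A m) (h' : IsCoord J e A m') : m = m' := by
  obtain ⟨f, hf, rfl⟩ := h
  obtain ⟨f', hf', rfl⟩ := h'
  rw [hf.D_trans J hf, hf.D_trans J hf']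

theorem IsCoord.contact {J : JetCoord X Y r K} {e : OpenPartialHomeomorph E (X × Y)}
    {A B : PointedSubmanifold X Y E} {m : (X × Y) × K}
    (h : IsCoord J e A m) (h' : IsCoord J e B m) : Contact r A B := by
  obtain ⟨f, hf, rfl⟩ := h
  obtain ⟨g, hg, hm⟩ := h'
  have h1 : e A.pt = e B.pt := congrArg Prod.fst hm
  have h2 : J.D f (e A.pt).1 = J.D g (e B.pt).1 := congrArg Prod.snd hm
  refine ⟨e.injOn hf.source hg.source h1, e, f, g, hf, hg, ?_⟩
  exact (J.D_iff hf.smoothAt (by simpa [h1] using hg.smoothAt)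
    (by rw [hf.val, h1, hg.val])).2 (by rw [h2, h1])

/-- `m` are the coordinates of the jet `θ` in the divided chart `e`. -/
def HasCoord [CompleteSpace X] (J : JetCoord X Y r K) (e : OpenPartialHomeomorph E (X × Y)) :
    Jet X Y E r → (X × Y) × K → Prop :=
  Quot.lift (IsCoord J e) fun _ _ h => funext fun _ =>
    propext ⟨fun hm => hm.of_contact h, fun hm => hm.of_contact h.symm⟩

theorem HasCoord.unique [CompleteSpace X] {J : JetCoord X Y r K}
    {e : OpenPartialHomeomorph E (X × Y)} {θ : Jet X Y E r} {m m' : (X × Y) × K}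
    (h : HasCoord J e θ m) (h' : HasCoord J e θ m') : m = m' := by
  induction θ using Quot.ind
  exact IsCoord.unique h h'

theorem HasCoord.inj [CompleteSpace X] {J : JetCoord X Y r K}
    {e : OpenPartialHomeomorph E (X × Y)} {θ θ' : Jet X Y E r} {m : (X × Y) × K}
    (h : HasCoord J e θ m) (h' : HasCoord J e θ' m) : θ = θ' := by
  induction θ using Quot.ind
  induction θ' using Quot.ind
  exact Quot.sound (IsCoord.contact h h')

/-- The submanifold which is the graph of `J.P z k` in the divided chart `e`. -/
def polySub (J : JetCoord X Y r K) (e : OpenPartialHomeomorph E (X × Y))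
    (he : e ∈ IsManifold.maximalAtlas 𝓘(ℝ, X × Y) ∞ E) (m : (X × Y) × K) (hm : m.1 ∈ e.target) :
    PointedSubmanifold X Y E where
  carrier := {q | q ∈ e.source ∧ (e q).2 = J.P m.1 m.2 (e q).1}
  isSubmanifold p hp := ⟨e, J.P m.1 m.2, he, hp.1, hp,
    Eventually.of_forall fun _ => (J.P_smooth _ _).contDiffAt, by
      filter_upwards [e.open_source.mem_nhds hp.1] with q hq
      exact ⟨fun h => h.2, fun h => ⟨hq, h⟩⟩⟩
  pt := e.symm m.1
  mem := ⟨e.map_target hm, by rw [e.right_inv hm, J.P_val]⟩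

theorem polySub_graph (J : JetCoord X Y r K) (e : OpenPartialHomeomorph E (X × Y))
    (he : e ∈ IsManifold.maximalAtlas 𝓘(ℝ, X × Y) ∞ E) (m : (X × Y) × K) (hm : m.1 ∈ e.target) :
    IsGraphAt e (polySub J e he m hm).carrier (polySub J e he m hm).pt (J.P m.1 m.2) :=
  ⟨he, e.map_target hm, (polySub J e he m hm).mem,
    Eventually.of_forall fun _ => (J.P_smooth _ _).contDiffAt, by
      filter_upwards [e.open_source.mem_nhds (e.map_target hm)] with q hq
      exact ⟨fun h => h.2, fun h => ⟨hq, h⟩⟩⟩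

theorem polySub_coord (J : JetCoord X Y r K) (e : OpenPartialHomeomorph E (X × Y))
    (he : e ∈ IsManifold.maximalAtlas 𝓘(ℝ, X × Y) ∞ E) (m : (X × Y) × K) (hm : m.1 ∈ e.target) :
    IsCoord J e (polySub J e he m hm) m := by
  refine ⟨_, polySub_graph J e he m hm, ?_⟩
  have : e (polySub J e he m hm).pt = m.1 := e.right_inv hm
  rw [this, J.P_D]

variable [IsManifold 𝓘(ℝ, X × Y) ∞ E]

open Classical in
/-- The chart of the jet space which is induced by the divided chart `e` of `E`. -/
def jetChart [CompleteSpace X] (J : JetCoord X Y r K) (e : OpenPartialHomeomorph E (X × Y))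
    (he : e ∈ IsManifold.maximalAtlas 𝓘(ℝ, X × Y) ∞ E) :
    PartialEquiv (Jet X Y E r) ((X × Y) × K) where
  toFun θ := if h : ∃ m, HasCoord J e θ m then h.choose else 0
  invFun m := if h : m.1 ∈ e.target then jet r (polySub J e he m h) else
    jet r (polySub J (chartAt (X × Y) (e.symm m.1)) (IsManifold.chart_mem_maximalAtlas _)
      (chartAt (X × Y) (e.symm m.1) (e.symm m.1), 0) (mem_chart_target _ _))
  source := {θ | ∃ m, HasCoord J e θ m}
  target := {m | m.1 ∈ e.target}
  map_source' θ hθ := by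
    have h := hθ.choose_spec
    simp only [mem_ofPred_eq] at hθ ⊢
    rw [dif_pos hθ]
    induction θ using Quot.ind
    obtain ⟨f, hf, hm⟩ := h
    rw [hm]
    exact e.map_source hf.source
  map_target' m hm := by
    simp only [mem_ofPred_eq] at hm ⊢
    rw [dif_pos hm]
    exact ⟨m, polySub_coord J e he m hm⟩
  left_inv' θ hθ := by
    have h := hθ.choose_spec
    simp only [mem_ofPred_eq] at hθ
    have ht : (Exists.choose hθ).1 ∈ e.target := by
      induction θ using Quot.ind
      obtain ⟨f, hf, hm⟩ := h
      rw [hm]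
      exact e.map_source hf.source
    rw [dif_pos hθ, dif_pos ht]
    exact HasCoord.inj (polySub_coord J e he _ ht) h
  right_inv' m hm := by
    simp only [mem_ofPred_eq] at hm
    rw [dif_pos hm]
    have h : ∃ m', HasCoord J e (jet r (polySub J e he m hm)) m' :=
      ⟨m, polySub_coord J e he m hm⟩
    rw [dif_pos h]
    exact HasCoord.unique h.choose_spec (polySub_coord J e he m hm)

theorem jetChart_apply [CompleteSpace X] {J : JetCoord X Y r K}
    {e : OpenPartialHomeomorph E (X × Y)} (he : e ∈ IsManifold.maximalAtlas 𝓘(ℝ, X × Y) ∞ E)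
    {θ : Jet X Y E r} {m : (X × Y) × K} (h : HasCoord J e θ m) : jetChart J e he θ = m := by
  have h' : ∃ m, HasCoord J e θ m := ⟨m, h⟩
  simp only [jetChart]
  rw [dif_pos h']
  exact h'.choose_spec.unique h

open Classical in
theorem jetChart_symm_apply [CompleteSpace X] {J : JetCoord X Y r K}
    {e : OpenPartialHomeomorph E (X × Y)} (he : e ∈ IsManifold.maximalAtlas 𝓘(ℝ, X × Y) ∞ E)
    {m : (X × Y) × K} (hm : m.1 ∈ e.target) :
    (jetChart J e he).symm m = jet r (polySub J e he m hm) := by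
  change (if h : m.1 ∈ e.target then jet r (polySub J e he m h) else _) = _
  rw [dif_pos hm]

theorem jetChart_trans_source [CompleteSpace X] {J : JetCoord X Y r K}
    {e e' : OpenPartialHomeomorph E (X × Y)}
    (he : e ∈ IsManifold.maximalAtlas 𝓘(ℝ, X × Y) ∞ E)
    (he' : e' ∈ IsManifold.maximalAtlas 𝓘(ℝ, X × Y) ∞ E) :
    ((jetChart J e he).symm.trans (jetChart J e' he')).source =
      {m | m.1 ∈ (e.symm.trans e').source} ∩
        (fun m => graphDerivH (fun w => e' (e.symm w)) (m.1, J.lin m.2)) ⁻¹'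
          range ((↑) : (X ≃L[ℝ] X) → (X →L[ℝ] X)) := by
  ext m
  have hmem : m ∈ ((jetChart J e he).symm.trans (jetChart J e' he')).source ↔
      m.1 ∈ e.target ∧ ∃ m', HasCoord J e' ((jetChart J e he).symm m) m' := by
    rw [PartialEquiv.trans_source]; rfl
  rw [hmem]
  constructor
  · rintro ⟨h1, m', h2⟩
    rw [jetChart_symm_apply he h1] at h2
    obtain ⟨g, hg, -⟩ := h2
    have hP := polySub_graph J e he m h1
    refine ⟨?_, ?_⟩
    · have := hg.source
      simp only [mem_ofPred_eq, OpenPartialHomeomorph.trans_source,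
        OpenPartialHomeomorph.symm_source]
      exact ⟨h1, this⟩
    · have h3 := hP.invertible hg
      have h4 : e (polySub J e he m h1).pt = m.1 := e.right_inv h1
      rw [h4, ← J.lin_D, J.P_D] at h3
      exact h3
  · rintro ⟨h1, h2⟩
    simp only [mem_ofPred_eq, OpenPartialHomeomorph.trans_source,
        OpenPartialHomeomorph.symm_source] at h1
    refine ⟨h1.1, ?_⟩
    rw [jetChart_symm_apply he h1.1]
    have hP := polySub_graph J e he m h1.1
    have h4 : e (polySub J e he m h1.1).pt = m.1 := e.right_inv h1.1
    obtain ⟨g, hg⟩ := hP.exists_graph he' h1.2 (by rw [h4, ← J.lin_D, J.P_D]; exact h2)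
    exact ⟨_, g, hg, rfl⟩

theorem jetChart_trans_apply [CompleteSpace X] {J : JetCoord X Y r K}
    {e e' : OpenPartialHomeomorph E (X × Y)}
    (he : e ∈ IsManifold.maximalAtlas 𝓘(ℝ, X × Y) ∞ E)
    (he' : e' ∈ IsManifold.maximalAtlas 𝓘(ℝ, X × Y) ∞ E) {m : (X × Y) × K}
    (hm : m ∈ ((jetChart J e he).symm.trans (jetChart J e' he')).source) :
    (jetChart J e he).symm.trans (jetChart J e' he') m =
      (e' (e.symm m.1), J.tr (fun w => e' (e.symm w)) m) := by
  rw [PartialEquiv.trans_source] at hm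
  obtain ⟨h1, m', h2⟩ := hm
  have h1 : m.1 ∈ e.target := h1
  rw [PartialEquiv.trans_apply]
  rw [jetChart_apply he' h2]
  rw [jetChart_symm_apply he h1] at h2
  obtain ⟨g, hg, rfl⟩ := h2
  have hP := polySub_graph J e he m h1
  have h4 : e (polySub J e he m h1).pt = m.1 := e.right_inv h1
  rw [hP.D_trans J hg, h4, J.P_D]
  rfl

theorem jetChart_trans_contDiffOn [CompleteSpace X] {J : JetCoord X Y r K}
    {e e' : OpenPartialHomeomorph E (X × Y)}
    (he : e ∈ IsManifold.maximalAtlas 𝓘(ℝ, X × Y) ∞ E)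
    (he' : e' ∈ IsManifold.maximalAtlas 𝓘(ℝ, X × Y) ∞ E) :
    ContDiffOn ℝ ∞ ((jetChart J e he).symm.trans (jetChart J e' he'))
      ((jetChart J e he).symm.trans (jetChart J e' he')).source := by
  refine ContDiffOn.congr (f := fun m => (e' (e.symm m.1), J.tr (fun w => e' (e.symm w)) m)) ?_
    fun m hm => jetChart_trans_apply he he' hm
  rw [jetChart_trans_source]
  rintro m ⟨h1, h2⟩
  have hψ : ContDiffAt ℝ ∞ (fun w => e' (e.symm w)) m.1 :=
    IsGraphAt.transition_smooth he he' h1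
  exact ((ContDiffAt.comp m hψ contDiffAt_fst).prodMk (J.tr_smooth hψ h2)).contDiffWithinAt

theorem isOpen_jetChart_trans_source [CompleteSpace X] {J : JetCoord X Y r K}
    {e e' : OpenPartialHomeomorph E (X × Y)}
    (he : e ∈ IsManifold.maximalAtlas 𝓘(ℝ, X × Y) ∞ E)
    (he' : e' ∈ IsManifold.maximalAtlas 𝓘(ℝ, X × Y) ∞ E) :
    IsOpen ((jetChart J e he).symm.trans (jetChart J e' he')).source := by
  rw [jetChart_trans_source]
  refine ContinuousOn.isOpen_inter_preimage ?_
    ((e.symm.trans e').open_source.preimage continuous_fst) ContinuousLinearEquiv.isOpen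
  intro m hm
  have hψ : ContDiffAt ℝ ∞ (fun w => e' (e.symm w)) m.1 :=
    IsGraphAt.transition_smooth he he' hm
  exact (ContinuousAt.comp (f := fun m : (X × Y) × K => (m.1, J.lin m.2))
    (graphDerivH_smooth (m := (m.1, J.lin m.2)) hψ).continuousAt
    (by fun_prop)).continuousWithinAt

theorem exists_jetChart [CompleteSpace X] (J : JetCoord X Y r K) (θ : Jet X Y E r) :
    ∃ (e : OpenPartialHomeomorph E (X × Y))
      (he : e ∈ IsManifold.maximalAtlas 𝓘(ℝ, X × Y) ∞ E), θ ∈ (jetChart J e he).source := by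
  induction θ using Quot.ind with
  | mk A =>
    obtain ⟨e, f, hf⟩ := A.isSubmanifold A.pt A.mem
    exact ⟨e, hf.chart, _, f, hf, rfl⟩

variable (E) in
/-- The atlas of the jet space which consists of all charts induced by divided charts. -/
def jetCore [CompleteSpace X] (J : JetCoord X Y r K) :
    ChartedSpaceCore ((X × Y) × K) (Jet X Y E r) where
  atlas := {c | ∃ (e : OpenPartialHomeomorph E (X × Y))
    (he : e ∈ IsManifold.maximalAtlas 𝓘(ℝ, X × Y) ∞ E), c = jetChart J e he}
  chartAt θ := jetChart J (exists_jetChart J θ).choose (exists_jetChart J θ).choose_spec.choose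
  mem_chart_source θ := (exists_jetChart J θ).choose_spec.choose_spec
  chart_mem_atlas θ := ⟨_, _, rfl⟩
  open_source := by
    rintro _ _ ⟨e, he, rfl⟩ ⟨e', he', rfl⟩
    exact isOpen_jetChart_trans_source he he'
  continuousOn_toFun := by
    rintro _ _ ⟨e, he, rfl⟩ ⟨e', he', rfl⟩
    exact (jetChart_trans_contDiffOn he he').continuousOn

variable (E) in
theorem jetCore_isManifold [CompleteSpace X] (J : JetCoord X Y r K) :
    letI := (jetCore E J).toTopologicalSpace
    letI := (jetCore E J).toChartedSpace
    IsManifold 𝓘(ℝ, (X × Y) × K) ∞ (Jet X Y E r) := by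
  let := (jetCore E J).toTopologicalSpace
  let := (jetCore E J).toChartedSpace
  refine isManifold_of_contDiffOn _ _ _ fun c c' hc hc' => ?_
  obtain ⟨_, ⟨_, rfl⟩, hc⟩ := hc
  obtain ⟨_, ⟨_, rfl⟩, hc'⟩ := hc'
  simp only [mem_iUnion, mem_singleton_iff] at hc hc'
  obtain ⟨⟨e, he, rfl⟩, rfl⟩ := hc
  obtain ⟨⟨e', he', rfl⟩, rfl⟩ := hc'
  simp only [modelWithCornersSelf_coe, modelWithCornersSelf_coe_symm, range_id, inter_univ,
    preimage_id, Function.comp_id, Function.id_comp]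
  exact jetChart_trans_contDiffOn (J := J) he he'

end Charts

section Instances

variable [CompleteSpace X] [IsManifold 𝓘(ℝ, X × Y) ∞ E]

instance : TopologicalSpace (Jet X Y E 1) :=
  (jetCore E (firstJetCoord X Y)).toTopologicalSpace

instance : ChartedSpace ((X × Y) × (X →L[ℝ] Y)) (Jet X Y E 1) :=
  (jetCore E (firstJetCoord X Y)).toChartedSpace

instance : IsManifold 𝓘(ℝ, (X × Y) × (X →L[ℝ] Y)) ∞ (Jet X Y E 1) :=
  jetCore_isManifold E (firstJetCoord X Y)

instance : TopologicalSpace (Jet X Y E 2) :=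
  (jetCore E (secondJetCoord X Y)).toTopologicalSpace

instance : ChartedSpace ((X × Y) × (X →L[ℝ] Y) × SymBilin X Y) (Jet X Y E 2) :=
  (jetCore E (secondJetCoord X Y)).toChartedSpace

instance : IsManifold 𝓘(ℝ, (X × Y) × (X →L[ℝ] Y) × SymBilin X Y) ∞ (Jet X Y E 2) :=
  jetCore_isManifold E (secondJetCoord X Y)

end Instances

end Jets


section Distributions

variable {V N : Type*} [NormedAddCommGroup V] [NormedSpace ℝ V] [TopologicalSpace N]
  [ChartedSpace V N]

/-- The tangent space at `p` of an embedded submanifold `S` of the manifold `N`, spanned by the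
velocities at `p` of the smooth curves of `N` which lie in `S` (Mathlib's `TangentSpace` at a point
is the model space `V`, so that the velocity at `γ 0 = p` is an element of `V`). -/
def tangentTo (S : Set N) (p : N) : Submodule ℝ (TangentSpace 𝓘(ℝ, V) p) :=
  Submodule.span ℝ {v | ∃ γ : ℝ → N, ContMDiff 𝓘(ℝ, ℝ) 𝓘(ℝ, V) ∞ γ ∧ (∀ t, γ t ∈ S) ∧ γ 0 = p ∧
    (mfderiv 𝓘(ℝ, ℝ) 𝓘(ℝ, V) γ 0 (1 : ℝ) : V) = v}

/-- `F` is smooth near the point `s` of `D`, and agrees near `s` with the map `φ` from the subset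
`D` of `N` to itself. -/
structure IsLocalExtension (D : Set N) (φ : D → D) (s : D) (F : N → N) : Prop where
  smooth : ∀ᶠ x in 𝓝 (s : N), ContMDiffAt 𝓘(ℝ, V) 𝓘(ℝ, V) ∞ F x
  agree : ∀ᶠ x in 𝓝 (s : N), ∀ hx : x ∈ D, F x = φ ⟨x, hx⟩

/-- `φ` is a smooth map from the submanifold `D` to itself, whose tangent map sends the
distribution `p ↦ C p ∩ T_p D` onto itself. -/
def PreservesDistribution (D : Set N) (C : ∀ p : N, Submodule ℝ (TangentSpace 𝓘(ℝ, V) p))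
    (φ : D → D) : Prop :=
  ∀ s : D, ∃ F : N → N, IsLocalExtension (V := V) D φ s F ∧
    (C s ⊓ tangentTo D s).map (mfderiv 𝓘(ℝ, V) 𝓘(ℝ, V) F s).toLinearMap =
      C (F s) ⊓ tangentTo D (F s)

theorem IsLocalExtension.apply {D : Set N} {φ : D → D} {s : D} {F : N → N}
    (h : IsLocalExtension (V := V) D φ s F) : F s = φ s :=
  h.agree.self_of_nhds s.2

theorem IsLocalExtension.comp {D : Set N} {φ ψ : D → D} {s : D} {F G : N → N}
    (hF : IsLocalExtension (V := V) D φ s F) (hG : IsLocalExtension (V := V) D ψ (φ s) G) :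
    IsLocalExtension (V := V) D (ψ ∘ φ) s (G ∘ F) := by
  have hc : Tendsto F (𝓝 (s : N)) (𝓝 (φ s : N)) := by
    rw [← hF.apply]
    exact hF.smooth.self_of_nhds.continuousAt
  refine ⟨?_, ?_⟩
  · filter_upwards [hF.smooth, hc.eventually hG.smooth] with x h1 h2
    exact ContMDiffAt.comp x h2 h1
  · filter_upwards [hF.agree, hc.eventually hG.agree] with x h1 h2 hx
    have h3 := h1 hx
    have h4 : F x ∈ D := h3 ▸ (φ ⟨x, hx⟩).2
    have h5 := h2 h4
    have h6 : (⟨F x, h4⟩ : D) = φ ⟨x, hx⟩ := Subtype.ext h3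
    rw [h6] at h5
    exact h5

theorem PreservesDistribution.comp {D : Set N}
    {C : ∀ p : N, Submodule ℝ (TangentSpace 𝓘(ℝ, V) p)} {φ ψ : D → D}
    (hφ : PreservesDistribution D C φ) (hψ : PreservesDistribution D C ψ) :
    PreservesDistribution D C (ψ ∘ φ) := by
  intro s
  obtain ⟨F, hF, hFC⟩ := hφ s
  obtain ⟨G, hG, hGC⟩ := hψ (φ s)
  refine ⟨G ∘ F, hF.comp hG, ?_⟩
  have h1 := hF.apply
  rw [← h1] at hGC
  have h2 : MDifferentiableAt 𝓘(ℝ, V) 𝓘(ℝ, V) G (F s) := by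
    rw [h1]; exact hG.smooth.self_of_nhds.mdifferentiableAt (by simp)
  rw [mfderiv_comp _ h2 (hF.smooth.self_of_nhds.mdifferentiableAt (by simp)),
    Function.comp_apply, ← hGC, ← hFC, ← Submodule.map_comp]
  rfl

theorem PreservesDistribution.id (D : Set N)
    (C : ∀ p : N, Submodule ℝ (TangentSpace 𝓘(ℝ, V) p)) :
    PreservesDistribution D C (fun s => s) := by
  intro s
  refine ⟨fun x => x, ⟨Eventually.of_forall fun x => contMDiffAt_id,
    Eventually.of_forall fun x hx => rfl⟩, ?_⟩
  have : mfderiv 𝓘(ℝ, V) 𝓘(ℝ, V) (fun x : N => x) (s : N) = ContinuousLinearMap.id ℝ _ := mfderiv_id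
  rw [this]
  exact Submodule.map_id _

/-- The group of diffeomorphisms of the submanifold `D` of `N` which preserve the distribution
`p ↦ C p ∩ T_p D`. -/
def distAut (D : Set N) (C : ∀ p : N, Submodule ℝ (TangentSpace 𝓘(ℝ, V) p)) :
    Subgroup (Equiv.Perm D) where
  carrier := {φ | PreservesDistribution D C φ ∧ PreservesDistribution D C φ.symm}
  mul_mem' {φ ψ} hφ hψ := ⟨hψ.1.comp hφ.1, hφ.2.comp hψ.2⟩
  one_mem' := ⟨.id D C, .id D C⟩
  inv_mem' hφ := ⟨hφ.2, hφ.1⟩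

end Distributions

section Geometry

variable {X Y : Type*} [NormedAddCommGroup X] [NormedSpace ℝ X] [CompleteSpace X]
  [NormedAddCommGroup Y] [NormedSpace ℝ Y]
  {E : Type*} [TopologicalSpace E] [ChartedSpace (X × Y) E] [IsManifold 𝓘(ℝ, X × Y) ∞ E]

/-- The projection `π_{2,1} : [L]²_p ↦ [L]¹_p`. -/
def jetProj : Jet X Y E 2 → Jet X Y E 1 :=
  Quot.map (fun A => A) fun _ _ h => by
    obtain ⟨hp, e, f, g, hf, hg, hk⟩ := h
    exact ⟨hp, e, f, g, hf, hg, fun k hk1 => hk k (hk1.trans one_le_two)⟩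

/-- The prolongation `L^(r)`, that is, the set of the `r`-jets of `L` at its points. -/
def prolong (X Y : Type*) [NormedAddCommGroup X] [NormedSpace ℝ X]
    [NormedAddCommGroup Y] [NormedSpace ℝ Y]
    {E : Type*} [TopologicalSpace E] [ChartedSpace (X × Y) E] (r : ℕ) (L : Set E) :
    Set (Jet X Y E r) :=
  {θ | ∃ A : PointedSubmanifold X Y E, A.carrier = L ∧ jet r A = θ}

/-- The Cartan distribution of `J¹`: the span at `θ` of the tangent spaces of the prolongations of
the submanifolds whose first jet is `θ`. -/
def cartan₁ (θ : Jet X Y E 1) :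
    Submodule ℝ (TangentSpace 𝓘(ℝ, (X × Y) × (X →L[ℝ] Y)) θ) :=
  ⨆ (A : PointedSubmanifold X Y E) (_ : jet 1 A = θ), tangentTo (prolong X Y 1 A.carrier) θ

/-- The Cartan distribution of `J²`: the span at `θ` of the tangent spaces of the prolongations of
the submanifolds whose second jet is `θ`. -/
def cartan₂ (θ : Jet X Y E 2) :
    Submodule ℝ (TangentSpace 𝓘(ℝ, (X × Y) × (X →L[ℝ] Y) × SymBilin X Y) θ) :=
  ⨆ (A : PointedSubmanifold X Y E) (_ : jet 2 A = θ), tangentTo (prolong X Y 2 A.carrier) θ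

/-- `W` is an `R`-plane at `θ`, that is, the tangent space at `θ` of the prolongation to `J¹` of a
submanifold with first jet `θ`. -/
def IsRPlane (θ : Jet X Y E 1)
    (W : Submodule ℝ (TangentSpace 𝓘(ℝ, (X × Y) × (X →L[ℝ] Y)) θ)) : Prop :=
  ∃ A : PointedSubmanifold X Y E, jet 1 A = θ ∧ W = tangentTo (prolong X Y 1 A.carrier) θ

variable (X Y E) in
/-- Operators of the type of a covariant derivative on the tangent bundle of `E`, without axioms;
they are only used for the covariant derivatives of Mathlib and for `directSum`. -/
abbrev Connection : Type _ :=
  (∀ p : E, TangentSpace 𝓘(ℝ, X × Y) p) →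
    ∀ p : E, TangentSpace 𝓘(ℝ, X × Y) p →L[ℝ] TangentSpace 𝓘(ℝ, X × Y) p

/-- The second fundamental form `II (v, σ p) = ∇_v σ mod T_p L` at the point `p` of the submanifold
`L`, where `v` is tangent to `L` at `p`, and the vector field `σ` is tangent to `L` along `L`. -/
def secondFundForm (cov : Connection X Y E) (A : PointedSubmanifold X Y E)
    (v : TangentSpace 𝓘(ℝ, X × Y) A.pt) (σ : ∀ p : E, TangentSpace 𝓘(ℝ, X × Y) p) :
    TangentSpace 𝓘(ℝ, X × Y) A.pt ⧸ tangentTo (V := X × Y) A.carrier A.pt :=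
  Submodule.Quotient.mk (cov σ A.pt v)

/-- The equation of totally geodesic submanifolds: the set of the second jets `[L]²_p` such that the
second fundamental form of `L` vanishes at `p`. -/
def totGeod (cov : Connection X Y E) : Set (Jet X Y E 2) :=
  {θ | ∃ A : PointedSubmanifold X Y E, jet 2 A = θ ∧
    ∀ v ∈ tangentTo (V := X × Y) A.carrier A.pt, ∀ σ : ∀ p : E, TangentSpace 𝓘(ℝ, X × Y) p,
      ContMDiffAt 𝓘(ℝ, X × Y) 𝓘(ℝ, X × Y).tangent ∞
        (fun p => (⟨p, σ p⟩ : TangentBundle 𝓘(ℝ, X × Y) E)) A.pt →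
      (∀ᶠ p in 𝓝 A.pt, p ∈ A.carrier → σ p ∈ tangentTo (V := X × Y) A.carrier p) →
      secondFundForm cov A v σ = 0}

/-- The distribution `R ∘ Γ̈` on `J¹`: the tangent space at `θ` of the prolongation to `J¹` of a
submanifold with first jet `θ` whose second jet lies in the equation `totGeod cov`. -/
def grassDist (cov : Connection X Y E) (θ : Jet X Y E 1) :
    Submodule ℝ (TangentSpace 𝓘(ℝ, (X × Y) × (X →L[ℝ] Y)) θ) :=
  ⨆ (A : PointedSubmanifold X Y E) (_ : jet 1 A = θ) (_ : jet 2 A ∈ totGeod cov),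
    tangentTo (prolong X Y 1 A.carrier) θ

/-- The group of classical external symmetries of the equation `totGeod cov` in the open subset `U₂`
of `J²`: the contact transformations of `U₂` which preserve the equation. -/
def externalSym (cov : Connection X Y E) (U₂ : Set (Jet X Y E 2)) : Subgroup (Equiv.Perm U₂) where
  carrier := {G | G ∈ distAut U₂ cartan₂ ∧
    ∀ θ : U₂, (G θ : Jet X Y E 2) ∈ totGeod cov ↔ (θ : Jet X Y E 2) ∈ totGeod cov}
  mul_mem' {G H} hG hH := ⟨mul_mem hG.1 hH.1, fun θ => (hG.2 (H θ)).trans (hH.2 θ)⟩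
  one_mem' := ⟨one_mem _, fun _ => Iff.rfl⟩
  inv_mem' {G} hG := ⟨inv_mem hG.1, fun θ => by
    simpa using (hG.2 (G⁻¹ θ)).symm⟩

/-- The group of classical internal symmetries of the equation `totGeod cov` in `U₂`: the
diffeomorphisms of the equation which preserve the induced Cartan distribution. -/
def internalSym (cov : Connection X Y E) (U₂ : Set (Jet X Y E 2)) :
    Subgroup (Equiv.Perm ↥(totGeod cov ∩ U₂)) :=
  distAut (totGeod cov ∩ U₂) cartan₂

/-- The group of contact transformations of the open subset `U₁` of `J¹` which also preserve the
distribution `grassDist cov`. -/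
def contactGrass (cov : Connection X Y E) (U₁ : Set (Jet X Y E 1)) :
    Subgroup (Equiv.Perm U₁) :=
  distAut U₁ cartan₁ ⊓ distAut U₁ (grassDist cov)

/-- The tangent map of the smooth map `g` sends `R`-planes to `R`-planes. -/
def PreservesRPlanes (U₁ : Set (Jet X Y E 1)) (g : U₁ → U₁) : Prop :=
  ∀ θ : U₁, ∃ F : Jet X Y E 1 → Jet X Y E 1,
    IsLocalExtension (V := (X × Y) × (X →L[ℝ] Y)) U₁ g θ F ∧
    ∀ W, IsRPlane (θ : Jet X Y E 1) W → IsRPlane (F θ)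
      (W.map (mfderiv 𝓘(ℝ, (X × Y) × (X →L[ℝ] Y)) 𝓘(ℝ, (X × Y) × (X →L[ℝ] Y)) F θ).toLinearMap)

end Geometry

section Product

variable {X Z : Type*} [NormedAddCommGroup X] [NormedSpace ℝ X]
  [NormedAddCommGroup Z] [NormedSpace ℝ Z]
  {M : Type*} [TopologicalSpace M] [ChartedSpace X M]
  {E : Type*} [TopologicalSpace E] [ChartedSpace Z E]

instance : ChartedSpace (X × Z) (M × E) :=
  inferInstanceAs (ChartedSpace (ModelProd X Z) (M × E))

instance [IsManifold 𝓘(ℝ, X) ∞ M] [IsManifold 𝓘(ℝ, Z) ∞ E] :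
    IsManifold 𝓘(ℝ, X × Z) ∞ (M × E) := by
  rw [modelWithCornersSelf_prod]
  exact inferInstanceAs (IsManifold (𝓘(ℝ, X).prod 𝓘(ℝ, Z)) ∞ (M × E))

variable [IsManifold 𝓘(ℝ, X) ∞ M] [IsManifold 𝓘(ℝ, Z) ∞ E]

/-- The direct sum of a connection `Θ` on `M` and a connection `Γ` on `E`. A vector field on `M × E`
is a pair `σ = (σ₁, σ₂)` with `σ₁ (x, y) ∈ T_x M` and `σ₂ (x, y) ∈ T_y E`, and
`∇_(v, w) σ = (Θ_v σ₁(·, y) + ∂_w σ₁(x, ·), Γ_w σ₂(x, ·) + ∂_v σ₂(·, y))`, where `∂` is the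
derivative of a map with values in a fixed tangent space. -/
def directSum
    (Θ : CovariantDerivative 𝓘(ℝ, X) X (TangentSpace 𝓘(ℝ, X) : M → Type _))
    (Γ : CovariantDerivative 𝓘(ℝ, Z) Z (TangentSpace 𝓘(ℝ, Z) : E → Type _)) :
    Connection X Z (M × E) := fun σ q =>
  let covM : X →L[ℝ] X := Θ (fun x => (σ (x, q.2) : X × Z).1) q.1
  let covE : Z →L[ℝ] Z := Γ (fun y => (σ (q.1, y) : X × Z).2) q.2
  let derM : Z →L[ℝ] X := mfderiv 𝓘(ℝ, Z) 𝓘(ℝ, X) (fun y : E => (σ (q.1, y) : X × Z).1) q.2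
  let derE : X →L[ℝ] Z := mfderiv 𝓘(ℝ, X) 𝓘(ℝ, Z) (fun x : M => (σ (x, q.2) : X × Z).2) q.1
  (covM.coprod derM).prod (derE.coprod covE)

variable (X Z M E) in
/-- The space `J^r pr_M` of the `r`-jets of the submanifolds of `M × E` which are images of local
sections of the projection `M × E → M`, that is, graphs of maps `s : O → E` with `O ⊆ M` open. -/
def sectionJets (r : ℕ) : Set (Jet X Z (M × E) r) :=
  {θ | ∃ A : PointedSubmanifold X Z (M × E), jet r A = θ ∧ ∃ (O : Set M) (s : M → E),
    IsOpen O ∧ ContMDiffOn 𝓘(ℝ, X) 𝓘(ℝ, Z) ∞ s O ∧ A.carrier = (fun x => (x, s x)) '' O}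

variable (X Z M E) in
/-- The space `Imm J^r pr_M` of the `r`-jets of the graphs of the immersions `s : O → E`. -/
def immersionJets (r : ℕ) : Set (Jet X Z (M × E) r) :=
  {θ | ∃ A : PointedSubmanifold X Z (M × E), jet r A = θ ∧ ∃ (O : Set M) (s : M → E),
    IsOpen O ∧ ContMDiffOn 𝓘(ℝ, X) 𝓘(ℝ, Z) ∞ s O ∧
    (∀ x ∈ O, Function.Injective (mfderiv 𝓘(ℝ, X) 𝓘(ℝ, Z) s x)) ∧
    A.carrier = (fun x => (x, s x)) '' O}

end Product

section Conclusions

variable {X Y : Type*} [NormedAddCommGroup X] [NormedSpace ℝ X] [CompleteSpace X]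
  [NormedAddCommGroup Y] [NormedSpace ℝ Y]
  {E : Type*} [TopologicalSpace E] [ChartedSpace (X × Y) E] [IsManifold 𝓘(ℝ, X × Y) ∞ E]

/-- Every external symmetry restricts to an internal symmetry, and the restriction is an injective
group homomorphism: the external symmetries are a subgroup of the internal symmetries. -/
def ExternalSubgroupOfInternal (cov : Connection X Y E) (U₂ : Set (Jet X Y E 2)) : Prop :=
  ∃ ρ : externalSym cov U₂ →* internalSym cov U₂, Function.Injective ρ ∧
    ∀ (G : externalSym cov U₂) (s : ↥(totGeod cov ∩ U₂)) (θ : U₂), (s : Jet X Y E 2) = θ →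
      ((ρ G : Equiv.Perm ↥(totGeod cov ∩ U₂)) s : Jet X Y E 2) = (G : Equiv.Perm U₂) θ

/-- The projection of second jets onto first jets identifies the group of internal symmetries with
the group of diffeomorphisms of `U₁` which preserve the distribution `grassDist cov`. -/
def InternalEquivGrass (cov : Connection X Y E) (U₁ : Set (Jet X Y E 1))
    (U₂ : Set (Jet X Y E 2)) : Prop :=
  ∃ ι : internalSym cov U₂ ≃* distAut U₁ (grassDist cov),
    ∀ (φ : internalSym cov U₂) (s : ↥(totGeod cov ∩ U₂)) (ϑ : U₁), jetProj (s : Jet X Y E 2) = ϑ →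
      jetProj ((φ : Equiv.Perm ↥(totGeod cov ∩ U₂)) s : Jet X Y E 2) = (ι φ : Equiv.Perm U₁) ϑ

/-- Every external symmetry projects to a transformation of first jets which determines it, and
the transformations obtained in this way form the set `T`. -/
def ExternalProjectsOnto (cov : Connection X Y E) (U₁ : Set (Jet X Y E 1))
    (U₂ : Set (Jet X Y E 2)) (T : Set (Equiv.Perm U₁)) : Prop :=
  ∃ κ : externalSym cov U₂ →* Equiv.Perm U₁, Function.Injective κ ∧
    (∀ (G : externalSym cov U₂) (θ : U₂) (ϑ : U₁), jetProj (θ : Jet X Y E 2) = ϑ →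
      jetProj ((G : Equiv.Perm U₂) θ : Jet X Y E 2) = κ G ϑ) ∧
    range κ = T

/-- The contact transformations of `U₁` which preserve the distribution `grassDist cov` and which,
together with their inverses, send `R`-planes to `R`-planes. -/
def lieGrass (cov : Connection X Y E) (U₁ : Set (Jet X Y E 1)) : Set (Equiv.Perm U₁) :=
  {g | g ∈ contactGrass cov U₁ ∧ PreservesRPlanes U₁ g ∧ PreservesRPlanes U₁ g.symm}

end Conclusions

end SubmanifoldJet

end

open SubmanifoldJet

/-! All three situations have the same shape: an open set `U` of first jets, the set `jetProj ⁻¹' U`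
of second jets, and an equation which is the image of a smooth section `s` of `jetProj`
(`IsGeodSection`). The theorem is proved once for such data, in `IsGeodSection.symmetries`. The
section exists because in a chart the graph of f is totally geodesic at a point exactly when the
second derivative of f there equals an expression in the Christoffel symbols and the first jet
(`mem_totGeod_iff`); this expression is symmetric since the torsion vanishes. A direct sum of
connections has block diagonal symbols, and the jets of sections and of immersions are cut out by
open conditions on the first jet.

Two facts carry the argument. A second jet over a given first jet is determined by its R-plane
(`chart₂_injOn_fibre`), and the Cartan distribution on second jets is the preimage of the R-plane
under the tangent map of `jetProj` (`cartanSpace₂_eq`).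

Internal symmetries: `s` identifies `U` with the equation. As the tangent maps of `s` and `jetProj`
compose to the identity, the induced Cartan distribution corresponds to the field of R-planes of
`s`, which is `grassDist`. Conjugation by `s` gives item 2.

External symmetries: a contact transformation G of second jets preserves the derived Cartan
distribution, and with it the directions whose brackets with that distribution stay inside it; these
contain the vertical vectors of `jetProj`, which G therefore preserves
(`fderiv_vertical_of_contact₂`). The fibres are connected, so G covers a map g of first jets, and
the tangent map of g sends the R-plane of each second jet to the R-plane of its image. So g
determines G. Conversely, a g which with its inverse permutes R-planes acts on second jets, smoothly
because of the explicit formula `prolongMap`. Finally G preserves the equation if and only if g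
preserves the R-planes of `s`. The restriction homomorphism of item 1 is this projection followed by
the inverse of the isomorphism of item 2.

For k ≠ 1 the R-plane condition is automatic. The bracket of contact vector fields modulo the
contact distribution is a two-form with values in `Y`. Paired with a vertical vector of rank one it
takes values in a line, whereas paired with a nonvertical vector it takes all values. Hence vertical
vectors stay vertical (`fderiv_vertical_of_contact₁`), and R-planes, as horizontal planes on which
the form vanishes, go to R-planes (`exists_map_rSpace`). -/

noncomputable section
namespace SubmanifoldJet

/-! ### Contact distributions in coordinates and the brackets of their sections. -/

section Contact

variable {X Y : Type*} [NormedAddCommGroup X] [NormedSpace ℝ X]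
  [NormedAddCommGroup Y] [NormedSpace ℝ Y]
  {W : Type*} [NormedAddCommGroup W] [NormedSpace ℝ W]

/-- If the vector fields `P` and `Q` satisfy `dy = a dx`, then the form `dy - a dx` of their bracket
is given by the curvature form `da ∧ dx`. -/
theorem contact_lieBracket {x : W → X} {y : W → Y} {a : W → X →L[ℝ] Y} {P Q : W → W} {m : W}
    (hx : ContDiffAt ℝ ∞ x m) (hy : ContDiffAt ℝ ∞ y m) (ha : ContDiffAt ℝ ∞ a m)
    (hP : DifferentiableAt ℝ P m) (hQ : DifferentiableAt ℝ Q m)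
    (hP' : ∀ᶠ n in 𝓝 m, fderiv ℝ y n (P n) = a n (fderiv ℝ x n (P n)))
    (hQ' : ∀ᶠ n in 𝓝 m, fderiv ℝ y n (Q n) = a n (fderiv ℝ x n (Q n))) :
    fderiv ℝ y m (VectorField.lieBracket ℝ P Q m) -
      a m (fderiv ℝ x m (VectorField.lieBracket ℝ P Q m)) =
    fderiv ℝ a m (P m) (fderiv ℝ x m (Q m)) - fderiv ℝ a m (Q m) (fderiv ℝ x m (P m)) := by
  have dx : DifferentiableAt ℝ (fderiv ℝ x) m :=
    (hx.fderiv_right (m := ∞) (by simp)).differentiableAt (by simp)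
  have dy : DifferentiableAt ℝ (fderiv ℝ y) m :=
    (hy.fderiv_right (m := ∞) (by simp)).differentiableAt (by simp)
  have da : DifferentiableAt ℝ a m := ha.differentiableAt (by simp)
  -- Differentiate the identity dy(T) = a dx(T) in the direction S. In the difference of the two
  -- instances the second derivatives of x and y cancel by symmetry.
  have key : ∀ {S T : W → W}, DifferentiableAt ℝ T m →
      (∀ᶠ n in 𝓝 m, fderiv ℝ y n (T n) = a n (fderiv ℝ x n (T n))) →
      fderiv ℝ (fderiv ℝ y) m (S m) (T m) + fderiv ℝ y m (fderiv ℝ T m (S m)) =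
      fderiv ℝ a m (S m) (fderiv ℝ x m (T m)) +
        a m (fderiv ℝ (fderiv ℝ x) m (S m) (T m) + fderiv ℝ x m (fderiv ℝ T m (S m))) := by
    intro S T hT hT'
    have h1 := dy.hasFDerivAt.clm_apply hT.hasFDerivAt
    have h2 := da.hasFDerivAt.clm_apply (dx.hasFDerivAt.clm_apply hT.hasFDerivAt)
    have h3 := (h2.congr_of_eventuallyEq hT').unique h1
    have h4 := congrArg (fun L : W →L[ℝ] Y => L (S m)) h3
    simp at h4
    rw [add_comm, ← h4, map_add]
    abel
  have h1 := key (S := P) hQ hQ'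
  have h2 := key (S := Q) hP hP'
  have sx := (hx.isSymmSndFDerivAt (by simp [two_le_infty])) (P m) (Q m)
  have sy := (hy.isSymmSndFDerivAt (by simp [two_le_infty])) (P m) (Q m)
  rw [VectorField.lieBracket, (fderiv ℝ y m).map_sub, (fderiv ℝ x m).map_sub, (a m).map_sub]
  rw [(a m).map_add, sx, sy] at h1
  rw [(a m).map_add] at h2
  rw [eq_sub_of_add_eq' h1, eq_sub_of_add_eq' h2]
  abel

/-- The contact distribution in the coordinates of first jets. -/
def contact₁ (m : (X × Y) × (X →L[ℝ] Y)) : Submodule ℝ ((X × Y) × (X →L[ℝ] Y)) where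
  carrier := {w | w.1.2 = m.2 w.1.1}
  add_mem' ha hb := by simp_all
  zero_mem' := by simp
  smul_mem' c q hq := by simp_all

/-- The derived contact distribution in the coordinates of second jets: the preimage of the
contact distribution on first jets. -/
def contactDerived (m : (X × Y) × (X →L[ℝ] Y) × SymBilin X Y) :
    Submodule ℝ ((X × Y) × (X →L[ℝ] Y) × SymBilin X Y) where
  carrier := {w | w.1.2 = m.2.1 w.1.1}
  add_mem' ha hb := by simp_all
  zero_mem' := by simp
  smul_mem' c q hq := by simp_all

/-- The contact distribution in the coordinates of second jets. -/
def contact₂ (m : (X × Y) × (X →L[ℝ] Y) × SymBilin X Y) :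
    Submodule ℝ ((X × Y) × (X →L[ℝ] Y) × SymBilin X Y) where
  carrier := {w | w.1.2 = m.2.1 w.1.1 ∧ w.2.1 = m.2.2.incl w.1.1}
  add_mem' ha hb := by simp_all
  zero_mem' := by simp
  smul_mem' c q hq := by simp_all

/-- The parametrization `v ↦ (v, a v, q v)` of the `R`-plane of a second jet. -/
def rLift (m : (X × Y) × (X →L[ℝ] Y) × SymBilin X Y) : X →L[ℝ] (X × Y) × (X →L[ℝ] Y) :=
  ((ContinuousLinearMap.id ℝ X).prod m.2.1).prod m.2.2.incl

/-- The `R`-plane of a second jet in coordinates. -/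
def rSpace (m : (X × Y) × (X →L[ℝ] Y) × SymBilin X Y) : Submodule ℝ ((X × Y) × (X →L[ℝ] Y)) where
  carrier := {w | w.1.2 = m.2.1 w.1.1 ∧ w.2 = m.2.2.incl w.1.1}
  add_mem' ha hb := by simp_all
  zero_mem' := by simp
  smul_mem' c q hq := by simp_all

theorem mem_contact₁ {m w : (X × Y) × (X →L[ℝ] Y)} : w ∈ contact₁ m ↔ w.1.2 = m.2 w.1.1 := Iff.rfl

theorem mem_contactDerived {m w : (X × Y) × (X →L[ℝ] Y) × SymBilin X Y} :
    w ∈ contactDerived m ↔ w.1.2 = m.2.1 w.1.1 := Iff.rfl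

theorem mem_rSpace {m : (X × Y) × (X →L[ℝ] Y) × SymBilin X Y} {w : (X × Y) × (X →L[ℝ] Y)} :
    w ∈ rSpace m ↔ w.1.2 = m.2.1 w.1.1 ∧ w.2 = m.2.2.incl w.1.1 := Iff.rfl

@[simp] theorem rLift_apply (m : (X × Y) × (X →L[ℝ] Y) × SymBilin X Y) (v : X) :
    rLift m v = ((v, m.2.1 v), m.2.2.incl v) := rfl

theorem mem_rSpace_iff_rLift {m : (X × Y) × (X →L[ℝ] Y) × SymBilin X Y}
    {w : (X × Y) × (X →L[ℝ] Y)} : w ∈ rSpace m ↔ rLift m w.1.1 = w := by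
  rw [mem_rSpace, rLift_apply]
  constructor
  · rintro ⟨h1, h2⟩
    rw [← h1, ← h2]
  · intro h
    exact ⟨(congrArg (fun w : (X × Y) × (X →L[ℝ] Y) => w.1.2) h).symm,
      (congrArg (fun w : (X × Y) × (X →L[ℝ] Y) => w.2) h).symm⟩

theorem rLift_mem (m : (X × Y) × (X →L[ℝ] Y) × SymBilin X Y) (v : X) : rLift m v ∈ rSpace m :=
  ⟨rfl, rfl⟩

theorem SymBilin.incl_injective : Function.Injective (SymBilin.incl : SymBilin X Y → _) :=
  fun p q h => by rw [← symmetrize_incl p, h, symmetrize_incl]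

@[simp] theorem SymBilin.incl_zero : (0 : SymBilin X Y).incl = 0 := rfl

/-- The inclusion of symmetric bilinear maps as a continuous linear map. -/
def SymBilin.inclL : SymBilin X Y →L[ℝ] X →L[ℝ] X →L[ℝ] Y := Fixed.incl (flipBilin X Y)

@[simp] theorem SymBilin.inclL_apply (q : SymBilin X Y) : SymBilin.inclL q = q.incl := rfl

/-- The plane is the graph of (a, q) over `X`, so q can be read off from it. This is why a
transformation of first jets has at most one lift to second jets. -/
theorem rSpace_injective {z : X × Y} {a : X →L[ℝ] Y} {q q' : SymBilin X Y}
    (h : rSpace (z, a, q) = rSpace (z, a, q')) : q = q' := by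
  refine SymBilin.incl_injective (ContinuousLinearMap.ext fun v => ?_)
  have := rLift_mem (z, a, q) v
  rw [h] at this
  exact this.2

/-- Contraction with a nonzero vector is onto. Two consequences are used: the brackets of contact
fields on second jets fill all directions b, and the R-planes at a first jet span the contact
distribution. -/
theorem SymBilin.exists_apply_eq {v : X} (hv : v ≠ 0) (b : X →L[ℝ] Y) :
    ∃ q : SymBilin X Y, q.incl v = b := by
  obtain ⟨ξ, hξ⟩ := SeparatingDual.exists_eq_one (R := ℝ) hv
  -- With ξ(v) = 1, symmetrizing ξ ⊗ b adds the unwanted term ξ(w) b(v) to the contraction with v;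
  -- the last summand removes it.
  let B : X →L[ℝ] X →L[ℝ] Y := ξ.smulRight b + (ξ.smulRight b).flip -
    ξ.smulRight (ξ.smulRight (b v))
  refine ⟨symmetrize B, ?_⟩
  rw [incl_symmetrize]
  · ext u; simp [B, hξ]
  · intro u w
    simp [B, smul_smul, mul_comm]
    abel

/-- The vector field `(v, a v, b)` on the coordinate space of first jets. -/
def field₁ (v : X) (b : X →L[ℝ] Y) (m : (X × Y) × (X →L[ℝ] Y)) : (X × Y) × (X →L[ℝ] Y) :=
  ((v, m.2 v), b)

theorem field₁_hasFDerivAt (v : X) (b : X →L[ℝ] Y) (m : (X × Y) × (X →L[ℝ] Y)) :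
    HasFDerivAt (field₁ v b) (((0 : (X × Y) × (X →L[ℝ] Y) →L[ℝ] X).prod
      ((ContinuousLinearMap.apply ℝ Y v).comp (ContinuousLinearMap.snd ℝ _ _))).prod 0) m :=
  ((hasFDerivAt_const v m).prodMk
    ((ContinuousLinearMap.apply ℝ Y v).comp (ContinuousLinearMap.snd ℝ _ _)).hasFDerivAt).prodMk
    (hasFDerivAt_const b m)

theorem lieBracket_field₁ (v u : X) (b c : X →L[ℝ] Y) (m : (X × Y) × (X →L[ℝ] Y)) :
    VectorField.lieBracket ℝ (field₁ v b) (field₁ u c) m = ((0, b u - c v), 0) := by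
  rw [VectorField.lieBracket, (field₁_hasFDerivAt u c m).fderiv, (field₁_hasFDerivAt v b m).fderiv]
  simp [field₁]

/-- The vector field `(v, a v, b, q)` on the coordinate space of second jets. -/
def fieldDerived (v : X) (b : X →L[ℝ] Y) (q : SymBilin X Y)
    (m : (X × Y) × (X →L[ℝ] Y) × SymBilin X Y) : (X × Y) × (X →L[ℝ] Y) × SymBilin X Y :=
  ((v, m.2.1 v), (b, q))

theorem fieldDerived_hasFDerivAt (v : X) (b : X →L[ℝ] Y) (q : SymBilin X Y)
    (m : (X × Y) × (X →L[ℝ] Y) × SymBilin X Y) :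
    HasFDerivAt (fieldDerived v b q)
      (((0 : (X × Y) × (X →L[ℝ] Y) × SymBilin X Y →L[ℝ] X).prod
      ((ContinuousLinearMap.apply ℝ Y v).comp ((ContinuousLinearMap.fst ℝ _ _).comp
        (ContinuousLinearMap.snd ℝ _ _)))).prod 0) m :=
  ((hasFDerivAt_const v m).prodMk
    ((ContinuousLinearMap.apply ℝ Y v).comp ((ContinuousLinearMap.fst ℝ _ _).comp
      (ContinuousLinearMap.snd ℝ _ _))).hasFDerivAt).prodMk (hasFDerivAt_const (b, q) m)

theorem lieBracket_fieldDerived (v u : X) (b c : X →L[ℝ] Y) (p q : SymBilin X Y)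
    (m : (X × Y) × (X →L[ℝ] Y) × SymBilin X Y) :
    VectorField.lieBracket ℝ (fieldDerived v b p) (fieldDerived u c q) m =
      ((0, b u - c v), 0) := by
  rw [VectorField.lieBracket, (fieldDerived_hasFDerivAt u c q m).fderiv,
    (fieldDerived_hasFDerivAt v b p m).fderiv]
  simp [fieldDerived]

/-- The vector field `(v, a v, h v, q)` on the coordinate space of second jets, with `h` the
coordinate of second derivatives. -/
def field₂ (v : X) (q : SymBilin X Y)
    (m : (X × Y) × (X →L[ℝ] Y) × SymBilin X Y) : (X × Y) × (X →L[ℝ] Y) × SymBilin X Y :=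
  ((v, m.2.1 v), (m.2.2.incl v, q))

theorem field₂_hasFDerivAt (v : X) (q : SymBilin X Y)
    (m : (X × Y) × (X →L[ℝ] Y) × SymBilin X Y) :
    HasFDerivAt (field₂ v q)
      (((0 : (X × Y) × (X →L[ℝ] Y) × SymBilin X Y →L[ℝ] X).prod
      ((ContinuousLinearMap.apply ℝ Y v).comp ((ContinuousLinearMap.fst ℝ _ _).comp
        (ContinuousLinearMap.snd ℝ _ _)))).prod
      ((((ContinuousLinearMap.apply ℝ (X →L[ℝ] Y) v).comp SymBilin.inclL).comp
        ((ContinuousLinearMap.snd ℝ _ _).comp (ContinuousLinearMap.snd ℝ _ _))).prod 0)) m :=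
  ((hasFDerivAt_const v m).prodMk
    ((ContinuousLinearMap.apply ℝ Y v).comp ((ContinuousLinearMap.fst ℝ _ _).comp
      (ContinuousLinearMap.snd ℝ _ _))).hasFDerivAt).prodMk
  ((((ContinuousLinearMap.apply ℝ (X →L[ℝ] Y) v).comp SymBilin.inclL).comp
        ((ContinuousLinearMap.snd ℝ _ _).comp (ContinuousLinearMap.snd ℝ _ _))).hasFDerivAt.prodMk
    (hasFDerivAt_const q m))

theorem lieBracket_field₂ (v u : X) (p q : SymBilin X Y)
    (m : (X × Y) × (X →L[ℝ] Y) × SymBilin X Y) :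
    VectorField.lieBracket ℝ (field₂ v p) (field₂ u q) m =
      (0, (p.incl u - q.incl v, 0)) := by
  rw [VectorField.lieBracket, (field₂_hasFDerivAt u q m).fderiv, (field₂_hasFDerivAt v p m).fderiv]
  simp [field₂, SymBilin.symm m.2.2 u v]

/-- The components of the derivative of a map into `(X × Y) × K`. -/
theorem fderiv_components {K : Type*} [NormedAddCommGroup K] [NormedSpace ℝ K]
    {G : W → (X × Y) × K} {m : W} (hG : DifferentiableAt ℝ G m) (w : W) :
    fderiv ℝ (fun n => (G n).1.1) m w = (fderiv ℝ G m w).1.1 ∧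
    fderiv ℝ (fun n => (G n).1.2) m w = (fderiv ℝ G m w).1.2 ∧
    fderiv ℝ (fun n => (G n).2) m w = (fderiv ℝ G m w).2 := by
  have h := hG.hasFDerivAt
  refine ⟨?_, ?_, ?_⟩
  · rw [h.fst.fst.fderiv]; rfl
  · rw [h.fst.snd.fderiv]; rfl
  · rw [h.snd.fderiv]; rfl

theorem eventually_differentiableAt {V : Type*} [NormedAddCommGroup V] [NormedSpace ℝ V]
    {G : W → V} {m : W} (hG : ContDiffAt ℝ ∞ G m) : ∀ᶠ n in 𝓝 m, DifferentiableAt ℝ G n := by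
  have := (hG.of_le (m := 1) (by simp)).eventually (by simp)
  filter_upwards [this] with n hn using hn.differentiableAt (by simp)

/-- `contact_lieBracket` for the components of a map into the coordinate space of first jets. -/
theorem contact_lieBracket_map {G : W → (X × Y) × (X →L[ℝ] Y)} {P Q : W → W} {m : W}
    (hG : ContDiffAt ℝ ∞ G m) (hP : DifferentiableAt ℝ P m) (hQ : DifferentiableAt ℝ Q m)
    (hP' : ∀ᶠ n in 𝓝 m, fderiv ℝ G n (P n) ∈ contact₁ (G n))
    (hQ' : ∀ᶠ n in 𝓝 m, fderiv ℝ G n (Q n) ∈ contact₁ (G n)) :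
    (fderiv ℝ G m (VectorField.lieBracket ℝ P Q m)).1.2 -
      (G m).2 (fderiv ℝ G m (VectorField.lieBracket ℝ P Q m)).1.1 =
    (fderiv ℝ G m (P m)).2 (fderiv ℝ G m (Q m)).1.1 -
      (fderiv ℝ G m (Q m)).2 (fderiv ℝ G m (P m)).1.1 := by
  have hs := eventually_differentiableAt hG
  have h := contact_lieBracket (x := fun n => (G n).1.1) (y := fun n => (G n).1.2)
    (a := fun n => (G n).2) hG.fst.fst hG.fst.snd hG.snd hP hQ
    (by
      filter_upwards [hs, hP'] with n h1 h2
      rw [(fderiv_components h1 _).1, (fderiv_components h1 _).2.1]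
      exact h2)
    (by
      filter_upwards [hs, hQ'] with n h1 h2
      rw [(fderiv_components h1 _).1, (fderiv_components h1 _).2.1]
      exact h2)
  have e := fun w => fderiv_components hs.self_of_nhds w
  simpa only [(e _).1, (e _).2.1, (e _).2.2] using h

/-- An injective endomorphism which maps the graph of `a` into the graph of `a'` maps it onto the
graph of `a'`. -/
theorem exists_preimage_of_injective {K : Type*} [NormedAddCommGroup K] [NormedSpace ℝ K]
    [FiniteDimensional ℝ X] [FiniteDimensional ℝ K] {a a' : X →L[ℝ] Y}
    {T : (X × Y) × K →L[ℝ] (X × Y) × K} (hT : Function.Injective T)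
    (h : ∀ w, w.1.2 = a w.1.1 → (T w).1.2 = a' (T w).1.1) (x : X) (k : K) :
    ∃ w, w.1.2 = a w.1.1 ∧ (T w).1.1 = x ∧ (T w).2 = k := by
  let P : X × K →ₗ[ℝ] (X × Y) × K :=
    { toFun := fun u => ((u.1, a u.1), u.2)
      map_add' := fun u v => by simp
      map_smul' := fun c u => by simp }
  -- `P` parametrizes the graph of `a`, and `S` is `T` on it, read in the parameters of the target
  -- graph. It is an injective endomorphism of a finite dimensional space, hence onto.
  let S : X × K →ₗ[ℝ] X × K :=
    { toFun := fun u => ((T (P u)).1.1, (T (P u)).2)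
      map_add' := fun u v => by simp
      map_smul' := fun c u => by simp }
  have hS : Function.Injective S := by
    rw [injective_iff_map_eq_zero]
    intro u hu
    have h1 : (T (P u)).1.1 = 0 := congrArg Prod.fst hu
    have h2 : (T (P u)).2 = 0 := congrArg Prod.snd hu
    have h3 : (T (P u)).1.2 = 0 := by rw [h (P u) rfl, h1, map_zero]
    have h4 : P u = 0 := hT (by rw [map_zero]; exact Prod.ext (Prod.ext h1 h3) h2)
    exact Prod.ext (congrArg (fun w : (X × Y) × K => w.1.1) h4)
      (congrArg (fun w : (X × Y) × K => w.2) h4)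
  obtain ⟨u, hu⟩ := LinearMap.injective_iff_surjective.1 hS (x, k)
  exact ⟨P u, rfl, congrArg Prod.fst hu, congrArg Prod.snd hu⟩

instance {W : Type*} [NormedAddCommGroup W] [NormedSpace ℝ W] [FiniteDimensional ℝ W]
    (σ : W →L[ℝ] W) : FiniteDimensional ℝ (Fixed σ) :=
  inferInstanceAs (FiniteDimensional ℝ (fixedSubmodule σ))

instance [FiniteDimensional ℝ X] [FiniteDimensional ℝ Y] : FiniteDimensional ℝ (Bilin X Y) :=
  inferInstanceAs (FiniteDimensional ℝ (X →L[ℝ] X →L[ℝ] Y))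

theorem subsingleton_symBilin_left (h : Subsingleton X) : Subsingleton (SymBilin X Y) :=
  ⟨fun _ _ => SymBilin.incl_injective (ContinuousLinearMap.ext fun v => by
    rw [Subsingleton.elim v 0, map_zero, map_zero])⟩

theorem subsingleton_symBilin_right (h : Subsingleton Y) : Subsingleton (SymBilin X Y) :=
  ⟨fun _ _ => SymBilin.incl_injective (ContinuousLinearMap.ext fun _ =>
    ContinuousLinearMap.ext fun _ => Subsingleton.elim _ _)⟩

/-! ### Contact maps of second jets preserve the derived distribution and the vertical vectors. -/

section SecondOrder

variable {G : (X × Y) × (X →L[ℝ] Y) × SymBilin X Y → (X × Y) × (X →L[ℝ] Y) × SymBilin X Y}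
  {m : (X × Y) × (X →L[ℝ] Y) × SymBilin X Y}

/-- The first order components of a map between the coordinate spaces of second jets. -/
def dropSecond (m : (X × Y) × (X →L[ℝ] Y) × SymBilin X Y) : (X × Y) × (X →L[ℝ] Y) := (m.1, m.2.1)

/-- `dropSecond` as a continuous linear map. -/
def dropSecondL : (X × Y) × (X →L[ℝ] Y) × SymBilin X Y →L[ℝ] (X × Y) × (X →L[ℝ] Y) :=
  (ContinuousLinearMap.fst ℝ _ _).prod ((ContinuousLinearMap.fst ℝ _ _).comp
    (ContinuousLinearMap.snd ℝ _ _))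

@[simp] theorem dropSecondL_apply (m : (X × Y) × (X →L[ℝ] Y) × SymBilin X Y) :
    dropSecondL m = dropSecond m := rfl

theorem fderiv_dropSecond (hG : DifferentiableAt ℝ G m)
    (w : (X × Y) × (X →L[ℝ] Y) × SymBilin X Y) :
    fderiv ℝ (fun n => dropSecond (G n)) m w = dropSecond (fderiv ℝ G m w) := by
  have h : HasFDerivAt (fun n => dropSecond (G n)) _ m :=
    HasFDerivAt.comp m (dropSecondL (X := X) (Y := Y)).hasFDerivAt hG.hasFDerivAt
  rw [h.fderiv]; rfl

/-- A map which preserves the contact distribution on second jets preserves the derived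
distribution. -/
theorem contactDerived_of_contact₂ (hG : ContDiffAt ℝ ∞ G m)
    (hc : ∀ᶠ n in 𝓝 m, ∀ w ∈ contact₂ n, fderiv ℝ G n w ∈ contact₂ (G n)) :
    ∀ w ∈ contactDerived m, fderiv ℝ G m w ∈ contactDerived (G m) := by
  have hd := eventually_differentiableAt hG
  have hG' : ContDiffAt ℝ ∞ (fun n => dropSecond (G n)) m :=
    (dropSecondL (X := X) (Y := Y)).contDiff.contDiffAt.comp m hG
  have hF : ∀ v q, ∀ᶠ n in 𝓝 m,
      fderiv ℝ (fun n => dropSecond (G n)) n (field₂ v q n) ∈ contact₁ (dropSecond (G n)) := by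
    intro v q
    filter_upwards [hd, hc] with n h1 h2
    rw [fderiv_dropSecond h1]
    exact (h2 (field₂ v q n) ⟨rfl, rfl⟩).1
  have hb : ∀ b : X →L[ℝ] Y, fderiv ℝ G m (0, (b, 0)) ∈ contactDerived (G m) := by
    intro b
    rcases subsingleton_or_nontrivial X with hX | hX
    · have : ((0 : X × Y), (b, (0 : SymBilin X Y))) = 0 := by
        ext v
        · rfl
        · rfl
        · simp [Subsingleton.elim v 0]
        · rfl
      rw [this, map_zero]
      exact zero_mem _
    obtain ⟨v, hv⟩ := exists_ne (0 : X)
    obtain ⟨q, rfl⟩ := SymBilin.exists_apply_eq hv b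
    -- The vector b = q v is the bracket of two contact fields. Its image satisfies dy = a dx
    -- because the curvature form vanishes on the images of these fields, where da is the symmetric
    -- form `(G m).2.2`.
    have h := contact_lieBracket_map hG' (field₂_hasFDerivAt 0 q m).differentiableAt
      (field₂_hasFDerivAt v 0 m).differentiableAt (hF 0 q) (hF v 0)
    rw [lieBracket_field₂] at h
    simp only [fderiv_dropSecond hd.self_of_nhds] at h
    have h1 := hc.self_of_nhds (field₂ 0 q m) ⟨rfl, rfl⟩
    have h2 := hc.self_of_nhds (field₂ v 0 m) ⟨rfl, rfl⟩
    simp only [dropSecond, h1.2, h2.2, SymBilin.symm (G m).2.2 (fderiv ℝ G m (field₂ 0 q m)).1.1,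
      sub_self] at h
    rw [mem_contactDerived]
    simpa [sub_eq_zero] using h
  intro w hw
  have h1 := (hc.self_of_nhds (field₂ w.1.1 w.2.2 m) ⟨rfl, rfl⟩).1
  have h2 := hb (w.2.1 - m.2.2.incl w.1.1)
  have h3 : w = field₂ w.1.1 w.2.2 m + (0, (w.2.1 - m.2.2.incl w.1.1, 0)) := by
    rw [mem_contactDerived] at hw
    simp [field₂, ← hw]
  rw [h3, map_add]
  exact add_mem (mem_contactDerived.2 h1) h2

/-- A map which preserves the contact distribution on second jets preserves the kernel of the
projection to first jets. -/
theorem fderiv_vertical_of_contact₂ [FiniteDimensional ℝ X] [FiniteDimensional ℝ Y]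
    (hG : ∀ᶠ n in 𝓝 m, ContDiffAt ℝ ∞ G n)
    (hc : ∀ᶠ n in 𝓝 m, ∀ w ∈ contact₂ n, fderiv ℝ G n w ∈ contact₂ (G n))
    (hi : Function.Injective (fderiv ℝ G m)) (q : SymBilin X Y) :
    dropSecond (fderiv ℝ G m (0, (0, q))) = 0 := by
  rcases subsingleton_or_nontrivial Y with hY | hY
  · have := subsingleton_symBilin_right (X := X) hY
    rw [Subsingleton.elim q 0]
    change dropSecondL (fderiv ℝ G m 0) = 0
    rw [map_zero, map_zero]
  have hd : ∀ᶠ n in 𝓝 m, ∀ w ∈ contactDerived n, fderiv ℝ G n w ∈ contactDerived (G n) := by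
    filter_upwards [hG, hc.eventually_nhds] with n h1 h2 using contactDerived_of_contact₂ h1 h2
  have hF : ∀ v b q, ∀ᶠ n in 𝓝 m, fderiv ℝ (fun n => dropSecond (G n)) n (fieldDerived v b q n) ∈
      contact₁ (dropSecond (G n)) := by
    intro v b q
    filter_upwards [hG, hd] with n h1 h2
    rw [fderiv_dropSecond (h1.differentiableAt (by simp))]
    exact h2 (fieldDerived v b q n) rfl
  have hG' : ContDiffAt ℝ ∞ (fun n => dropSecond (G n)) m :=
    (dropSecondL (X := X) (Y := Y)).contDiff.contDiffAt.comp m hG.self_of_nhds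
  -- The constant field in the direction q commutes with every `fieldDerived`, so the curvature form
  -- at the image point vanishes between the image of q and the image of each vector of the derived
  -- distribution.
  have key : ∀ w ∈ contactDerived m, (fderiv ℝ G m (0, (0, q))).2.1 (fderiv ℝ G m w).1.1 =
      (fderiv ℝ G m w).2.1 (fderiv ℝ G m (0, (0, q))).1.1 := by
    intro w hw
    have h := contact_lieBracket_map hG' (fieldDerived_hasFDerivAt 0 0 q m).differentiableAt
      (fieldDerived_hasFDerivAt w.1.1 w.2.1 w.2.2 m).differentiableAt (hF 0 0 q) (hF _ _ _)
    have e1 : fieldDerived 0 0 q m = (0, (0, q)) := by simp [fieldDerived]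
    have e2 : fieldDerived w.1.1 w.2.1 w.2.2 m = w := by
      rw [mem_contactDerived] at hw
      simp [fieldDerived, ← hw]
    have e3 : (((0 : X), (0 : Y)), (0 : (X →L[ℝ] Y) × SymBilin X Y)) = 0 := rfl
    rw [lieBracket_fieldDerived, e1, e2, zero_apply,
      ContinuousLinearMap.map_zero, sub_zero, e3] at h
    simp only [fderiv_dropSecond (hG.self_of_nhds.differentiableAt (by simp))] at h
    simp [dropSecond] at h
    exact (sub_eq_zero.1 h.symm)
  have hsurj := fun x k => exists_preimage_of_injective (a := m.2.1) (a' := (G m).2.1) hi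
    (fun w hw => hd.self_of_nhds w hw) x k
  -- By `hsurj` the images of derived vectors have arbitrary components in `X` and in the jet
  -- directions. Testing with horizontal part zero and a rank one form excludes a nonzero horizontal
  -- part; testing with arbitrary horizontal part and zero form then kills the slope component in
  -- `ha`.
  have hx : (fderiv ℝ G m (0, (0, q))).1.1 = 0 := by
    by_contra hne
    obtain ⟨ξ, hξ⟩ := SeparatingDual.exists_eq_one (R := ℝ) hne
    obtain ⟨y, hy⟩ := exists_ne (0 : Y)
    obtain ⟨w, hw, h1, h2⟩ := hsurj 0 (ξ.smulRight y, 0)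
    have := key w hw
    rw [h1, h2] at this
    simp [hξ] at this
    exact hy this.symm
  have ha : (fderiv ℝ G m (0, (0, q))).2.1 = 0 := by
    ext x
    obtain ⟨w, hw, h1, h2⟩ := hsurj x 0
    have := key w hw
    rw [h1, h2] at this
    simpa using this
  have hy := hd.self_of_nhds (0, (0, q)) (by simp [mem_contactDerived])
  rw [mem_contactDerived, hx, map_zero] at hy
  exact Prod.ext (Prod.ext hx hy) ha

end SecondOrder

end Contact

/-! ### Contact maps of first jets, their action on R-planes, and prolongation. -/

section FirstOrder

variable {X Y : Type*} [NormedAddCommGroup X] [NormedSpace ℝ X]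
  [NormedAddCommGroup Y] [NormedSpace ℝ Y]

variable {g : (X × Y) × (X →L[ℝ] Y) → (X × Y) × (X →L[ℝ] Y)} {m : (X × Y) × (X →L[ℝ] Y)}

/-- The bracket of contact fields modulo the contact distribution depends only on their values at
the point; it is the curvature form w.2 w'.1.1 - w'.2 w.1.1. A contact map intertwines the forms at
`m` and `g m`. The fields `field₁` extend the two given vectors. -/
theorem contact₁_lieBracket (hg : ContDiffAt ℝ ∞ g m)
    (hc : ∀ᶠ n in 𝓝 m, ∀ w ∈ contact₁ n, fderiv ℝ g n w ∈ contact₁ (g n))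
    {w w' : (X × Y) × (X →L[ℝ] Y)} (hw : w ∈ contact₁ m) (hw' : w' ∈ contact₁ m) :
    (fderiv ℝ g m ((0, w.2 w'.1.1 - w'.2 w.1.1), 0)).1.2 -
      (g m).2 (fderiv ℝ g m ((0, w.2 w'.1.1 - w'.2 w.1.1), 0)).1.1 =
    (fderiv ℝ g m w).2 (fderiv ℝ g m w').1.1 - (fderiv ℝ g m w').2 (fderiv ℝ g m w).1.1 := by
  have hF : ∀ v b, ∀ᶠ n in 𝓝 m, fderiv ℝ g n (field₁ v b n) ∈ contact₁ (g n) := by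
    intro v b
    filter_upwards [hc] with n h2 using h2 (field₁ v b n) rfl
  have h := contact_lieBracket_map hg (field₁_hasFDerivAt w.1.1 w.2 m).differentiableAt
    (field₁_hasFDerivAt w'.1.1 w'.2 m).differentiableAt (hF _ _) (hF _ _)
  have e : ∀ {w : (X × Y) × (X →L[ℝ] Y)}, w ∈ contact₁ m → field₁ w.1.1 w.2 m = w := by
    intro w hw
    rw [mem_contact₁] at hw
    simp [field₁, ← hw]
  rwa [lieBracket_field₁, e hw, e hw'] at h

variable [FiniteDimensional ℝ X] [FiniteDimensional ℝ Y]

/-- If the fibres do not have dimension one, a map which preserves the contact distribution on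
first jets preserves the vertical vectors. -/
theorem fderiv_vertical_of_contact₁ (hY : Module.finrank ℝ Y ≠ 1) (hg : ContDiffAt ℝ ∞ g m)
    (hc : ∀ᶠ n in 𝓝 m, ∀ w ∈ contact₁ n, fderiv ℝ g n w ∈ contact₁ (g n))
    (hi : Function.Injective (fderiv ℝ g m)) (b : X →L[ℝ] Y) :
    (fderiv ℝ g m (0, b)).1 = 0 := by
  have hsurj := fun x k => exists_preimage_of_injective (a := m.2) (a' := (g m).2) hi
    (fun w hw => hc.self_of_nhds w hw) x k
  have hv : ∀ b : X →L[ℝ] Y, ((0, b) : (X × Y) × (X →L[ℝ] Y)) ∈ contact₁ m := fun b => by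
    simp [mem_contact₁]
  -- The curvature form pairs ξ ⊗ y with w to a multiple of y. If the image of ξ ⊗ y had a nonzero
  -- horizontal part, the pairing of the image with suitable vectors would give every y', although
  -- all values are multiples of the single vector `l`. So dim `Y` ≤ 1, hence `Y` = 0, where ξ ⊗ y
  -- itself is zero.
  have rankOne : ∀ (ξ : X →L[ℝ] ℝ) (y : Y), (fderiv ℝ g m (0, ξ.smulRight y)).1.1 = 0 := by
    intro ξ y
    by_contra hne
    obtain ⟨η, hη⟩ := SeparatingDual.exists_eq_one (R := ℝ) hne
    set l : Y := (fderiv ℝ g m ((0, y), 0)).1.2 - (g m).2 (fderiv ℝ g m ((0, y), 0)).1.1 with hl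
    have hspan : ∀ y' : Y, ∃ c : ℝ, c • l = y' := by
      intro y'
      obtain ⟨w, hw, h1, h2⟩ := hsurj 0 (η.smulRight y')
      have h := contact₁_lieBracket hg hc hw (hv (ξ.smulRight y))
      rw [h1, h2] at h
      have e : (((0 : X), -(ξ w.1.1 • y)), (0 : X →L[ℝ] Y)) = (-ξ w.1.1) • ((0, y), 0) := by
        simp
      simp [hη] at h
      rw [e, map_smul] at h
      refine ⟨-ξ w.1.1, ?_⟩
      rw [← h, hl, smul_sub]
      simp
    have h1 : Module.finrank ℝ Y ≤ 1 := finrank_le_one l hspan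
    have h0 : Module.finrank ℝ Y = 0 := by omega
    have : Subsingleton Y := Module.finrank_zero_iff.1 h0
    have e : (((0 : X × Y), ξ.smulRight y)) = 0 := by
      rw [Subsingleton.elim y 0]; ext <;> simp
    rw [e, map_zero] at hne
    exact hne rfl
  have hx : (fderiv ℝ g m (0, b)).1.1 = 0 := by
    -- Every linear map from `X` to `Y` is a sum of maps of rank one, and the horizontal part of the
    -- image is linear in b.
    let β := Module.finBasis ℝ X
    have e : b = ∑ i, (LinearMap.toContinuousLinearMap (β.coord i)).smulRight (b (β i)) := by
      ext v
      conv_lhs => rw [← β.sum_repr v, map_sum]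
      simp
    let T : (X →L[ℝ] Y) →ₗ[ℝ] X := ((LinearMap.fst ℝ X Y).comp ((LinearMap.fst ℝ (X × Y) _).comp
      ((fderiv ℝ g m).toLinearMap.comp (LinearMap.inr ℝ (X × Y) (X →L[ℝ] Y)))))
    change T b = 0
    rw [e, map_sum]
    exact Finset.sum_eq_zero fun i _ => rankOne _ _
  have hy := hc.self_of_nhds _ (hv b)
  rw [mem_contact₁, hx, map_zero] at hy
  exact Prod.ext hx hy

/-- If an injective map preserves the contact distribution on first jets and the vertical vectors,
then it sends `R`-planes to `R`-planes. -/
theorem exists_map_rSpace (hg : ContDiffAt ℝ ∞ g m)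
    (hc : ∀ᶠ n in 𝓝 m, ∀ w ∈ contact₁ n, fderiv ℝ g n w ∈ contact₁ (g n))
    (hi : Function.Injective (fderiv ℝ g m))
    (hv : ∀ b : X →L[ℝ] Y, (fderiv ℝ g m (0, b)).1 = 0) (q : SymBilin X Y) :
    ∃ q' : SymBilin X Y, (rSpace (m.1, m.2, q)).map (fderiv ℝ g m).toLinearMap =
      rSpace ((g m).1, (g m).2, q') := by
  have hR : ∀ v, rLift (m.1, m.2, q) v ∈ contact₁ m := fun v => rfl
  let A : X →L[ℝ] (X × Y) × (X →L[ℝ] Y) := (fderiv ℝ g m).comp (rLift (m.1, m.2, q))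
  have hA : ∀ v, (A v).1.2 = (g m).2 (A v).1.1 := fun v => hc.self_of_nhds _ (hR v)
  let L : X →ₗ[ℝ] X := (LinearMap.fst ℝ X Y).comp ((LinearMap.fst ℝ (X × Y) _).comp A.toLinearMap)
  have hvert : ∀ b' : X →L[ℝ] Y, ∃ b : X →L[ℝ] Y, (fderiv ℝ g m (0, b)).2 = b' := by
    let V : (X →L[ℝ] Y) →ₗ[ℝ] (X →L[ℝ] Y) := (LinearMap.snd ℝ (X × Y) _).comp
      ((fderiv ℝ g m).toLinearMap.comp (LinearMap.inr ℝ (X × Y) (X →L[ℝ] Y)))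
    have hV : Function.Injective V := by
      rw [injective_iff_map_eq_zero]
      intro b hb
      have : fderiv ℝ g m (0, b) = fderiv ℝ g m 0 := by
        rw [map_zero]; exact Prod.ext (hv b) hb
      exact congrArg Prod.snd (hi this)
    exact fun b' => LinearMap.injective_iff_surjective.1 hV b'
  -- A vector of the R-plane with vertical image has the image of some vertical vector, by `hvert`.
  -- By injectivity it is vertical itself, hence zero.
  have hL : Function.Injective L := by
    rw [injective_iff_map_eq_zero]
    intro v hv0
    have h1 : (A v).1.1 = 0 := hv0
    have h2 : (A v).1.2 = 0 := by rw [hA, h1, map_zero]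
    obtain ⟨b, hb⟩ := hvert (A v).2
    have h3 : fderiv ℝ g m (0, b) = fderiv ℝ g m (rLift (m.1, m.2, q) v) :=
      Prod.ext ((hv b).trans (Prod.ext h1 h2).symm) hb
    exact (congrArg (fun w : (X × Y) × (X →L[ℝ] Y) => w.1.1) (hi h3)).symm
  let Le : X ≃L[ℝ] X := (LinearEquiv.ofInjectiveEndo L hL).toContinuousLinearEquiv
  have hLe : ∀ v, Le v = (A v).1.1 := fun v => rfl
  let B : X →L[ℝ] X →L[ℝ] Y := (ContinuousLinearMap.snd ℝ (X × Y) _).comp (A.comp (Le.symm : X →L[ℝ] X))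
  have hB : ∀ v, B (A v).1.1 = (A v).2 := fun v => by
    rw [← hLe]
    simp [B]
  -- The curvature form vanishes on the R-plane because q is symmetric, hence it vanishes on the
  -- image plane, which says that `B` is symmetric.
  have hBs : ∀ u v, B u v = B v u := by
    intro u v
    obtain ⟨u, rfl⟩ := Le.surjective u
    obtain ⟨v, rfl⟩ := Le.surjective v
    rw [hLe, hLe, hB, hB]
    have h := contact₁_lieBracket hg hc (hR u) (hR v)
    have e : (((0 : X), (0 : Y)), (0 : X →L[ℝ] Y)) = 0 := rfl
    simp only [rLift_apply, SymBilin.symm q u v, sub_self, e, map_zero] at h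
    simp at h
    exact (sub_eq_zero.1 h.symm)
  refine ⟨symmetrize B, ?_⟩
  ext w
  rw [mem_rSpace, incl_symmetrize hBs]
  constructor
  · rintro ⟨w, hw, rfl⟩
    rw [SetLike.mem_coe, mem_rSpace_iff_rLift] at hw
    rw [← hw]
    exact ⟨hA _, (hB _).symm⟩
  · rintro ⟨h1, h2⟩
    refine ⟨_, rLift_mem _ (Le.symm w.1.1), ?_⟩
    have h3 : (A (Le.symm w.1.1)).1.1 = w.1.1 := by rw [← hLe]; simp
    change A (Le.symm w.1.1) = w
    refine Prod.ext (Prod.ext h3 ?_) ?_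
    · rw [hA, h3, ← h1]
    · rw [← hB, h3, h2]

variable (g) in
/-- The prolongation of the map `g` between coordinate spaces of first jets. -/
def prolongMap (n : (X × Y) × (X →L[ℝ] Y) × SymBilin X Y) :
    (X × Y) × (X →L[ℝ] Y) × SymBilin X Y :=
  -- The image of the R-plane is written as a graph over its horizontal part. Where the horizontal
  -- part is not invertible, `inverse` is zero and the value has no meaning.
  ((g (dropSecond n)).1, (g (dropSecond n)).2, symmetrize
    (((ContinuousLinearMap.snd ℝ (X × Y) _).comp
      ((fderiv ℝ g (dropSecond n)).comp (rLift n))).comp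
    (((ContinuousLinearMap.fst ℝ X Y).comp (ContinuousLinearMap.fst ℝ (X × Y) _)).comp
      ((fderiv ℝ g (dropSecond n)).comp (rLift n))).inverse))

-- A vector of an R-plane is determined by its horizontal part, so the horizontal part of the
-- injective map onto the image plane is invertible, and q is then read off. This turns the
-- geometric description of a lift by R-planes into the explicit formula from which its smoothness
-- follows.
omit [FiniteDimensional ℝ Y] in
theorem prolongMap_spec {n : (X × Y) × (X →L[ℝ] Y) × SymBilin X Y} {q : SymBilin X Y}
    (hi : Function.Injective (fderiv ℝ g (dropSecond n)))
    (h : (rSpace n).map (fderiv ℝ g (dropSecond n)).toLinearMap =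
      rSpace ((g (dropSecond n)).1, (g (dropSecond n)).2, q)) :
    (((ContinuousLinearMap.fst ℝ X Y).comp (ContinuousLinearMap.fst ℝ (X × Y) _)).comp
      ((fderiv ℝ g (dropSecond n)).comp (rLift n))).IsInvertible ∧
    prolongMap g n = ((g (dropSecond n)).1, (g (dropSecond n)).2, q) := by
  set A : X →L[ℝ] (X × Y) × (X →L[ℝ] Y) := (fderiv ℝ g (dropSecond n)).comp (rLift n) with hAdef
  have hA : ∀ v, A v ∈ rSpace ((g (dropSecond n)).1, (g (dropSecond n)).2, q) := fun v => by
    rw [← h]; exact ⟨_, rLift_mem n v, rfl⟩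
  set L : X →L[ℝ] X := ((ContinuousLinearMap.fst ℝ X Y).comp
    (ContinuousLinearMap.fst ℝ (X × Y) _)).comp A with hLdef
  have hL : Function.Injective L.toLinearMap := by
    rw [injective_iff_map_eq_zero]
    intro v hv
    have h1 : (A v).1.1 = 0 := hv
    have h2 := mem_rSpace_iff_rLift.1 (hA v)
    rw [h1, map_zero] at h2
    have h3 : fderiv ℝ g (dropSecond n) (rLift n v) = fderiv ℝ g (dropSecond n) 0 := by
      rw [map_zero]; exact h2.symm
    exact congrArg (fun w : (X × Y) × (X →L[ℝ] Y) => w.1.1) (hi h3)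
  let Le : X ≃L[ℝ] X := (LinearEquiv.ofInjectiveEndo L.toLinearMap hL).toContinuousLinearEquiv
  have hLe : (Le : X →L[ℝ] X) = L := rfl
  refine ⟨⟨Le, hLe⟩, ?_⟩
  have : ((ContinuousLinearMap.snd ℝ (X × Y) (X →L[ℝ] Y)).comp A).comp L.inverse = q.incl := by
    rw [← hLe, ContinuousLinearMap.inverse_equiv]
    refine ContinuousLinearMap.ext fun v => ?_
    have h1 := (hA (Le.symm v)).2
    have h2 : (A (Le.symm v)).1.1 = v := by
      change L (Le.symm v) = v
      rw [← hLe]; simp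
    rw [h2] at h1
    exact h1
  rw [prolongMap, ← hAdef, ← hLdef, this, symmetrize_incl]

omit [FiniteDimensional ℝ X] [FiniteDimensional ℝ Y] in
theorem rLift_contDiff : ContDiff ℝ ∞ (rLift : (X × Y) × (X →L[ℝ] Y) × SymBilin X Y → _) := by
  have : (rLift : (X × Y) × (X →L[ℝ] Y) × SymBilin X Y → _) = fun n =>
      (ContinuousLinearMap.inl ℝ (X × Y) (X →L[ℝ] Y)).comp (ContinuousLinearMap.inl ℝ X Y) +
      ((ContinuousLinearMap.inl ℝ (X × Y) (X →L[ℝ] Y)).comp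
        (ContinuousLinearMap.inr ℝ X Y)).comp n.2.1 +
      (ContinuousLinearMap.inr ℝ (X × Y) (X →L[ℝ] Y)).comp n.2.2.incl := by
    funext n
    ext v <;> simp
  rw [this]
  have h2 : ContDiff ℝ ∞ (fun n : (X × Y) × (X →L[ℝ] Y) × SymBilin X Y => n.2.2.incl) :=
    SymBilin.incl_contDiff.comp (contDiff_snd.comp contDiff_snd)
  exact (contDiff_const.add (contDiff_const.clm_comp (contDiff_fst.comp contDiff_snd))).add
    (contDiff_const.clm_comp h2)

omit [FiniteDimensional ℝ Y] in
theorem prolongMap_contDiffAt {n : (X × Y) × (X →L[ℝ] Y) × SymBilin X Y}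
    (hg : ContDiffAt ℝ ∞ g (dropSecond n))
    (h : (((ContinuousLinearMap.fst ℝ X Y).comp (ContinuousLinearMap.fst ℝ (X × Y) _)).comp
      ((fderiv ℝ g (dropSecond n)).comp (rLift n))).IsInvertible) :
    ContDiffAt ℝ ∞ (prolongMap g) n := by
  have hd : ContDiffAt ℝ ∞ (dropSecond : (X × Y) × (X →L[ℝ] Y) × SymBilin X Y → _) n :=
    (dropSecondL (X := X) (Y := Y)).contDiff.contDiffAt
  have h1 : ContDiffAt ℝ ∞ (fun n : (X × Y) × (X →L[ℝ] Y) × SymBilin X Y => g (dropSecond n)) n :=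
    ContDiffAt.comp n hg hd
  have h2 : ContDiffAt ℝ ∞ (fun n : (X × Y) × (X →L[ℝ] Y) × SymBilin X Y =>
      (fderiv ℝ g (dropSecond n)).comp (rLift n)) n :=
    (ContDiffAt.comp n (hg.fderiv_right (m := ∞) (by simp)) hd).clm_comp rLift_contDiff.contDiffAt
  refine h1.fst.prodMk (h1.snd.prodMk (symmetrize_contDiff.contDiffAt.comp n ?_))
  exact (contDiffAt_const.clm_comp h2).clm_comp
    (ContDiffAt.comp n (g := ContinuousLinearMap.inverse) h.contDiffAt_map_inverse
      (contDiffAt_const.clm_comp h2))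

end FirstOrder

/-! ### Tangent maps and tangent spaces of subsets, read in charts. -/

section Manifolds

variable {V N V' N' V'' N'' Z : Type*}
  [NormedAddCommGroup V] [NormedSpace ℝ V] [TopologicalSpace N] [ChartedSpace V N]
  [NormedAddCommGroup V'] [NormedSpace ℝ V'] [TopologicalSpace N'] [ChartedSpace V' N']
  [NormedAddCommGroup V''] [NormedSpace ℝ V''] [TopologicalSpace N''] [ChartedSpace V'' N'']
  [NormedAddCommGroup Z] [NormedSpace ℝ Z]

variable (V V') in
/-- The tangent map of `F` at `p` as a map between model spaces. -/
def tMap (F : N → N') (p : N) : V →L[ℝ] V' := mfderiv 𝓘(ℝ, V) 𝓘(ℝ, V') F p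

theorem tMap_comp {F : N → N'} {G : N' → N''} {p : N}
    (hG : ContMDiffAt 𝓘(ℝ, V') 𝓘(ℝ, V'') ∞ G (F p)) (hF : ContMDiffAt 𝓘(ℝ, V) 𝓘(ℝ, V') ∞ F p) :
    tMap V V'' (fun q => G (F q)) p = (tMap V' V'' G (F p)).comp (tMap V V' F p) :=
  mfderiv_comp p (hG.mdifferentiableAt (by simp)) (hF.mdifferentiableAt (by simp))

theorem tMap_congr {F G : N → N'} {p : N} (h : F =ᶠ[𝓝 p] G) : tMap V V' F p = tMap V V' G p :=
  h.mfderiv_eq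

theorem tMap_eq_fderiv (F : V → V') (p : V) : tMap V V' F p = fderiv ℝ F p := mfderiv_eq_fderiv

theorem tMap_id (p : N) : tMap V V (fun q : N => q) p = ContinuousLinearMap.id ℝ V := mfderiv_id

theorem tMap_leftInverse {F : N → N'} {G : N' → N} {p : N}
    (hG : ContMDiffAt 𝓘(ℝ, V') 𝓘(ℝ, V) ∞ G (F p)) (hF : ContMDiffAt 𝓘(ℝ, V) 𝓘(ℝ, V') ∞ F p)
    (h : ∀ᶠ q in 𝓝 p, G (F q) = q) (w : V) : tMap V' V G (F p) (tMap V V' F p w) = w := by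
  have h1 := tMap_comp hG hF
  rw [tMap_congr h, tMap_id] at h1
  exact (congrArg (fun L : V →L[ℝ] V => L w) h1).symm

variable (V) in
/-- `tangentTo` as a subspace of the model space. -/
def tanSpace (S : Set N) (p : N) : Submodule ℝ V := tangentTo S p

theorem velocity_mem_tanSpace {S : Set N} {p : N} {γ : ℝ → N} (hγ : ContMDiff 𝓘(ℝ, ℝ) 𝓘(ℝ, V) ∞ γ)
    (hS : ∀ t, γ t ∈ S) (h0 : γ 0 = p) : tMap ℝ V γ 0 (1 : ℝ) ∈ tanSpace V S p := by
  subst h0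
  have h : tMap ℝ V γ 0 (1 : ℝ) ∈ {v : TangentSpace 𝓘(ℝ, V) (γ 0) | ∃ γ' : ℝ → N,
      ContMDiff 𝓘(ℝ, ℝ) 𝓘(ℝ, V) ∞ γ' ∧ (∀ t, γ' t ∈ S) ∧ γ' 0 = γ 0 ∧
      (mfderiv 𝓘(ℝ, ℝ) 𝓘(ℝ, V) γ' 0 (1 : ℝ) : V) = v} := ⟨γ, hγ, hS, rfl, rfl⟩
  exact (Submodule.subset_span (R := ℝ) (M := TangentSpace 𝓘(ℝ, V) (γ 0)) h)

theorem tanSpace_le {S : Set N} {p : N} {T : Submodule ℝ V}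
    (h : ∀ γ : ℝ → N, ContMDiff 𝓘(ℝ, ℝ) 𝓘(ℝ, V) ∞ γ → (∀ t, γ t ∈ S) → γ 0 = p →
      tMap ℝ V γ 0 (1 : ℝ) ∈ T) : tanSpace V S p ≤ T := by
  refine Submodule.span_le.2 ?_
  rintro w ⟨γ, hγ, hγS, h0, rfl⟩
  exact h γ hγ hγS h0

/-- The tangent map of a chart. -/
def cMap (c : OpenPartialHomeomorph N V) (p : N) : V →L[ℝ] V := tMap V V c p

section Chart

variable {c : OpenPartialHomeomorph N V} (hc : c ∈ IsManifold.maximalAtlas 𝓘(ℝ, V) ∞ N)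
  {p : N} (hp : p ∈ c.source)

include hc hp

theorem chart_contMDiffAt : ContMDiffAt 𝓘(ℝ, V) 𝓘(ℝ, V) ∞ c p := by
  exact contMDiffAt_of_mem_maximalAtlas hc hp

theorem chart_symm_contMDiffAt : ContMDiffAt 𝓘(ℝ, V) 𝓘(ℝ, V) ∞ c.symm (c p) := by
  exact contMDiffAt_symm_of_mem_maximalAtlas hc (c.map_source hp)

theorem tMap_symm_cMap (w : V) : tMap V V c.symm (c p) (cMap c p w) = w :=
  tMap_leftInverse (chart_symm_contMDiffAt hc hp) (chart_contMDiffAt hc hp)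
    (by filter_upwards [c.open_source.mem_nhds hp] with q hq using c.left_inv hq) w

theorem cMap_tMap_symm (w : V) : cMap c p (tMap V V c.symm (c p) w) = w := by
  have h := tMap_leftInverse (V := V) (V' := V) (F := c.symm) (G := c) (p := c p)
    (by rw [c.left_inv hp]; exact chart_contMDiffAt hc hp) (chart_symm_contMDiffAt hc hp)
    (by filter_upwards [c.open_target.mem_nhds (c.map_source hp)] with q hq using c.right_inv hq) w
  rwa [c.left_inv hp] at h

theorem cMap_injective : Function.Injective (cMap c p) :=
  Function.LeftInverse.injective (tMap_symm_cMap hc hp)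

theorem cMap_surjective : Function.Surjective (cMap c p) :=
  Function.RightInverse.surjective (cMap_tMap_symm hc hp)

variable {c' : OpenPartialHomeomorph N' V'} (hc' : c' ∈ IsManifold.maximalAtlas 𝓘(ℝ, V') ∞ N')

include hc'

theorem rep_contDiffAt {F : N → N'} (hF : ContMDiffAt 𝓘(ℝ, V) 𝓘(ℝ, V') ∞ F p)
    (hp' : F p ∈ c'.source) : ContDiffAt ℝ ∞ (fun v => c' (F (c.symm v))) (c p) := by
  rw [← contMDiffAt_iff_contDiffAt]
  have h1 : ContMDiffAt 𝓘(ℝ, V) 𝓘(ℝ, V') ∞ F (c.symm (c p)) := by rwa [c.left_inv hp]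
  have h2 : ContMDiffAt 𝓘(ℝ, V') 𝓘(ℝ, V') ∞ c' (F (c.symm (c p))) := by
    rw [c.left_inv hp]; exact chart_contMDiffAt hc' hp'
  exact ContMDiffAt.comp (c p) (g := c') (f := fun v => F (c.symm v)) h2
    (ContMDiffAt.comp (c p) h1 (chart_symm_contMDiffAt hc hp))

theorem rep_fderiv {F : N → N'} (hF : ContMDiffAt 𝓘(ℝ, V) 𝓘(ℝ, V') ∞ F p)
    (hp' : F p ∈ c'.source) (w : V) :
    fderiv ℝ (fun v => c' (F (c.symm v))) (c p) (cMap c p w) =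
      cMap c' (F p) (tMap V V' F p w) := by
  have h1 : ContMDiffAt 𝓘(ℝ, V) 𝓘(ℝ, V') ∞ (fun v => c' (F (c.symm v))) (c p) :=
    contMDiffAt_iff_contDiffAt.2 (rep_contDiffAt hc hp hc' hF hp')
  rw [cMap, cMap, ← tMap_eq_fderiv, ← ContinuousLinearMap.comp_apply, ← ContinuousLinearMap.comp_apply,
    ← tMap_comp h1 (chart_contMDiffAt hc hp), ← tMap_comp (chart_contMDiffAt hc' hp') hF]
  congr 1
  apply tMap_congr
  filter_upwards [c.open_source.mem_nhds hp] with q hq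
  rw [c.left_inv hq]

theorem contMDiffAt_of_rep {F : N → N'} (hF : ∀ᶠ q in 𝓝 p, F q ∈ c'.source) {R : V → V'}
    (hR : ContDiffAt ℝ ∞ R (c p)) (h : ∀ᶠ q in 𝓝 p, c' (F q) = R (c q)) :
    ContMDiffAt 𝓘(ℝ, V) 𝓘(ℝ, V') ∞ F p := by
  have h1 : ContMDiffAt 𝓘(ℝ, V) 𝓘(ℝ, V') ∞ (fun q => R (c q)) p :=
    ContMDiffAt.comp p (contMDiffAt_iff_contDiffAt.2 hR) (chart_contMDiffAt hc hp)
  have h2 : ContMDiffAt 𝓘(ℝ, V') 𝓘(ℝ, V') ∞ c'.symm (R (c p)) := by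
    rw [← h.self_of_nhds]; exact chart_symm_contMDiffAt hc' hF.self_of_nhds
  refine (ContMDiffAt.comp p (g := c'.symm) (f := fun q => R (c q)) h2 h1).congr_of_eventuallyEq ?_
  filter_upwards [hF, h] with q h3 h4
  rw [Function.comp_apply, ← h4, c'.left_inv h3]

end Chart

/-- The tangent space at `p` of a subset `S` which is near `p` the image of the map `h` in the
chart `c`, with left inverse `π`. -/
theorem mem_tangentTo_iff {c : OpenPartialHomeomorph N V}
    (hc : c ∈ IsManifold.maximalAtlas 𝓘(ℝ, V) ∞ N) {p : N} (hp : p ∈ c.source) {S : Set N}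
    {h : Z → V} {z₀ : Z} (hh : ∀ᶠ z in 𝓝 z₀, ContDiffAt ℝ ∞ h z) (h₀ : h z₀ = c p)
    (hS : ∀ᶠ z in 𝓝 z₀, h z ∈ c.target ∧ c.symm (h z) ∈ S) (π : V →L[ℝ] Z) (hz : π (c p) = z₀)
    (hπ : ∀ᶠ q in 𝓝 p, q ∈ S → c q = h (π (c q))) {w : V} :
    w ∈ tanSpace V S p ↔ ∃ v, fderiv ℝ h z₀ v = cMap c p w := by
  have hd : DifferentiableAt ℝ h z₀ := hh.self_of_nhds.differentiableAt (by simp)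
  constructor
  · intro hw
    suffices tanSpace V S p ≤
        (LinearMap.range (fderiv ℝ h z₀).toLinearMap).comap (cMap c p).toLinearMap from this hw
    refine tanSpace_le fun γ hγ hγS h0 => ?_
    subst h0
    have h1 : ContMDiffAt 𝓘(ℝ, ℝ) 𝓘(ℝ, V) ∞ (fun t => c (γ t)) 0 :=
      ContMDiffAt.comp 0 (chart_contMDiffAt hc hp) (hγ 0)
    have h2 := tMap_comp (F := γ) (chart_contMDiffAt hc hp) (hγ 0)
    -- A curve in S factors near time 0 through `h`, so its velocity lies in the range of the
    -- derivative of `h`.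
    have h3 : (fun t => c (γ t)) =ᶠ[𝓝 0] fun t => h (π (c (γ t))) := by
      filter_upwards [(hγ 0).continuousAt.eventually hπ] with t ht using ht (hγS t)
    have h4 : HasFDerivAt (fun t => c (γ t)) (fderiv ℝ (fun t => c (γ t)) 0) 0 :=
      ((contMDiffAt_iff_contDiffAt.1 h1).differentiableAt (by simp)).hasFDerivAt
    have h5 : HasFDerivAt (fun t => π (c (γ t))) (π.comp (fderiv ℝ (fun t => c (γ t)) 0)) 0 :=
      HasFDerivAt.comp (0 : ℝ) π.hasFDerivAt h4
    have h6 : HasFDerivAt (fun t => h (π (c (γ t)))) _ 0 :=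
      HasFDerivAt.comp (0 : ℝ) (g := h) (f := fun t => π (c (γ t)))
        (by rw [hz]; exact hd.hasFDerivAt) h5
    have h7 := (h6.congr_of_eventuallyEq h3).unique h4
    rw [← tMap_eq_fderiv (fun t => c (γ t)), h2] at h7
    exact ⟨_, congrArg (fun L : ℝ →L[ℝ] V => L 1) h7⟩
  · rintro ⟨v, hv⟩
    obtain ⟨r, hr, hball⟩ := Metric.eventually_nhds_iff_ball.1 (hh.and hS)
    obtain ⟨δ, hδ, hδv⟩ : ∃ δ : ℝ, 0 < δ ∧ δ * ‖v‖ < r := by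
      refine ⟨r / (‖v‖ + 1), by positivity, ?_⟩
      rw [div_mul_eq_mul_div, div_lt_iff₀ (by positivity)]
      nlinarith [norm_nonneg v]
    -- The curves in `tangentTo` must stay in S for all times. The sine keeps the segment inside the
    -- ball where `h` parametrizes S; the velocity at 0 is δ v, and δ is divided out at the end.
    set σ : ℝ → Z := fun t => z₀ + (δ * Real.sin t) • v with hσ
    have hσb : ∀ t, σ t ∈ Metric.ball z₀ r := fun t => by
      rw [mem_ball_iff_norm, hσ]
      simp only [add_sub_cancel_left, norm_smul, norm_mul, Real.norm_eq_abs, abs_of_pos hδ]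
      refine lt_of_le_of_lt ?_ hδv
      have := Real.abs_sin_le_one t
      have h3 : δ * |Real.sin t| ≤ δ := by nlinarith
      exact mul_le_mul_of_nonneg_right h3 (norm_nonneg v)
    have hσs : ContDiff ℝ ∞ σ :=
      contDiff_const.add ((contDiff_const.mul Real.contDiff_sin).smul contDiff_const)
    have hσ0 : σ 0 = z₀ := by simp [hσ]
    have hσd : HasFDerivAt σ (ContinuousLinearMap.toSpanSingleton ℝ (δ • v)) 0 := by
      have := (((Real.hasDerivAt_sin 0).const_mul δ).smul_const v).const_add z₀
      simpa only [Real.cos_zero, mul_one] using this.hasFDerivAt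
    have hγ1 : ∀ t, ContMDiffAt 𝓘(ℝ, ℝ) 𝓘(ℝ, V) ∞ (fun t => h (σ t)) t := fun t =>
      contMDiffAt_iff_contDiffAt.2
        (ContDiffAt.comp t (hball _ (hσb t)).1 hσs.contDiffAt)
    have hcs : ∀ t, ContMDiffAt 𝓘(ℝ, V) 𝓘(ℝ, V) ∞ c.symm (h (σ t)) := fun t => by
      exact contMDiffAt_symm_of_mem_maximalAtlas hc (hball _ (hσb t)).2.1
    have hd0 : tMap ℝ V (fun t => c.symm (h (σ t))) 0 (1 : ℝ) = δ • w := by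
      have h2 : HasFDerivAt (fun t => h (σ t)) _ 0 :=
        HasFDerivAt.comp (0 : ℝ) (g := h) (f := σ) (by rw [hσ0]; exact hd.hasFDerivAt) hσd
      rw [tMap_comp (F := fun t => h (σ t)) (G := c.symm) (hcs 0) (hγ1 0), tMap_eq_fderiv, h2.fderiv,
        hσ0, h₀]
      simp only [ContinuousLinearMap.comp_apply, ContinuousLinearMap.toSpanSingleton_apply,
        one_smul, map_smul, hv, tMap_symm_cMap hc hp]
    have hγ0 : c.symm (h (σ 0)) = p := by rw [hσ0, h₀, c.left_inv hp]
    have hmem := velocity_mem_tanSpace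
      (fun t => ContMDiffAt.comp t (g := c.symm) (f := fun t => h (σ t)) (hcs t) (hγ1 t))
      (fun t => (hball _ (hσb t)).2.2) hγ0
    have hmem' := (tanSpace V S p).smul_mem δ⁻¹ hmem
    rw [Function.comp_def, hd0] at hmem'
    rwa [smul_smul, inv_mul_cancel₀ hδ.ne', one_smul] at hmem'

theorem tanSpace_eq_top [IsManifold 𝓘(ℝ, V) ∞ N] {U : Set N} (hU : IsOpen U) {p : N}
    (hp : p ∈ U) : tanSpace V U p = ⊤ := by
  rw [eq_top_iff]
  intro w _
  have hc : chartAt V p ∈ IsManifold.maximalAtlas 𝓘(ℝ, V) ∞ N := IsManifold.chart_mem_maximalAtlas p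
  have hp' := mem_chart_source V p
  have ht := (chartAt V p).open_target.mem_nhds ((chartAt V p).map_source hp')
  have hs := (chartAt V p).continuousAt_symm ((chartAt V p).map_source hp')
  rw [ContinuousAt, (chartAt V p).left_inv hp'] at hs
  refine (mem_tangentTo_iff hc hp' (h := fun z => z) (z₀ := chartAt V p p)
    (Eventually.of_forall fun z => contDiffAt_id) rfl ?_
    (ContinuousLinearMap.id ℝ V) rfl (Eventually.of_forall fun q _ => rfl)).2 ?_
  · filter_upwards [ht, hs (hU.mem_nhds hp)] with z h1 h2 using ⟨h1, h2⟩
  · exact ⟨_, by rw [fderiv_fun_id]; rfl⟩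

end Manifolds

/-! ### Functions with prescribed third order behaviour in one direction. -/

section Cubic

variable {X Y : Type*} [NormedAddCommGroup X] [NormedSpace ℝ X]
  [NormedAddCommGroup Y] [NormedSpace ℝ Y]

theorem hasFDerivAt_apply_sub (B : X →L[ℝ] Y) (x₀ x : X) :
    HasFDerivAt (fun x => B (x - x₀)) B x :=
  B.hasFDerivAt.comp x ((hasFDerivAt_id x).sub_const x₀)

/-- The symmetrization of bilinear maps as a continuous linear map. -/
def symmetrizeL : (X →L[ℝ] X →L[ℝ] Y) →L[ℝ] SymBilin X Y :=
  Fixed.proj (flipBilin X Y) flipBilin_flipBilin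

theorem symmetrize_hasFDerivAt (B : X →L[ℝ] X →L[ℝ] Y) :
    HasFDerivAt symmetrize symmetrizeL B := by
  have h : HasFDerivAt (fun B => symmetrizeL B) (symmetrizeL (X := X) (Y := Y)) B :=
    ContinuousLinearMap.hasFDerivAt _
  exact h

/-- A symmetric trilinear map with prescribed contraction with a nonzero vector. -/
theorem exists_trilinear {v : X} (hv : v ≠ 0) (q : SymBilin X Y) :
    ∃ T : X →L[ℝ] X →L[ℝ] X →L[ℝ] Y, (∀ a b c, T a b c = T b a c) ∧ (∀ a b c, T a b c = T a c b) ∧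
      T v = q.incl := by
  obtain ⟨ξ, hξ⟩ := SeparatingDual.exists_eq_one (R := ℝ) hv
  -- Inclusion and exclusion with ξ(v) = 1: the three terms ξ(a) q(b,c), minus the three terms ξ(a)
  -- ξ(b) q(v,c), plus ξ(a) ξ(b) ξ(c) q(v,v). For a = v everything cancels except q(b,c).
  refine ⟨ξ.smulRight q.incl + (ξ.smulRight q.incl).flip +
    bilPush (ContinuousLinearMap.smulRightL ℝ X Y ξ) q.incl -
    ξ.smulRight (ξ.smulRight (q.incl v)) - ξ.smulRight (ξ.smulRight (q.incl v)).flip -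
    (ξ.smulRight (ξ.smulRight (q.incl v)).flip).flip +
    ξ.smulRight (ξ.smulRight (ξ.smulRight (q.incl v v))), ?_, ?_, ?_⟩
  · intro a b c
    simp [bilPush_apply, SymBilin.symm q a b]
    module
  · intro a b c
    simp [bilPush_apply, SymBilin.symm q c b]
    module
  · ext a b
    simp [bilPush_apply, hξ]
    module

/-- A function with prescribed second jet at a point, and prescribed derivative of the second
derivative in a nonzero direction. -/
theorem exists_function_third (m : (X × Y) × (X →L[ℝ] Y) × SymBilin X Y) {v : X} (hv : v ≠ 0)
    (q : SymBilin X Y) :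
    ∃ f : X → Y, ContDiff ℝ ∞ f ∧ f m.1.1 = m.1.2 ∧ fderiv ℝ f m.1.1 = m.2.1 ∧
      fderiv ℝ (fderiv ℝ f) m.1.1 = m.2.2.incl ∧
      fderiv ℝ (fun x => symmetrize (fderiv ℝ (fderiv ℝ f) x)) m.1.1 v = q := by
  obtain ⟨T, hT1, hT2, hTv⟩ := exists_trilinear hv q
  set x₀ := m.1.1
  have hs : ∀ x : X, HasFDerivAt (fun x : X => x - x₀) (ContinuousLinearMap.id ℝ X) x :=
    fun x => (hasFDerivAt_id x).sub_const x₀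
  -- The Taylor polynomial with third derivative `T`, whose contraction with v is q.
  let f : X → Y := fun x => m.1.2 + m.2.1 (x - x₀) + (2⁻¹ : ℝ) • m.2.2.incl (x - x₀) (x - x₀) +
    (6⁻¹ : ℝ) • T (x - x₀) (x - x₀) (x - x₀)
  have hT2' : ∀ x, HasFDerivAt (fun x => T (x - x₀) (x - x₀))
      ((2 : ℝ) • T (x - x₀)) x := by
    intro x
    have h1 := hasFDerivAt_apply_sub (Y := X →L[ℝ] X →L[ℝ] Y) T x₀ x
    have h2 := h1.clm_apply (hs x)
    refine h2.congr_fderiv ?_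
    ext u w
    have h2 := hT1 u (x - x₀) w
    simp only [map_sub, sub_apply] at h2
    simp [h2]
    module
  have hf1 : ∀ x, HasFDerivAt f (m.2.1 + m.2.2.incl (x - x₀) +
      (2⁻¹ : ℝ) • T (x - x₀) (x - x₀)) x := by
    intro x
    have a1 := (hasFDerivAt_apply_sub m.2.1 x₀ x).const_add m.1.2
    have a2 := ((hasFDerivAt_apply_sub m.2.2.incl x₀ x).clm_apply
      (hs x)).const_smul (2⁻¹ : ℝ)
    have b2 := (hT2' x).clm_apply (hs x)
    have a3 := b2.const_smul (6⁻¹ : ℝ)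
    refine ((a1.add a2).add a3).congr_fderiv ?_
    ext u
    have h1 := SymBilin.symm m.2.2 u (x - x₀)
    have h3 := hT2 (x - x₀) u (x - x₀)
    simp only [map_sub, sub_apply] at h1 h3
    simp [h1, h3]
    module
  have hf2 : fderiv ℝ f = fun x => m.2.1 + m.2.2.incl (x - x₀) +
      (2⁻¹ : ℝ) • T (x - x₀) (x - x₀) := funext fun x => (hf1 x).fderiv
  have hf3 : ∀ x, HasFDerivAt (fderiv ℝ f) (m.2.2.incl + T (x - x₀)) x := by
    intro x
    rw [hf2]
    have a2 := (hasFDerivAt_apply_sub m.2.2.incl x₀ x).const_add m.2.1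
    have a3 := (hT2' x).const_smul (2⁻¹ : ℝ)
    refine (a2.add a3).congr_fderiv ?_
    ext u w
    simp
  have hf4 : fderiv ℝ (fderiv ℝ f) = fun x => m.2.2.incl + T (x - x₀) :=
    funext fun x => (hf3 x).fderiv
  have hf5 : HasFDerivAt (fun x => m.2.2.incl + T (x - x₀)) T x₀ := by
    exact (hasFDerivAt_apply_sub (Y := X →L[ℝ] X →L[ℝ] Y) T x₀ x₀).const_add m.2.2.incl
  refine ⟨f, ?_, ?_, ?_, ?_, ?_⟩
  · have h1 : ContDiff ℝ ∞ (fun x : X => x - x₀) := contDiff_id.sub contDiff_const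
    exact ((contDiff_const.add (contDiff_const.clm_apply h1)).add
      (contDiff_const.smul ((contDiff_const.clm_apply h1).clm_apply h1))).add
      (contDiff_const.smul (((contDiff_const.clm_apply h1).clm_apply h1).clm_apply h1))
  · simp [f]
  · rw [hf2]; simp
  · rw [hf4]; simp
  · rw [hf4]
    have h : HasFDerivAt (fun x => symmetrize (m.2.2.incl + T (x - x₀))) (symmetrizeL.comp T) x₀ :=
      HasFDerivAt.comp (g := symmetrize) (f := fun x => m.2.2.incl + T (x - x₀)) x₀
        (symmetrize_hasFDerivAt _) hf5
    rw [h.fderiv]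
    change symmetrize (T v) = q
    rw [hTv, symmetrize_incl]

end Cubic

/-! ### Tangent spaces of prolonged submanifolds, for jets of any order. -/

section JetCharts

variable {X Y : Type*} [NormedAddCommGroup X] [NormedSpace ℝ X] [CompleteSpace X]
  [NormedAddCommGroup Y] [NormedSpace ℝ Y]
  {E : Type*} [TopologicalSpace E] [ChartedSpace (X × Y) E]

section Prolongation

variable {r : ℕ} {K : Type*} [NormedAddCommGroup K] [NormedSpace ℝ K] {J : JetCoord X Y r K}
  {e : OpenPartialHomeomorph E (X × Y)} {L : Set E} {p : E} {f : X → Y}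

omit [CompleteSpace X] in
theorem IsGraphAt.eventually (h : IsGraphAt e L p f) :
    ∀ᶠ q in 𝓝 p, q ∈ L → IsGraphAt e L q f := by
  have h1 : Tendsto (fun q => (e q).1) (𝓝 p) (𝓝 (e p).1) := (e.continuousAt h.source).fst
  filter_upwards [h1.eventually h.smooth.eventually_nhds, h.graph.eventually_nhds,
    e.open_source.mem_nhds h.source] with q h2 h3 h4 h5
  exact ⟨h.chart, h4, h5, h2, h3⟩

/-- Together with `eventually_mem_prolong` this shows that the prolongation is locally the image of
x ↦ (x, f x, D f x): nearby points of the submanifold are described by the same function f. -/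
theorem hasCoord_of_mem_prolong (h : IsGraphAt e L p f) :
    ∀ᶠ q in 𝓝 p, ∀ θ ∈ prolong X Y r L, ∀ m, HasCoord J e θ m → e.symm m.1 = q →
      m = ((m.1.1, f m.1.1), J.D f m.1.1) := by
  filter_upwards [h.eventually] with q hq
  rintro _ ⟨A, rfl, rfl⟩ m hm hmq
  have hm' := hm
  obtain ⟨f', hf', rfl⟩ := hm
  have hA : A.pt = q := by rw [← hmq, e.left_inv hf'.source]
  have hg := hq (hA ▸ A.mem)
  rw [← hA] at hg
  have h2 : IsCoord J e A (e A.pt, J.D f (e A.pt).1) := ⟨f, hg, rfl⟩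
  have h3 := HasCoord.unique hm' h2
  rw [h3]
  exact Prod.ext hg.pair.symm rfl

theorem eventually_mem_prolong {A : PointedSubmanifold X Y E}
    (h : IsGraphAt e A.carrier A.pt f) :
    ∀ᶠ x in 𝓝 (e A.pt).1, (x, f x) ∈ e.target ∧
      ∃ θ ∈ prolong X Y r A.carrier, HasCoord J e θ ((x, f x), J.D f x) := by
  filter_upwards [h.eventually_target, h.eventually_mem, h.tendsto_symm.eventually h.eventually]
    with x h1 h2 h3
  refine ⟨h1, jet r ⟨A.carrier, A.isSubmanifold, e.symm (x, f x), h2⟩, ⟨⟨A.carrier, A.isSubmanifold, e.symm (x, f x), h2⟩, rfl, rfl⟩,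
    f, h3 h2, ?_⟩
  rw [e.right_inv h1]

/-- `mem_tangentTo_iff` for the parametrization x ↦ (x, f x, D f x), with the projection to x as
left inverse. The chart enters only through `hsrc` and `hcoord`, so that one proof serves first and
second jets. -/
theorem mem_tanSpace_prolong [TopologicalSpace (Jet X Y E r)]
    [ChartedSpace ((X × Y) × K) (Jet X Y E r)]
    {c : OpenPartialHomeomorph (Jet X Y E r) ((X × Y) × K)}
    (hc : c ∈ IsManifold.maximalAtlas 𝓘(ℝ, (X × Y) × K) ∞ (Jet X Y E r))
    (hsrc : ∀ θ, θ ∈ c.source ↔ ∃ m, HasCoord J e θ m)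
    (hcoord : ∀ θ m, HasCoord J e θ m → c θ = m) {A : PointedSubmanifold X Y E}
    (h : IsGraphAt e A.carrier A.pt f)
    (hD : ∀ᶠ x in 𝓝 (e A.pt).1, ContDiffAt ℝ ∞ (J.D f) x) (w : (X × Y) × K) :
    w ∈ tanSpace ((X × Y) × K) (prolong X Y r A.carrier) (jet r A) ↔
      ∃ v, ((v, fderiv ℝ f (e A.pt).1 v), fderiv ℝ (J.D f) (e A.pt).1 v) =
        cMap c (jet r A) w := by
  have hA : HasCoord J e (jet r A) (e A.pt, J.D f (e A.pt).1) := ⟨f, h, rfl⟩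
  have hAs : jet r A ∈ c.source := (hsrc _).2 ⟨_, hA⟩
  have hAc := hcoord _ _ hA
  have hcont : Tendsto (fun θ => e.symm (c θ).1) (𝓝 (jet r A)) (𝓝 A.pt) := by
    have h1 : Tendsto (fun θ => (c θ).1) (𝓝 (jet r A)) (𝓝 (e A.pt)) := by
      have := (c.continuousAt hAs).fst
      rwa [ContinuousAt, hAc] at this
    have h2 := e.continuousAt_symm (e.map_source h.source)
    rw [ContinuousAt, e.left_inv h.source] at h2
    exact h2.comp h1
  have hd : fderiv ℝ (fun x => ((x, f x), J.D f x)) (e A.pt).1 =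
      ((ContinuousLinearMap.id ℝ X).prod (fderiv ℝ f (e A.pt).1)).prod
        (fderiv ℝ (J.D f) (e A.pt).1) :=
    (((hasFDerivAt_id _).prodMk (h.smoothAt.differentiableAt (by simp)).hasFDerivAt).prodMk
      (hD.self_of_nhds.differentiableAt (by simp)).hasFDerivAt).fderiv
  rw [mem_tangentTo_iff hc hAs (h := fun x => ((x, f x), J.D f x)) (z₀ := (e A.pt).1) ?_ ?_ ?_
    ((ContinuousLinearMap.fst ℝ X Y).comp (ContinuousLinearMap.fst ℝ (X × Y) K)) ?_ ?_, hd]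
  · rfl
  · filter_upwards [h.smooth, hD] with x h1 h2 using (contDiffAt_id.prodMk h1).prodMk h2
  · rw [hAc, h.pair]
  · filter_upwards [eventually_mem_prolong (r := r) (J := J) h] with x hx
    obtain ⟨h1, θ, h2, h3⟩ := hx
    have h4 : θ ∈ c.source := (hsrc _).2 ⟨_, h3⟩
    have h5 := hcoord _ _ h3
    rw [← h5]
    exact ⟨c.map_source h4, by rw [c.left_inv h4]; exact h2⟩
  · rw [hAc]; rfl
  · filter_upwards [hcont.eventually (hasCoord_of_mem_prolong (r := r) (J := J) h),
      c.open_source.mem_nhds hAs] with θ h1 h2 h3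
    obtain ⟨m, hm⟩ := (hsrc _).1 h2
    have h4 := hcoord _ _ hm
    rw [← h4] at hm
    exact h1 θ h3 _ hm rfl

end Prolongation

end JetCharts

/-! ### R-planes and Cartan distributions on the spaces of first and second jets. -/

section JetSpaces

variable {X Y : Type*} [NormedAddCommGroup X] [NormedSpace ℝ X] [CompleteSpace X]
  [NormedAddCommGroup Y] [NormedSpace ℝ Y]
  {E : Type*} [TopologicalSpace E] [ChartedSpace (X × Y) E]
  {e : OpenPartialHomeomorph E (X × Y)}

variable (X Y) in
/-- The model space of the space of first jets. -/
abbrev Model₁ : Type _ := (X × Y) × (X →L[ℝ] Y)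

variable (X Y) in
/-- The model space of the space of second jets. -/
abbrev Model₂ : Type _ := (X × Y) × (X →L[ℝ] Y) × SymBilin X Y

theorem hasCoord_jetProj {θ : Jet X Y E 2} {m : Model₂ X Y}
    (h : HasCoord (secondJetCoord X Y) e θ m) :
    HasCoord (firstJetCoord X Y) e (jetProj θ) (dropSecond m) := by
  induction θ using Quot.ind
  obtain ⟨f, hf, rfl⟩ := h
  exact ⟨f, hf, rfl⟩

theorem HasCoord.exists_second {θ : Jet X Y E 2} {m : Model₁ X Y}
    (h : HasCoord (firstJetCoord X Y) e (jetProj θ) m) :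
    ∃ m', HasCoord (secondJetCoord X Y) e θ m' := by
  induction θ using Quot.ind
  obtain ⟨f, hf, rfl⟩ := h
  exact ⟨_, f, hf, rfl⟩

variable [IsManifold 𝓘(ℝ, X × Y) ∞ E]
  (he : e ∈ IsManifold.maximalAtlas 𝓘(ℝ, X × Y) ∞ E)

/-- The chart of the space of first jets induced by the divided chart `e`. -/
def chart₁ : OpenPartialHomeomorph (Jet X Y E 1) (Model₁ X Y) :=
  (jetCore E (firstJetCoord X Y)).openPartialHomeomorph (jetChart _ e he) ⟨e, he, rfl⟩

/-- The chart of the space of second jets induced by the divided chart `e`. -/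
def chart₂ : OpenPartialHomeomorph (Jet X Y E 2) (Model₂ X Y) :=
  (jetCore E (secondJetCoord X Y)).openPartialHomeomorph (jetChart _ e he) ⟨e, he, rfl⟩

theorem chart₁_mem : chart₁ he ∈ IsManifold.maximalAtlas 𝓘(ℝ, Model₁ X Y) ∞ (Jet X Y E 1) := by
  refine IsManifold.subset_maximalAtlas ?_
  exact mem_iUnion.2 ⟨jetChart _ e he, mem_iUnion.2 ⟨⟨e, he, rfl⟩, rfl⟩⟩

theorem chart₂_mem : chart₂ he ∈ IsManifold.maximalAtlas 𝓘(ℝ, Model₂ X Y) ∞ (Jet X Y E 2) := by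
  refine IsManifold.subset_maximalAtlas ?_
  exact mem_iUnion.2 ⟨jetChart _ e he, mem_iUnion.2 ⟨⟨e, he, rfl⟩, rfl⟩⟩

theorem mem_chart₁_target {m : Model₁ X Y} : m ∈ (chart₁ he).target ↔ m.1 ∈ e.target := Iff.rfl

theorem chart₁_apply {θ : Jet X Y E 1} {m : Model₁ X Y}
    (h : HasCoord (firstJetCoord X Y) e θ m) : chart₁ he θ = m := jetChart_apply he h

theorem chart₂_apply {θ : Jet X Y E 2} {m : Model₂ X Y}
    (h : HasCoord (secondJetCoord X Y) e θ m) : chart₂ he θ = m := jetChart_apply he h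

theorem hasCoord_chart₁ {θ : Jet X Y E 1} (h : θ ∈ (chart₁ he).source) :
    HasCoord (firstJetCoord X Y) e θ (chart₁ he θ) := by
  obtain ⟨m, hm⟩ := h
  rwa [chart₁_apply he hm]

theorem hasCoord_chart₂ {θ : Jet X Y E 2} (h : θ ∈ (chart₂ he).source) :
    HasCoord (secondJetCoord X Y) e θ (chart₂ he θ) := by
  obtain ⟨m, hm⟩ := h
  rwa [chart₂_apply he hm]

variable (X Y) in
theorem exists_chart₁ (θ : Jet X Y E 1) :
    ∃ (e : OpenPartialHomeomorph E (X × Y))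
      (he : e ∈ IsManifold.maximalAtlas 𝓘(ℝ, X × Y) ∞ E), θ ∈ (chart₁ he).source :=
  exists_jetChart (firstJetCoord X Y) θ

/-- Being a graph in a divided chart does not refer to the order of the jet. Hence an induced chart
of second jets contains every fibre of `jetProj` that it meets. -/
theorem jetProj_mem_source {θ : Jet X Y E 2} :
    jetProj θ ∈ (chart₁ he).source ↔ θ ∈ (chart₂ he).source :=
  ⟨fun ⟨_, hm⟩ => hm.exists_second, fun ⟨_, hm⟩ => ⟨_, hasCoord_jetProj hm⟩⟩

theorem exists_chart₂ (θ : Jet X Y E 2) :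
    ∃ (e : OpenPartialHomeomorph E (X × Y))
      (he : e ∈ IsManifold.maximalAtlas 𝓘(ℝ, X × Y) ∞ E), θ ∈ (chart₂ he).source := by
  obtain ⟨e, he, h⟩ := exists_chart₁ X Y (jetProj θ)
  exact ⟨e, he, (jetProj_mem_source he).1 h⟩

theorem chart₁_jetProj {θ : Jet X Y E 2} (h : θ ∈ (chart₂ he).source) :
    chart₁ he (jetProj θ) = dropSecond (chart₂ he θ) :=
  chart₁_apply he (hasCoord_jetProj (hasCoord_chart₂ he h))

variable (X Y E) in
theorem jetProj_contMDiff :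
    ContMDiff 𝓘(ℝ, Model₂ X Y) 𝓘(ℝ, Model₁ X Y) ∞ (jetProj : Jet X Y E 2 → Jet X Y E 1) := by
  intro θ
  obtain ⟨e, he, h⟩ := exists_chart₂ θ
  refine contMDiffAt_of_rep (chart₂_mem he) h (chart₁_mem he) (R := dropSecond) ?_
    (dropSecondL (X := X) (Y := Y)).contDiff.contDiffAt ?_
  · filter_upwards [(chart₂ he).open_source.mem_nhds h] with q hq
    exact (jetProj_mem_source he).2 hq
  · filter_upwards [(chart₂ he).open_source.mem_nhds h] with q hq
    exact chart₁_jetProj he hq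

/-- The tangent map of `jetProj`. -/
def dProj (θ : Jet X Y E 2) : Model₂ X Y →L[ℝ] Model₁ X Y :=
  tMap (Model₂ X Y) (Model₁ X Y) jetProj θ

theorem cMap_dProj {θ : Jet X Y E 2} (h : θ ∈ (chart₂ he).source) (w : Model₂ X Y) :
    cMap (chart₁ he) (jetProj θ) (dProj θ w) = dropSecond (cMap (chart₂ he) θ w) := by
  have h1 := rep_fderiv (chart₂_mem he) h (chart₁_mem he) (jetProj_contMDiff X Y E θ)
    ((jetProj_mem_source he).2 h) w
  rw [dProj, ← h1]
  have h2 : (fun v => chart₁ he (jetProj ((chart₂ he).symm v))) =ᶠ[𝓝 (chart₂ he θ)]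
      dropSecondL (X := X) (Y := Y) := by
    filter_upwards [(chart₂ he).open_target.mem_nhds ((chart₂ he).map_source h)] with v hv
    rw [chart₁_jetProj he ((chart₂ he).map_target hv), (chart₂ he).right_inv hv, dropSecondL_apply]
  rw [h2.fderiv_eq, ContinuousLinearMap.fderiv, dropSecondL_apply]

theorem dProj_surjective (θ : Jet X Y E 2) : Function.Surjective (dProj θ) := by
  intro w
  obtain ⟨e, he, h⟩ := exists_chart₂ θ
  obtain ⟨u, hu⟩ := cMap_surjective (chart₂_mem he) h
    ((cMap (chart₁ he) (jetProj θ) w).1, ((cMap (chart₁ he) (jetProj θ) w).2, 0))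
  refine ⟨u, cMap_injective (chart₁_mem he) ((jetProj_mem_source he).2 h) ?_⟩
  rw [cMap_dProj he h, hu]
  rfl

/-- The tangent space of the first prolongation of a submanifold, in coordinates. -/
theorem mem_tanSpace_prolong_one {A : PointedSubmanifold X Y E}
    (h : jet 2 A ∈ (chart₂ he).source) (w : Model₁ X Y) :
    w ∈ tanSpace (Model₁ X Y) (prolong X Y 1 A.carrier) (jet 1 A) ↔
      cMap (chart₁ he) (jet 1 A) w ∈ rSpace (chart₂ he (jet 2 A)) := by
  obtain ⟨_, f, hf, rfl⟩ := h
  have hc : chart₂ he (jet 2 A) = _ := chart₂_apply he ⟨f, hf, rfl⟩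
  rw [mem_tanSpace_prolong (J := firstJetCoord X Y) (chart₁_mem he) (fun θ => Iff.rfl)
    (fun θ m hm => chart₁_apply he hm) hf
    (by filter_upwards [hf.smooth] with x hx using hx.fderiv_right (m := ∞) (by simp)),
    hc, mem_rSpace]
  have hs := snd_symm hf.smoothAt
  constructor
  · rintro ⟨v, hv⟩
    rw [← hv]
    refine ⟨rfl, ?_⟩
    exact (congrArg (fun B : X →L[ℝ] X →L[ℝ] Y => B v) hs).symm
  · rintro ⟨h1, h2⟩
    refine ⟨(cMap (chart₁ he) (jet 1 A) w).1.1, Prod.ext (Prod.ext rfl h1.symm) ?_⟩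
    rw [h2]
    exact (congrArg (fun B : X →L[ℝ] X →L[ℝ] Y => B _) hs).symm

/-- The tangent space of the second prolongation of a submanifold, in coordinates. -/
theorem mem_tanSpace_prolong_two {A : PointedSubmanifold X Y E} {f : X → Y}
    (hf : IsGraphAt e A.carrier A.pt f) (w : Model₂ X Y) :
    w ∈ tanSpace (Model₂ X Y) (prolong X Y 2 A.carrier) (jet 2 A) ↔
      ∃ v, ((v, fderiv ℝ f (e A.pt).1 v), (fderiv ℝ (fderiv ℝ f) (e A.pt).1 v,
        fderiv ℝ (fun x => symmetrize (fderiv ℝ (fderiv ℝ f) x)) (e A.pt).1 v)) =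
        cMap (chart₂ hf.chart) (jet 2 A) w := by
  have h1 : ∀ {x}, ContDiffAt ℝ ∞ f x → ContDiffAt ℝ ∞ (fderiv ℝ f) x := fun hx =>
    hx.fderiv_right (m := ∞) (by simp)
  have h2 : ∀ {x}, ContDiffAt ℝ ∞ f x →
      ContDiffAt ℝ ∞ (fun x => symmetrize (fderiv ℝ (fderiv ℝ f) x)) x := fun {x} hx =>
    ContDiffAt.comp x symmetrize_contDiff.contDiffAt ((h1 hx).fderiv_right (m := ∞) (by simp))
  rw [mem_tanSpace_prolong (J := secondJetCoord X Y) (chart₂_mem hf.chart) (fun θ => Iff.rfl)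
    (fun θ m hm => chart₂_apply hf.chart hm) hf
    (by filter_upwards [hf.smooth] with x hx using (h1 hx).prodMk (h2 hx))]
  have h3 : fderiv ℝ ((secondJetCoord X Y).D f) (e A.pt).1 =
      (fderiv ℝ (fderiv ℝ f) (e A.pt).1).prod
        (fderiv ℝ (fun x => symmetrize (fderiv ℝ (fderiv ℝ f) x)) (e A.pt).1) :=
    (((h1 hf.smoothAt).differentiableAt (by simp)).hasFDerivAt.prodMk
      ((h2 hf.smoothAt).differentiableAt (by simp)).hasFDerivAt).fderiv
  rw [h3]
  rfl

/-- The `R`-plane determined by a second jet. -/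
def rPlane (θ : Jet X Y E 2) : Submodule ℝ (Model₁ X Y) :=
  ⨆ (A : PointedSubmanifold X Y E) (_ : jet 2 A = θ),
    tanSpace (Model₁ X Y) (prolong X Y 1 A.carrier) (jetProj θ)

/-- In coordinates the tangent space of the first prolongation involves only the second jet, so the
supremum defining `rPlane` is taken over equal subspaces. -/
theorem tanSpace_prolong_eq_rPlane (A : PointedSubmanifold X Y E) :
    tanSpace (Model₁ X Y) (prolong X Y 1 A.carrier) (jet 1 A) = rPlane (jet 2 A) := by
  refine le_antisymm (le_iSup₂_of_le A rfl le_rfl) (iSup₂_le fun B hB => ?_)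
  have hB1 : jet 1 B = jet 1 A := congrArg jetProj hB
  intro w hw
  obtain ⟨e, he, h⟩ := exists_chart₂ (jet 2 A)
  change w ∈ tanSpace _ _ (jet 1 A) at hw
  rw [← hB1, mem_tanSpace_prolong_one he (hB ▸ h), hB, hB1] at hw
  exact (mem_tanSpace_prolong_one he h w).2 hw

theorem mem_rPlane {θ : Jet X Y E 2} (h : θ ∈ (chart₂ he).source) {w : Model₁ X Y} :
    w ∈ rPlane θ ↔ cMap (chart₁ he) (jetProj θ) w ∈ rSpace (chart₂ he θ) := by
  induction θ using Quot.ind with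
  | mk A =>
    change w ∈ rPlane (jet 2 A) ↔ _
    rw [← tanSpace_prolong_eq_rPlane]
    exact mem_tanSpace_prolong_one he h w

/-- The second derivative is the slope of the R-plane over `X`, so the first jet and the R-plane
together determine the second jet. -/
theorem chart₂_injOn_fibre {θ θ' : Jet X Y E 2} (h : jetProj θ = jetProj θ')
    (hR : rPlane θ = rPlane θ') : θ = θ' := by
  obtain ⟨e, he, hs⟩ := exists_chart₂ θ
  have hs' : θ' ∈ (chart₂ he).source := by
    rw [← jetProj_mem_source he] at hs ⊢
    rwa [← h]
  refine (chart₂ he).injOn hs hs' ?_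
  have h1 : dropSecond (chart₂ he θ) = dropSecond (chart₂ he θ') := by
    rw [← chart₁_jetProj he hs, ← chart₁_jetProj he hs', h]
  have h2 : rSpace (chart₂ he θ) = rSpace (chart₂ he θ') := by
    ext w
    obtain ⟨w, rfl⟩ := cMap_surjective (chart₁_mem he) ((jetProj_mem_source he).2 hs) w
    rw [← mem_rPlane he hs, hR, mem_rPlane he hs', h]
  generalize chart₂ he θ = m at h1 h2
  generalize chart₂ he θ' = m' at h1 h2
  obtain ⟨z, a, q⟩ := m
  obtain ⟨z', a', q'⟩ := m'
  obtain rfl : z = z' := congrArg Prod.fst h1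
  obtain rfl : a = a' := congrArg Prod.snd h1
  rw [rSpace_injective h2]

variable (X Y) in
/-- The Cartan distribution of the first jets as a field of subspaces of the model space. -/
def cartanSpace₁ (θ : Jet X Y E 1) : Submodule ℝ (Model₁ X Y) := cartan₁ θ

/-- The Cartan distribution of the second jets as a field of subspaces of the model space. -/
def cartanSpace₂ (θ : Jet X Y E 2) : Submodule ℝ (Model₂ X Y) := cartan₂ θ

theorem cartanSpace₁_eq (ϑ : Jet X Y E 1) :
    cartanSpace₁ X Y ϑ = ⨆ (θ : Jet X Y E 2) (_ : jetProj θ = ϑ), rPlane θ := by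
  have h0 : cartanSpace₁ X Y ϑ = ⨆ (A : PointedSubmanifold X Y E) (_ : jet 1 A = ϑ),
    tanSpace (Model₁ X Y) (prolong X Y 1 A.carrier) ϑ := rfl
  rw [h0]
  refine le_antisymm (iSup₂_le fun A hA => ?_) (iSup₂_le fun θ hθ => ?_)
  · subst hA
    rw [tanSpace_prolong_eq_rPlane]
    exact le_iSup₂_of_le (jet 2 A) rfl le_rfl
  · induction θ using Quot.ind with
    | mk A =>
      subst hθ
      change rPlane (jet 2 A) ≤ _
      rw [← tanSpace_prolong_eq_rPlane]
      exact le_iSup₂_of_le A rfl le_rfl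

theorem isRPlane_iff {ϑ : Jet X Y E 1} {W : Submodule ℝ (Model₁ X Y)} :
    IsRPlane ϑ W ↔ ∃ θ : Jet X Y E 2, jetProj θ = ϑ ∧ W = rPlane θ := by
  constructor
  · rintro ⟨A, rfl, hW⟩
    exact ⟨jet 2 A, rfl, hW.trans (tanSpace_prolong_eq_rPlane A)⟩
  · rintro ⟨θ, rfl, rfl⟩
    induction θ using Quot.ind with
    | mk A => exact ⟨A, rfl, (tanSpace_prolong_eq_rPlane A).symm⟩

theorem exists_second_jet {ϑ : Jet X Y E 1} (h : ϑ ∈ (chart₁ he).source) (q : SymBilin X Y) :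
    ∃ θ : Jet X Y E 2, jetProj θ = ϑ ∧ θ ∈ (chart₂ he).source ∧
      chart₂ he θ = ((chart₁ he ϑ).1, (chart₁ he ϑ).2, q) := by
  have ht : ((chart₁ he ϑ).1, (chart₁ he ϑ).2, q) ∈ (chart₂ he).target := (chart₁ he).map_source h
  have hs := (chart₂ he).map_target ht
  refine ⟨(chart₂ he).symm ((chart₁ he ϑ).1, (chart₁ he ϑ).2, q), ?_, hs,
    (chart₂ he).right_inv ht⟩
  refine (chart₁ he).injOn ((jetProj_mem_source he).2 hs) h ?_
  rw [chart₁_jetProj he hs, (chart₂ he).right_inv ht]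
  rfl

/-- A contact vector (v, a v, b) with v ≠ 0 lies on an R-plane, since b = q v can be solved for q.
One with v = 0 is the difference of two such vectors; if `X` = 0 it is zero, hence on any R-plane.
-/
theorem mem_cartanSpace₁ {ϑ : Jet X Y E 1} (h : ϑ ∈ (chart₁ he).source) {w : Model₁ X Y} :
    w ∈ cartanSpace₁ X Y ϑ ↔ cMap (chart₁ he) ϑ w ∈ contact₁ (chart₁ he ϑ) := by
  constructor
  · intro hw
    suffices cartanSpace₁ X Y ϑ ≤ (contact₁ (chart₁ he ϑ)).comap (cMap (chart₁ he) ϑ).toLinearMap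
      from this hw
    rw [cartanSpace₁_eq]
    refine iSup₂_le fun θ hθ u hu => ?_
    subst hθ
    have hs := (jetProj_mem_source he).1 h
    rw [mem_rPlane he hs] at hu
    rw [Submodule.mem_comap, ContinuousLinearMap.coe_coe, chart₁_jetProj he hs]
    exact hu.1
  · intro hw
    have hq : ∀ (u : Model₁ X Y) (q : SymBilin X Y),
        cMap (chart₁ he) ϑ u = rLift ((chart₁ he ϑ).1, (chart₁ he ϑ).2, q)
          (cMap (chart₁ he) ϑ u).1.1 → u ∈ cartanSpace₁ X Y ϑ := by
      intro u q hu
      obtain ⟨θ, rfl, hs, hc⟩ := exists_second_jet he h q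
      rw [cartanSpace₁_eq]
      refine (le_iSup₂_of_le (f := fun (θ' : Jet X Y E 2) (_ : jetProj θ' = jetProj θ) => rPlane θ')
        θ rfl le_rfl) ?_
      rw [mem_rPlane he hs, hc, hu]
      exact rLift_mem _ _
    have hne : ∀ u : Model₁ X Y, cMap (chart₁ he) ϑ u ∈ contact₁ (chart₁ he ϑ) →
        (cMap (chart₁ he) ϑ u).1.1 ≠ 0 → u ∈ cartanSpace₁ X Y ϑ := by
      intro u hu hv
      obtain ⟨q, hq'⟩ := SymBilin.exists_apply_eq hv (cMap (chart₁ he) ϑ u).2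
      refine hq u q ?_
      rw [rLift_apply, hq']
      exact Prod.ext (Prod.ext rfl hu) rfl
    by_cases hv : (cMap (chart₁ he) ϑ w).1.1 = 0
    · rcases subsingleton_or_nontrivial X with hX | hX
      · refine hq w 0 ?_
        refine Prod.ext (Prod.ext rfl hw) ?_
        ext x
        rw [Subsingleton.elim x 0, map_zero, map_zero]
      · obtain ⟨v, hv0⟩ := exists_ne (0 : X)
        obtain ⟨u, hu⟩ := cMap_surjective (chart₁_mem he) h (field₁ v 0 (chart₁ he ϑ))
        have hu' : cMap (chart₁ he) ϑ u ∈ contact₁ (chart₁ he ϑ) := by rw [hu]; rfl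
        have h1 := hne (w + u) (by rw [map_add]; exact add_mem hw hu')
          (by rw [map_add, hu, Prod.fst_add, Prod.fst_add, hv]; simpa [field₁] using hv0)
        have h2 := hne u hu' (by rw [hu]; exact hv0)
        simpa using sub_mem h1 h2
    · exact hne w hw hv

/-- The same pattern one order higher: for v ≠ 0 a submanifold tangent to the vector in the
prolonged sense comes from `exists_function_third`, and for v = 0 two such vectors are subtracted.
-/
theorem mem_cartanSpace₂ {θ : Jet X Y E 2} (h : θ ∈ (chart₂ he).source) {w : Model₂ X Y} :
    w ∈ cartanSpace₂ θ ↔ cMap (chart₂ he) θ w ∈ contact₂ (chart₂ he θ) := by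
  have h0 : cartanSpace₂ θ = ⨆ (A : PointedSubmanifold X Y E) (_ : jet 2 A = θ),
    tanSpace (Model₂ X Y) (prolong X Y 2 A.carrier) θ := rfl
  constructor
  · intro hw
    suffices cartanSpace₂ θ ≤ (contact₂ (chart₂ he θ)).comap (cMap (chart₂ he) θ).toLinearMap
      from this hw
    rw [h0]
    refine iSup₂_le fun A hA u hu => ?_
    subst hA
    obtain ⟨_, f, hf, rfl⟩ := h
    have hc : chart₂ he (jet 2 A) = _ := chart₂_apply he ⟨f, hf, rfl⟩
    obtain ⟨v, hv⟩ := (mem_tanSpace_prolong_two hf u).1 hu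
    rw [Submodule.mem_comap, ContinuousLinearMap.coe_coe, hc]
    change cMap (chart₂ hf.chart) (jet 2 A) u ∈ _
    rw [← hv]
    exact ⟨rfl, (congrArg (fun B : X →L[ℝ] X →L[ℝ] Y => B v) (snd_symm hf.smoothAt)).symm⟩
  · intro hw
    have hne : ∀ u : Model₂ X Y, cMap (chart₂ he) θ u ∈ contact₂ (chart₂ he θ) →
        (cMap (chart₂ he) θ u).1.1 ≠ 0 → u ∈ cartanSpace₂ θ := by
      intro u hu hv
      obtain ⟨f, hf, hf0, hf1, hf2, hf3⟩ := exists_function_third (chart₂ he θ) hv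
        (cMap (chart₂ he) θ u).2.2
      have ht : (chart₂ he θ).1 ∈ e.target := (chart₂ he).map_source h
      let A : PointedSubmanifold X Y E :=
        { carrier := {q | q ∈ e.source ∧ (e q).2 = f (e q).1}
          isSubmanifold := fun p hp => ⟨e, f, he, hp.1, hp,
            Eventually.of_forall fun _ => hf.contDiffAt, by
              filter_upwards [e.open_source.mem_nhds hp.1] with q hq
              exact ⟨fun h => h.2, fun h => ⟨hq, h⟩⟩⟩
          pt := e.symm (chart₂ he θ).1
          mem := ⟨e.map_target ht, by rw [e.right_inv ht, hf0]⟩ }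
      have hA : IsGraphAt e A.carrier A.pt f := ⟨he, e.map_target ht, A.mem,
        Eventually.of_forall fun _ => hf.contDiffAt, by
          filter_upwards [e.open_source.mem_nhds (e.map_target ht)] with q hq
          exact ⟨fun h => h.2, fun h => ⟨hq, h⟩⟩⟩
      have hp : e A.pt = (chart₂ he θ).1 := e.right_inv ht
      have hcoord : HasCoord (secondJetCoord X Y) e (jet 2 A) (chart₂ he θ) := by
        refine ⟨f, hA, ?_⟩
        rw [hp]
        refine Prod.ext rfl (Prod.ext hf1.symm ?_)
        change _ = symmetrize _
        rw [hf2, symmetrize_incl]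
      have hAθ : jet 2 A = θ := hcoord.inj (hasCoord_chart₂ he h)
      rw [h0]
      refine (le_iSup₂_of_le (f := fun (A : PointedSubmanifold X Y E) (_ : jet 2 A = θ) =>
        tanSpace (Model₂ X Y) (prolong X Y 2 A.carrier) θ) A hAθ le_rfl) ?_
      have h1 := (mem_tanSpace_prolong_two hA u).2 ⟨(cMap (chart₂ he) θ u).1.1, by
        rw [hp, hf1, hf2, hf3, hAθ]
        exact Prod.ext (Prod.ext rfl hu.1.symm) (Prod.ext hu.2.symm rfl)⟩
      rwa [hAθ] at h1
    by_cases hv : (cMap (chart₂ he) θ w).1.1 = 0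
    · rcases subsingleton_or_nontrivial X with hX | hX
      · have hw0 : cMap (chart₂ he) θ w = 0 := by
          have h1 := hw.1
          have h2 := hw.2
          rw [hv, map_zero] at h1 h2
          have := subsingleton_symBilin_left (Y := Y) hX
          exact Prod.ext (Prod.ext hv h1) (Prod.ext h2 (Subsingleton.elim _ _))
        have : w = 0 := cMap_injective (chart₂_mem he) h (by rw [hw0, map_zero])
        rw [this]
        exact zero_mem _
      · obtain ⟨v, hv0⟩ := exists_ne (0 : X)
        obtain ⟨u, hu⟩ := cMap_surjective (chart₂_mem he) h (field₂ v 0 (chart₂ he θ))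
        have hu' : cMap (chart₂ he) θ u ∈ contact₂ (chart₂ he θ) := by rw [hu]; exact ⟨rfl, rfl⟩
        have h1 := hne (w + u) (by rw [map_add]; exact add_mem hw hu')
          (by rw [map_add, hu, Prod.fst_add, Prod.fst_add, hv]; simpa [field₂] using hv0)
        have h2 := hne u hu' (by rw [hu]; exact hv0)
        simpa using sub_mem h1 h2
    · exact hne w hw hv

/-- The equations dy = a dx and da = h dx contain no differential of the second order coordinates h.
They say that the projected vector lies on the R-plane with slope h. -/
theorem cartanSpace₂_eq (θ : Jet X Y E 2) :
    cartanSpace₂ θ = (rPlane θ).comap (dProj θ).toLinearMap := by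
  obtain ⟨e, he, h⟩ := exists_chart₂ θ
  ext w
  rw [mem_cartanSpace₂ he h, Submodule.mem_comap, ContinuousLinearMap.coe_coe, mem_rPlane he h,
    cMap_dProj he h]
  rfl

end JetSpaces

/-! ### Self-maps of open sets and the distributions that they preserve. -/

section Extension

variable {V N Z : Type*} [NormedAddCommGroup V] [NormedSpace ℝ V] [TopologicalSpace N]
  [ChartedSpace V N] [NormedAddCommGroup Z] [NormedSpace ℝ Z]

/-- `PreservesDistribution` in terms of subspaces of the model space. -/
theorem preservesDistribution_iff {D : Set N} {C : N → Submodule ℝ V} {φ : D → D} :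
    PreservesDistribution (V := V) D C φ ↔ ∀ s : D, ∃ F : N → N,
      IsLocalExtension (V := V) D φ s F ∧
      (C s ⊓ tanSpace V D s).map (tMap V V F s).toLinearMap = C (F s) ⊓ tanSpace V D (F s) := Iff.rfl

open Classical in
/-- Extension of a self-map of `U` by the identity. -/
def extendMap (U : Set N) (g : U → U) (x : N) : N := if h : x ∈ U then g ⟨x, h⟩ else x

omit [TopologicalSpace N] in
theorem extendMap_of_mem {U : Set N} (g : U → U) {x : N} (h : x ∈ U) :
    extendMap U g x = g ⟨x, h⟩ := dif_pos h

omit [TopologicalSpace N] in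
@[simp] theorem extendMap_coe {U : Set N} (g : U → U) (x : U) : extendMap U g x = g x :=
  extendMap_of_mem g x.2

variable {U : Set N}

theorem IsLocalExtension.eventuallyEq (hU : IsOpen U) {g : U → U} {x : U} {F : N → N}
    (h : IsLocalExtension (V := V) U g x F) : F =ᶠ[𝓝 (x : N)] extendMap U g := by
  filter_upwards [h.agree, hU.mem_nhds x.2] with y h1 h2
  rw [h1 h2, extendMap_of_mem g h2]

variable (V) in
/-- The map `g` of the open set `U` is smooth. -/
def SmoothOn (U : Set N) (g : U → U) : Prop :=
  ∀ x ∈ U, ContMDiffAt 𝓘(ℝ, V) 𝓘(ℝ, V) ∞ (extendMap U g) x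

theorem SmoothOn.isLocalExtension (hU : IsOpen U) {g : U → U} (h : SmoothOn V U g) (x : U) :
    IsLocalExtension (V := V) U g x (extendMap U g) :=
  ⟨by filter_upwards [hU.mem_nhds x.2] with y hy using h y hy,
    Eventually.of_forall fun _ hy => extendMap_of_mem g hy⟩

theorem IsLocalExtension.contMDiffAt (hU : IsOpen U) {g : U → U} {x : U} {F : N → N}
    (h : IsLocalExtension (V := V) U g x F) :
    ContMDiffAt 𝓘(ℝ, V) 𝓘(ℝ, V) ∞ (extendMap U g) x :=
  h.smooth.self_of_nhds.congr_of_eventuallyEq (h.eventuallyEq hU).symm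

/-- The tangent space of an open set is everything, and every local extension has the same germ as
`extendMap`, so the local extensions can be replaced by this one map. -/
theorem preservesDistribution_open_iff [IsManifold 𝓘(ℝ, V) ∞ N] (hU : IsOpen U)
    {C : N → Submodule ℝ V} {g : U → U} :
    PreservesDistribution (V := V) U C g ↔ SmoothOn V U g ∧ ∀ x : U,
      (C x).map (tMap V V (extendMap U g) x).toLinearMap = C (g x) := by
  rw [preservesDistribution_iff]
  constructor
  · intro h
    refine ⟨fun x hx => ?_, fun x => ?_⟩
    · obtain ⟨F, hF, -⟩ := h ⟨x, hx⟩
      exact hF.contMDiffAt hU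
    · obtain ⟨F, hF, hm⟩ := h x
      rw [tanSpace_eq_top hU x.2, tMap_congr (hF.eventuallyEq hU), hF.apply,
        tanSpace_eq_top hU (g x).2, inf_top_eq, inf_top_eq] at hm
      exact hm
  · rintro ⟨h1, h2⟩ x
    refine ⟨extendMap U g, h1.isLocalExtension hU x, ?_⟩
    rw [tanSpace_eq_top hU x.2, extendMap_coe, tanSpace_eq_top hU (g x).2, inf_top_eq, inf_top_eq,
      h2 x]

theorem mem_distAut_open_iff [IsManifold 𝓘(ℝ, V) ∞ N] (hU : IsOpen U)
    {C : N → Submodule ℝ V} {g : Equiv.Perm U} :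
    g ∈ distAut (V := V) U C ↔
      (SmoothOn V U g ∧ ∀ x : U, (C x).map (tMap V V (extendMap U g) x).toLinearMap = C (g x)) ∧
      (SmoothOn V U g.symm ∧
        ∀ x : U, (C x).map (tMap V V (extendMap U g.symm) x).toLinearMap = C (g.symm x)) := by
  rw [← preservesDistribution_open_iff hU, ← preservesDistribution_open_iff hU]
  exact Iff.rfl

theorem tMap_extendMap_symm (hU : IsOpen U) {g : Equiv.Perm U} (hg : SmoothOn V U g)
    (hg' : SmoothOn V U g.symm) (x : U) (w : V) :
    tMap V V (extendMap U g.symm) (g x) (tMap V V (extendMap U g) x w) = w := by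
  have h := tMap_leftInverse (F := extendMap U g) (G := extendMap U g.symm) (p := (x : N))
    (by rw [extendMap_coe]; exact hg' _ (g x).2) (hg _ x.2)
    (by
      filter_upwards [hU.mem_nhds x.2] with y hy
      rw [extendMap_of_mem g hy, extendMap_coe, Equiv.symm_apply_apply]) w
  rwa [extendMap_coe] at h

theorem tMap_extendMap_injective (hU : IsOpen U) {g : Equiv.Perm U} (hg : SmoothOn V U g)
    (hg' : SmoothOn V U g.symm) (x : U) : Function.Injective (tMap V V (extendMap U g) x) :=
  Function.LeftInverse.injective (tMap_extendMap_symm hU hg hg' x)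

/-- A smooth map from a normed space to a manifold with vanishing tangent map is constant. -/
theorem eq_of_tMap_eq_zero [IsManifold 𝓘(ℝ, V) ∞ N] {k : Z → N}
    (hk : ∀ q, ContMDiffAt 𝓘(ℝ, Z) 𝓘(ℝ, V) ∞ k q) (h0 : ∀ q, tMap Z V k q = 0) (a b : Z) :
    k a = k b := by
  have hl : IsLocallyConstant k := by
    rw [IsLocallyConstant.iff_eventually_eq]
    intro q
    have hc : chartAt V (k q) ∈ IsManifold.maximalAtlas 𝓘(ℝ, V) ∞ N :=
      IsManifold.chart_mem_maximalAtlas (k q)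
    have hs := (hk q).continuousAt.eventually
      ((chartAt V (k q)).open_source.mem_nhds (mem_chart_source V (k q)))
    obtain ⟨r, hr, hball⟩ := Metric.eventually_nhds_iff_ball.1 hs
    have hd : ∀ x ∈ Metric.ball q r, DifferentiableAt ℝ (fun x => chartAt V (k q) (k x)) x ∧
        fderiv ℝ (fun x => chartAt V (k q) (k x)) x = 0 := by
      intro x hx
      have h1 := chart_contMDiffAt hc (hball x hx)
      have h2 : ContMDiffAt 𝓘(ℝ, Z) 𝓘(ℝ, V) ∞ (fun x => chartAt V (k q) (k x)) x :=
        ContMDiffAt.comp x h1 (hk x)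
      refine ⟨(contMDiffAt_iff_contDiffAt.1 h2).differentiableAt (by simp), ?_⟩
      rw [← tMap_eq_fderiv, tMap_comp h1 (hk x), h0, ContinuousLinearMap.comp_zero]
    filter_upwards [Metric.ball_mem_nhds q hr] with x hx
    have := (convex_ball q r).is_const_of_fderivWithin_eq_zero (𝕜 := ℝ)
      (f := fun x => chartAt V (k q) (k x))
      (fun x hx => (hd x hx).1.differentiableWithinAt)
      (fun x hx => by rw [fderivWithin_of_isOpen Metric.isOpen_ball hx, (hd x hx).2])
      hx (Metric.mem_ball_self hr)
    exact (chartAt V (k q)).injOn (hball x hx) (mem_chart_source V (k q)) this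
  exact hl.apply_eq_of_preconnectedSpace a b

end Extension

/-! ### The equation as the image of a section; internal symmetries. -/

section Section

variable {X Y : Type*} [NormedAddCommGroup X] [NormedSpace ℝ X] [CompleteSpace X]
  [NormedAddCommGroup Y] [NormedSpace ℝ Y]
  {E : Type*} [TopologicalSpace E] [ChartedSpace (X × Y) E] [IsManifold 𝓘(ℝ, X × Y) ∞ E]

/-- `s` is a smooth section of the projection from second to first jets with image `totGeod cov`. -/
structure IsGeodSection (cov : Connection X Y E) (s : Jet X Y E 1 → Jet X Y E 2) : Prop where
  proj : ∀ ϑ, jetProj (s ϑ) = ϑ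
  smooth : ContMDiff 𝓘(ℝ, Model₁ X Y) 𝓘(ℝ, Model₂ X Y) ∞ s
  mem_iff : ∀ θ, θ ∈ totGeod cov ↔ s (jetProj θ) = θ

/-- `grassDist` as a field of subspaces of the model space. -/
def grassSpace (cov : Connection X Y E) (ϑ : Jet X Y E 1) : Submodule ℝ (Model₁ X Y) :=
  grassDist cov ϑ

namespace IsGeodSection

variable {cov : Connection X Y E} {s : Jet X Y E 1 → Jet X Y E 2} (hs : IsGeodSection cov s)

include hs

theorem mem_totGeod (ϑ : Jet X Y E 1) : s ϑ ∈ totGeod cov := by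
  rw [hs.mem_iff, hs.proj]

/-- Submanifolds with first jet ϑ and second jet in the equation all have the second jet `s ϑ`, so
the supremum is a single R-plane. -/
theorem grassSpace_eq (ϑ : Jet X Y E 1) : grassSpace cov ϑ = rPlane (s ϑ) := by
  have h0 : grassSpace cov ϑ = ⨆ (A : PointedSubmanifold X Y E) (_ : jet 1 A = ϑ)
    (_ : jet 2 A ∈ totGeod cov), tanSpace (Model₁ X Y) (prolong X Y 1 A.carrier) ϑ := rfl
  rw [h0]
  refine le_antisymm (iSup₂_le fun A hA => iSup_le fun hA2 => ?_) ?_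
  · subst hA
    rw [tanSpace_prolong_eq_rPlane]
    have : s (jet 1 A) = jet 2 A := (hs.mem_iff (jet 2 A)).1 hA2
    rw [this]
  · obtain ⟨A, hA⟩ : ∃ A : PointedSubmanifold X Y E, jet 2 A = s ϑ := Quot.exists_rep (s ϑ)
    have h1 : jet 1 A = ϑ := by
      rw [← hs.proj ϑ, ← hA]; rfl
    have h2 : jet 2 A ∈ totGeod cov := hA ▸ hs.mem_totGeod ϑ
    rw [← hA, ← tanSpace_prolong_eq_rPlane, h1]
    exact le_iSup₂_of_le A h1 (le_iSup_of_le h2 le_rfl)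

theorem dProj_dSec (ϑ : Jet X Y E 1) (w : Model₁ X Y) :
    dProj (s ϑ) (tMap (Model₁ X Y) (Model₂ X Y) s ϑ w) = w :=
  tMap_leftInverse (jetProj_contMDiff X Y E _) (hs.smooth ϑ) (Eventually.of_forall hs.proj) w

variable {U : Set (Jet X Y E 1)} (hU : IsOpen U)

include hU

/-- `mem_tangentTo_iff` for the equation, parametrized by `s` with left inverse `jetProj`. -/
theorem mem_tanSpace {ϑ : Jet X Y E 1} (hϑ : ϑ ∈ U) {w : Model₂ X Y} :
    w ∈ tanSpace (Model₂ X Y) (totGeod cov ∩ jetProj ⁻¹' U) (s ϑ) ↔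
      ∃ u, tMap (Model₁ X Y) (Model₂ X Y) s ϑ u = w := by
  obtain ⟨e, he, h2⟩ := exists_chart₂ (s ϑ)
  have h1 : ϑ ∈ (chart₁ he).source := by
    have := (jetProj_mem_source he).2 h2
    rwa [hs.proj] at this
  have hsrc : ∀ {ϑ}, ϑ ∈ (chart₁ he).source → s ϑ ∈ (chart₂ he).source := fun {ϑ} h =>
    (jetProj_mem_source he).1 (by rwa [hs.proj])
  have hsymm := (chart₁ he).continuousAt_symm ((chart₁ he).map_source h1)
  rw [ContinuousAt, (chart₁ he).left_inv h1] at hsymm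
  have hev : ∀ᶠ z in 𝓝 (chart₁ he ϑ), z ∈ (chart₁ he).target ∧ (chart₁ he).symm z ∈ U :=
    ((chart₁ he).open_target.eventually_mem ((chart₁ he).map_source h1)).and
      (hsymm.eventually (hU.mem_nhds hϑ))
  rw [mem_tangentTo_iff (chart₂_mem he) h2
    (h := fun z => chart₂ he (s ((chart₁ he).symm z))) (z₀ := chart₁ he ϑ) ?_ ?_ ?_
    dropSecondL ?_ ?_]
  · constructor
    · rintro ⟨v, hv⟩
      obtain ⟨u, rfl⟩ := cMap_surjective (chart₁_mem he) h1 v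
      rw [rep_fderiv (chart₁_mem he) h1 (chart₂_mem he) (hs.smooth ϑ) h2] at hv
      exact ⟨u, cMap_injective (chart₂_mem he) h2 hv⟩
    · rintro ⟨u, rfl⟩
      exact ⟨cMap (chart₁ he) ϑ u,
        rep_fderiv (chart₁_mem he) h1 (chart₂_mem he) (hs.smooth ϑ) h2 u⟩
  · filter_upwards [hev] with z hz
    have hz' := (chart₁ he).map_target hz.1
    have := rep_contDiffAt (chart₁_mem he) hz' (chart₂_mem he) (hs.smooth _) (hsrc hz')
    rwa [(chart₁ he).right_inv hz.1] at this
  · rw [(chart₁ he).left_inv h1]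
  · filter_upwards [hev] with z hz
    have hz' := hsrc ((chart₁ he).map_target hz.1)
    refine ⟨(chart₂ he).map_source hz', ?_⟩
    rw [(chart₂ he).left_inv hz']
    exact ⟨hs.mem_totGeod _, by rw [mem_preimage, hs.proj]; exact hz.2⟩
  · rw [dropSecondL_apply, ← chart₁_jetProj he h2, hs.proj]
  · filter_upwards [(chart₂ he).open_source.mem_nhds h2] with θ hθ hθD
    rw [dropSecondL_apply, ← chart₁_jetProj he hθ,
      (chart₁ he).left_inv ((jetProj_mem_source he).2 hθ), (hs.mem_iff θ).1 hθD.1]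

/-- A tangent vector of the equation is ds(u), and dπ(ds(u)) = u. By `cartanSpace₂_eq` it is in the
Cartan distribution exactly when u is in the R-plane of `s ϑ`. This transports the induced
distribution to first jets. -/
theorem cartanSpace₂_inf {ϑ : Jet X Y E 1} (hϑ : ϑ ∈ U) :
    cartanSpace₂ (s ϑ) ⊓ tanSpace (Model₂ X Y) (totGeod cov ∩ jetProj ⁻¹' U) (s ϑ) =
      (grassSpace cov ϑ).map (tMap (Model₁ X Y) (Model₂ X Y) s ϑ).toLinearMap := by
  rw [hs.grassSpace_eq, cartanSpace₂_eq]
  ext w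
  rw [Submodule.mem_inf, hs.mem_tanSpace hU hϑ, Submodule.mem_comap, Submodule.mem_map]
  constructor
  · rintro ⟨h, u, rfl⟩
    rw [ContinuousLinearMap.coe_coe, hs.dProj_dSec] at h
    exact ⟨u, h, rfl⟩
  · rintro ⟨u, hu, rfl⟩
    rw [ContinuousLinearMap.coe_coe, ContinuousLinearMap.coe_coe, hs.dProj_dSec]
    exact ⟨hu, u, rfl⟩

omit hU in
/-- The identification of the equation with an open set of first jets. -/
def equiv (U : Set (Jet X Y E 1)) : ↥(totGeod cov ∩ jetProj ⁻¹' U) ≃ U where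
  toFun θ := ⟨jetProj θ, θ.2.2⟩
  invFun ϑ := ⟨s ϑ, hs.mem_totGeod _, by rw [mem_preimage, hs.proj]; exact ϑ.2⟩
  left_inv θ := Subtype.ext ((hs.mem_iff θ).1 θ.2.1)
  right_inv ϑ := Subtype.ext (hs.proj ϑ)

omit hU in
theorem equiv_symm_coe (ϑ : U) : ((hs.equiv U).symm ϑ : Jet X Y E 2) = s ϑ := rfl

/-- A local extension F of φ gives the extension π ∘ F ∘ s of the conjugate map, and an extension G
of the conjugate map gives s ∘ G ∘ π. The distributions correspond by `cartanSpace₂_inf`. -/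
theorem preservesDistribution_iff_conj
    (φ : ↥(totGeod cov ∩ jetProj ⁻¹' U) → ↥(totGeod cov ∩ jetProj ⁻¹' U)) :
    PreservesDistribution (V := Model₂ X Y) (totGeod cov ∩ jetProj ⁻¹' U) cartanSpace₂ φ ↔
      PreservesDistribution (V := Model₁ X Y) U (grassSpace cov)
        (fun ϑ => hs.equiv U (φ ((hs.equiv U).symm ϑ))) := by
  rw [preservesDistribution_iff, preservesDistribution_iff]
  constructor
  · intro h ϑ
    obtain ⟨F, hF, hm⟩ := h ((hs.equiv U).symm ϑ)
    have hF0 : F (s ϑ) = φ ((hs.equiv U).symm ϑ) := hF.apply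
    have hF1 : F (s ϑ) = s (jetProj (F (s ϑ))) := by
      rw [hF0]; exact ((hs.mem_iff _).1 (φ ((hs.equiv U).symm ϑ)).2.1).symm
    have hF2 : jetProj (F (s ϑ)) ∈ U := by
      rw [hF0]; exact (φ ((hs.equiv U).symm ϑ)).2.2
    have hsc : Tendsto s (𝓝 (ϑ : Jet X Y E 1)) (𝓝 (s ϑ)) := (hs.smooth _).continuousAt
    refine ⟨fun x => jetProj (F (s x)), ⟨?_, ?_⟩, ?_⟩
    · filter_upwards [hsc.eventually hF.smooth] with x hx
      exact ContMDiffAt.comp x (g := jetProj) (f := fun x => F (s x)) (jetProj_contMDiff X Y E _)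
        (ContMDiffAt.comp x hx (hs.smooth x))
    · filter_upwards [hsc.eventually hF.agree] with x hx hxU
      rw [hx ⟨hs.mem_totGeod _, by rw [mem_preimage, hs.proj]; exact hxU⟩]
      rfl
    · have e1 : tMap (Model₁ X Y) (Model₁ X Y) (fun x => jetProj (F (s x))) ϑ =
          (dProj (F (s ϑ))).comp ((tMap (Model₂ X Y) (Model₂ X Y) F (s ϑ)).comp
            (tMap (Model₁ X Y) (Model₂ X Y) s ϑ)) := by
        have hFs : ContMDiffAt 𝓘(ℝ, Model₁ X Y) 𝓘(ℝ, Model₂ X Y) ∞ (fun x => F (s x)) ϑ :=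
          ContMDiffAt.comp _ hF.smooth.self_of_nhds (hs.smooth ϑ)
        rw [tMap_comp (F := fun x => F (s x)) (G := jetProj) (jetProj_contMDiff X Y E _) hFs,
          tMap_comp (F := s) (G := F) hF.smooth.self_of_nhds (hs.smooth ϑ)]
        rfl
      change (cartanSpace₂ (s ϑ) ⊓ tanSpace (Model₂ X Y) _ (s ϑ)).map
        (tMap (Model₂ X Y) (Model₂ X Y) F (s ϑ)).toLinearMap =
        cartanSpace₂ (F (s ϑ)) ⊓ tanSpace (Model₂ X Y) _ (F (s ϑ)) at hm
      rw [hs.cartanSpace₂_inf hU ϑ.2, hF1, hs.cartanSpace₂_inf hU hF2] at hm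
      rw [tanSpace_eq_top hU ϑ.2, tanSpace_eq_top hU hF2, inf_top_eq, inf_top_eq, e1]
      have hm' := congrArg (Submodule.map (dProj (F (s ϑ))).toLinearMap) hm
      rw [← Submodule.map_comp, ← Submodule.map_comp] at hm'
      refine Eq.trans ?_ (hm'.trans ?_)
      · rfl
      · rw [← Submodule.map_comp]
        have : (dProj (F (s ϑ))).toLinearMap ∘ₗ
            (tMap (Model₁ X Y) (Model₂ X Y) s (jetProj (F (s ϑ)))).toLinearMap = LinearMap.id := by
          refine LinearMap.ext fun w => ?_
          have := hs.dProj_dSec (jetProj (F (s ϑ))) w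
          rw [← hF1] at this
          exact this
        rw [this, Submodule.map_id]
  · intro h θ
    obtain ⟨ϑ, rfl⟩ := (hs.equiv U).symm.surjective θ
    obtain ⟨G, hG, hm⟩ := h ϑ
    have hG0 : G ϑ = jetProj (φ ((hs.equiv U).symm ϑ) : Jet X Y E 2) := hG.apply
    have hG1 : G ϑ ∈ U := by
      rw [hG0]; exact (φ ((hs.equiv U).symm ϑ)).2.2
    have hpc : Tendsto jetProj (𝓝 (s ϑ)) (𝓝 (ϑ : Jet X Y E 1)) := by
      have := (jetProj_contMDiff X Y E (s ϑ)).continuousAt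
      rwa [ContinuousAt, hs.proj] at this
    have hp := hs.proj ϑ
    have hGs : ContMDiffAt 𝓘(ℝ, Model₁ X Y) 𝓘(ℝ, Model₁ X Y) ∞ G (jetProj (s ϑ)) := by
      rw [hp]; exact hG.smooth.self_of_nhds
    refine ⟨fun x => s (G (jetProj x)), ⟨?_, ?_⟩, ?_⟩
    · filter_upwards [hpc.eventually hG.smooth] with x hx
      exact ContMDiffAt.comp x (g := s) (f := fun x => G (jetProj x)) (hs.smooth _)
        (ContMDiffAt.comp x hx (jetProj_contMDiff X Y E x))
    · filter_upwards [hpc.eventually hG.agree] with x hx hxD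
      rw [hx hxD.2]
      have e : (hs.equiv U).symm ⟨jetProj x, hxD.2⟩ = ⟨x, hxD⟩ :=
        Subtype.ext ((hs.mem_iff x).1 hxD.1)
      rw [e]
      exact (hs.mem_iff _).1 (φ ⟨x, hxD⟩).2.1
    · rw [equiv_symm_coe]
      have e1 : tMap (Model₂ X Y) (Model₂ X Y) (fun x => s (G (jetProj x))) (s ϑ) =
          (tMap (Model₁ X Y) (Model₂ X Y) s (G ϑ)).comp
            ((tMap (Model₁ X Y) (Model₁ X Y) G ϑ).comp (dProj (s ϑ))) := by
        have hGp : ContMDiffAt 𝓘(ℝ, Model₂ X Y) 𝓘(ℝ, Model₁ X Y) ∞ (fun x => G (jetProj x)) (s ϑ) :=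
          ContMDiffAt.comp _ hGs (jetProj_contMDiff X Y E _)
        rw [tMap_comp (F := fun x => G (jetProj x)) (G := s) (hs.smooth _) hGp,
          tMap_comp (F := jetProj) (G := G) hGs (jetProj_contMDiff X Y E _), hp]
        rfl
      rw [tanSpace_eq_top hU ϑ.2, tanSpace_eq_top hU hG1, inf_top_eq, inf_top_eq] at hm
      simp only [hp]
      rw [hs.cartanSpace₂_inf hU ϑ.2, hs.cartanSpace₂_inf hU hG1, e1, ← hm,
        ← Submodule.map_comp, ← Submodule.map_comp]
      congr 1
      refine LinearMap.ext fun w => ?_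
      exact congrArg (fun u => tMap (Model₁ X Y) (Model₂ X Y) s (G ϑ)
        (tMap (Model₁ X Y) (Model₁ X Y) G ϑ u)) (hs.dProj_dSec ϑ w)

theorem internalEquivGrass : InternalEquivGrass cov U (jetProj ⁻¹' U) := by
  have hmem : ∀ φ : Equiv.Perm ↥(totGeod cov ∩ jetProj ⁻¹' U),
      φ ∈ internalSym cov (jetProj ⁻¹' U) ↔
        (hs.equiv U).permCongr φ ∈ distAut (V := Model₁ X Y) U (grassDist cov) := fun φ =>
    and_congr (hs.preservesDistribution_iff_conj hU φ) (hs.preservesDistribution_iff_conj hU φ.symm)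
  refine ⟨{ toFun := fun φ => ⟨(hs.equiv U).permCongr φ, (hmem _).1 φ.2⟩
            invFun := fun g => ⟨(hs.equiv U).permCongr.symm g, (hmem _).2 (by
              rw [Equiv.apply_symm_apply]; exact g.2)⟩
            left_inv := fun φ => Subtype.ext ((hs.equiv U).permCongr.symm_apply_apply _)
            right_inv := fun g => Subtype.ext ((hs.equiv U).permCongr.apply_symm_apply _)
            map_mul' := fun φ ψ => Subtype.ext (Equiv.ext fun x => by simp) }, ?_⟩
  rintro φ t ϑ h
  have : (hs.equiv U).symm ϑ = t := by
    rw [Equiv.symm_apply_eq]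
    exact Subtype.ext h.symm
  rw [← this]
  rfl

end IsGeodSection

end Section

/-! ### Parametrizations composed with an inverse chart. -/

section Charts

variable {V N Z : Type*} [NormedAddCommGroup V] [NormedSpace ℝ V] [TopologicalSpace N]
  [ChartedSpace V N] [NormedAddCommGroup Z] [NormedSpace ℝ Z] {c : OpenPartialHomeomorph N V}

omit [NormedSpace ℝ V] [ChartedSpace V N] in
theorem eventually_symm {p : N} (hp : p ∈ c.source) {P : N → Prop} (h : ∀ᶠ q in 𝓝 p, P q) :
    ∀ᶠ v in 𝓝 (c p), v ∈ c.target ∧ P (c.symm v) := by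
  have hs := c.continuousAt_symm (c.map_source hp)
  rw [ContinuousAt, c.left_inv hp] at hs
  exact (c.open_target.eventually_mem (c.map_source hp)).and (hs.eventually h)

variable (hc : c ∈ IsManifold.maximalAtlas 𝓘(ℝ, V) ∞ N) {i : Z → V} {q : Z}
  (hi : ContDiffAt ℝ ∞ i q) (hq : i q ∈ c.target)

include hc hi hq

theorem contMDiffAt_symm_comp : ContMDiffAt 𝓘(ℝ, Z) 𝓘(ℝ, V) ∞ (fun q => c.symm (i q)) q :=
  ContMDiffAt.comp q (g := c.symm) (f := i) (contMDiffAt_symm_of_mem_maximalAtlas hc hq)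
    (contMDiffAt_iff_contDiffAt.2 hi)

theorem cMap_tMap_symm_comp (x : Z) :
    cMap c (c.symm (i q)) (tMap Z V (fun q => c.symm (i q)) q x) = fderiv ℝ i q x := by
  rw [tMap_comp (F := i) (G := c.symm) (contMDiffAt_symm_of_mem_maximalAtlas hc hq)
    (contMDiffAt_iff_contDiffAt.2 hi), tMap_eq_fderiv, ContinuousLinearMap.comp_apply]
  have h := cMap_tMap_symm hc (c.map_target hq) (fderiv ℝ i q x)
  rwa [c.right_inv hq] at h

end Charts

/-! ### Contact transformations of second jets descend to first jets. -/

section External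

variable {X Y : Type*} [NormedAddCommGroup X] [NormedSpace ℝ X] [CompleteSpace X]
  [NormedAddCommGroup Y] [NormedSpace ℝ Y]
  {E : Type*} [TopologicalSpace E] [ChartedSpace (X × Y) E] [IsManifold 𝓘(ℝ, X × Y) ∞ E]
  {U : Set (Jet X Y E 1)}

theorem rPlane_eq_map (θ : Jet X Y E 2) :
    rPlane θ = (cartanSpace₂ θ).map (dProj θ).toLinearMap := by
  rw [cartanSpace₂_eq, Submodule.map_comap_eq_of_surjective (dProj_surjective θ)]

theorem isOpen_preimage_jetProj (hU : IsOpen U) :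
    IsOpen (jetProj ⁻¹' U : Set (Jet X Y E 2)) :=
  hU.preimage (jetProj_contMDiff X Y E).continuous

/-- The transformation `G` of second jets maps the `R`-plane of a second jet by the tangent map of
the transformation `g` of first jets. -/
structure Lifts (U : Set (Jet X Y E 1)) (g : U → U)
    (G : (jetProj ⁻¹' U : Set (Jet X Y E 2)) → (jetProj ⁻¹' U : Set (Jet X Y E 2))) : Prop where
  smooth : SmoothOn (Model₁ X Y) U g
  proj : ∀ (θ : Jet X Y E 2) (h : jetProj θ ∈ U), jetProj (G ⟨θ, h⟩ : Jet X Y E 2) = g ⟨jetProj θ, h⟩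
  map : ∀ (θ : Jet X Y E 2) (h : jetProj θ ∈ U), (rPlane θ).map
    (tMap (Model₁ X Y) (Model₁ X Y) (extendMap U g) (jetProj θ)).toLinearMap = rPlane (G ⟨θ, h⟩ : Jet X Y E 2)

section Commute

variable {g : U → U}
  {G : (jetProj ⁻¹' U : Set (Jet X Y E 2)) → (jetProj ⁻¹' U : Set (Jet X Y E 2))}

theorem tMap_dProj (hU : IsOpen U) (hg : SmoothOn (Model₁ X Y) U g)
    (hG : SmoothOn (Model₂ X Y) (jetProj ⁻¹' U) G)
    (hp : ∀ (θ : Jet X Y E 2) (h : jetProj θ ∈ U),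
      jetProj (G ⟨θ, h⟩ : Jet X Y E 2) = g ⟨jetProj θ, h⟩)
    (θ : Jet X Y E 2) (h : jetProj θ ∈ U) :
    (tMap (Model₁ X Y) (Model₁ X Y) (extendMap U g) (jetProj θ)).comp (dProj θ) =
      (dProj (G ⟨θ, h⟩ : Jet X Y E 2)).comp
        (tMap (Model₂ X Y) (Model₂ X Y) (extendMap (jetProj ⁻¹' U) G) θ) := by
  have h1 : extendMap (jetProj ⁻¹' U) G θ = G ⟨θ, h⟩ := extendMap_of_mem G h
  rw [← h1, dProj, dProj, ← tMap_comp (hg _ h) (jetProj_contMDiff X Y E θ),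
    ← tMap_comp (jetProj_contMDiff X Y E _) (hG θ h)]
  apply tMap_congr
  filter_upwards [(isOpen_preimage_jetProj hU).mem_nhds h] with q hq
  rw [extendMap_of_mem g hq, extendMap_of_mem G hq, hp]

end Commute

section Contact

variable [FiniteDimensional ℝ X] [FiniteDimensional ℝ Y]

/-- The infinitesimal form of descent: `fderiv_vertical_of_contact₂` applied to the coordinate
representative of G in charts around θ and its image. -/
theorem dProj_tMap_eq_zero (hU : IsOpen U) {G : Equiv.Perm (jetProj ⁻¹' U : Set (Jet X Y E 2))}
    (hG : G ∈ distAut (V := Model₂ X Y) (jetProj ⁻¹' U) cartanSpace₂)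
    {θ : Jet X Y E 2} (hθ : jetProj θ ∈ U) {w : Model₂ X Y} (hw : dProj θ w = 0) :
    dProj (G ⟨θ, hθ⟩ : Jet X Y E 2)
      (tMap (Model₂ X Y) (Model₂ X Y) (extendMap (jetProj ⁻¹' U) G) θ w) = 0 := by
  have hU₂ := isOpen_preimage_jetProj (X := X) (Y := Y) hU
  obtain ⟨⟨hGs, hGc⟩, hGs', -⟩ := (mem_distAut_open_iff hU₂).1 hG
  obtain ⟨e, he, hs⟩ := exists_chart₂ θ
  obtain ⟨e', he', hs'⟩ := exists_chart₂ (G ⟨θ, hθ⟩ : Jet X Y E 2)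
  set F := extendMap (jetProj ⁻¹' U) G with hF
  have hFθ : F θ = G ⟨θ, hθ⟩ := extendMap_of_mem (U := jetProj ⁻¹' U) G hθ
  rw [← hFθ] at hs' ⊢
  have hev : ∀ᶠ q in 𝓝 θ, q ∈ (jetProj ⁻¹' U : Set (Jet X Y E 2)) ∧ F q ∈ (chart₂ he').source :=
    (hU₂.eventually_mem hθ).and
      ((hGs θ hθ).continuousAt.eventually ((chart₂ he').open_source.mem_nhds hs'))
  have hev' := eventually_symm hs hev
  have key := fderiv_vertical_of_contact₂ (m := chart₂ he θ)
    (G := fun v => chart₂ he' (F ((chart₂ he).symm v))) ?_ ?_ ?_ (cMap (chart₂ he) θ w).2.2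
  · have h0 := cMap_dProj he hs w
    rw [hw, map_zero] at h0
    have h1 : cMap (chart₂ he) θ w = (0, (0, (cMap (chart₂ he) θ w).2.2)) :=
      Prod.ext (congrArg Prod.fst h0).symm (Prod.ext (congrArg Prod.snd h0).symm rfl)
    rw [← h1, rep_fderiv (chart₂_mem he) hs (chart₂_mem he') (hGs θ hθ) hs',
      ← cMap_dProj he' hs'] at key
    exact cMap_injective (chart₁_mem he') ((jetProj_mem_source he').2 hs')
      (key.trans (map_zero _).symm)
  · filter_upwards [hev'] with n hn
    have h1 := (chart₂ he).map_target hn.1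
    have := rep_contDiffAt (chart₂_mem he) h1 (chart₂_mem he') (hGs _ hn.2.1) hn.2.2
    rwa [(chart₂ he).right_inv hn.1] at this
  · filter_upwards [hev'] with n hn
    have h1 := (chart₂ he).map_target hn.1
    have h2 := (chart₂ he).right_inv hn.1
    generalize (chart₂ he).symm n = p at *
    subst h2
    intro u hu
    obtain ⟨u, rfl⟩ := cMap_surjective (chart₂_mem he) h1 u
    rw [rep_fderiv (chart₂_mem he) h1 (chart₂_mem he') (hGs _ hn.2.1) hn.2.2,
      ← mem_cartanSpace₂ he' hn.2.2]
    have h3 := hGc ⟨p, hn.2.1⟩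
    rw [← extendMap_coe] at h3
    rw [hF, ← h3]
    exact Submodule.mem_map_of_mem ((mem_cartanSpace₂ he h1).2 hu)
  · rw [injective_iff_map_eq_zero]
    intro u hu
    obtain ⟨u, rfl⟩ := cMap_surjective (chart₂_mem he) hs u
    rw [rep_fderiv (chart₂_mem he) hs (chart₂_mem he') (hGs θ hθ) hs'] at hu
    have h1 := cMap_injective (chart₂_mem he') hs' (hu.trans (map_zero _).symm)
    have h2 := tMap_extendMap_injective hU₂ hGs hGs' ⟨θ, hθ⟩ (h1.trans (map_zero _).symm)
    rw [h2, map_zero]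

/-- In a chart the fibre of `jetProj` is a copy of the vector space `SymBilin X Y`. Along it the map
π ∘ G has vanishing tangent map by `dProj_tMap_eq_zero`, and the fibre is connected, so π ∘ G is
constant there. -/
theorem jetProj_eq_of_contact (hU : IsOpen U)
    {G : Equiv.Perm (jetProj ⁻¹' U : Set (Jet X Y E 2))}
    (hG : G ∈ distAut (V := Model₂ X Y) (jetProj ⁻¹' U) cartanSpace₂)
    (θ θ' : (jetProj ⁻¹' U : Set (Jet X Y E 2)))
    (h : jetProj (θ : Jet X Y E 2) = jetProj (θ' : Jet X Y E 2)) :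
    jetProj (G θ : Jet X Y E 2) = jetProj (G θ' : Jet X Y E 2) := by
  have hU₂ := isOpen_preimage_jetProj (X := X) (Y := Y) hU
  obtain ⟨⟨hGs, hGc⟩, hGs', -⟩ := (mem_distAut_open_iff hU₂).1 hG
  obtain ⟨e, he, hs⟩ := exists_chart₂ (θ : Jet X Y E 2)
  have hs' : (θ' : Jet X Y E 2) ∈ (chart₂ he).source := by
    rw [← jetProj_mem_source he] at hs ⊢
    rwa [← h]
  set m := chart₁ he (jetProj (θ : Jet X Y E 2)) with hm
  let i : SymBilin X Y → Model₂ X Y := fun q => (m.1, (m.2, q))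
  have hi : ∀ q, HasFDerivAt i (ContinuousLinearMap.prod 0
      (ContinuousLinearMap.prod 0 (ContinuousLinearMap.id ℝ (SymBilin X Y)))) q := fun q =>
    (hasFDerivAt_const m.1 q).prodMk ((hasFDerivAt_const m.2 q).prodMk (hasFDerivAt_id q))
  have hic : ∀ q, ContDiffAt ℝ ∞ i q := fun q =>
    contDiffAt_const.prodMk (contDiffAt_const.prodMk contDiffAt_id)
  have hit : ∀ q, i q ∈ (chart₂ he).target := fun q =>
    (chart₁ he).map_source ((jetProj_mem_source he).2 hs)
  have hsrc : ∀ q, (chart₂ he).symm (i q) ∈ (chart₂ he).source := fun q =>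
    (chart₂ he).map_target (hit q)
  have hproj : ∀ q, jetProj ((chart₂ he).symm (i q)) = jetProj (θ : Jet X Y E 2) := fun q => by
    refine (chart₁ he).injOn ((jetProj_mem_source he).2 (hsrc q)) ((jetProj_mem_source he).2 hs) ?_
    rw [chart₁_jetProj he (hsrc q), (chart₂ he).right_inv (hit q)]
    rfl
  have hmem : ∀ q, jetProj ((chart₂ he).symm (i q)) ∈ U := fun q => by
    rw [hproj]; exact θ.2
  have hsm := fun q => contMDiffAt_symm_comp (chart₂_mem he) (hic q) (hit q)
  have hGi : ∀ q, ContMDiffAt 𝓘(ℝ, SymBilin X Y) 𝓘(ℝ, Model₂ X Y) ∞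
      (fun q => extendMap (jetProj ⁻¹' U) G ((chart₂ he).symm (i q))) q := fun q =>
    ContMDiffAt.comp q (hGs _ (hmem q)) (hsm q)
  have key := eq_of_tMap_eq_zero (V := Model₁ X Y) (Z := SymBilin X Y)
    (k := fun q => jetProj (extendMap (jetProj ⁻¹' U) G ((chart₂ he).symm (i q))))
    (fun q => ContMDiffAt.comp q (jetProj_contMDiff X Y E _) (hGi q)) (fun q => by
      refine ContinuousLinearMap.ext fun x => ?_
      rw [tMap_comp (G := jetProj)
        (F := fun q => extendMap (jetProj ⁻¹' U) G ((chart₂ he).symm (i q)))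
        (jetProj_contMDiff X Y E _) (hGi q),
        tMap_comp (G := extendMap (jetProj ⁻¹' U) G) (F := fun q => (chart₂ he).symm (i q))
          (hGs _ (hmem q)) (hsm q)]
      have h1 : dProj ((chart₂ he).symm (i q)) (tMap (SymBilin X Y) (Model₂ X Y)
          (fun q => (chart₂ he).symm (i q)) q x) = 0 := by
        refine cMap_injective (chart₁_mem he) ((jetProj_mem_source he).2 (hsrc q)) ?_
        rw [cMap_dProj he (hsrc q), cMap_tMap_symm_comp (chart₂_mem he) (hic q) (hit q),
          (hi q).fderiv, map_zero]
        rfl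
      have h2 := dProj_tMap_eq_zero hU hG (hmem q) h1
      rw [← extendMap_coe] at h2
      exact h2)
  have hθ : ∀ θ₁ : (jetProj ⁻¹' U : Set (Jet X Y E 2)), (θ₁ : Jet X Y E 2) ∈ (chart₂ he).source →
      jetProj (θ₁ : Jet X Y E 2) = jetProj (θ : Jet X Y E 2) →
      (chart₂ he).symm (i (chart₂ he (θ₁ : Jet X Y E 2)).2.2) = θ₁ := fun θ₁ h1 h2 => by
    have h3 : i (chart₂ he (θ₁ : Jet X Y E 2)).2.2 = chart₂ he (θ₁ : Jet X Y E 2) := by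
      have h4 := chart₁_jetProj he h1
      rw [h2] at h4
      exact Prod.ext (congrArg Prod.fst h4 :) (Prod.ext (congrArg Prod.snd h4 :) rfl)
    rw [h3, (chart₂ he).left_inv h1]
  have h1 := key (chart₂ he (θ : Jet X Y E 2)).2.2 (chart₂ he (θ' : Jet X Y E 2)).2.2
  simp only [hθ θ hs rfl, hθ θ' hs' h.symm, extendMap_coe] at h1
  exact h1

end Contact

end External

/-! ### Lifts of transformations of first jets, and Bäcklund's theorem. -/

section Lifting

variable {X Y : Type*} [NormedAddCommGroup X] [NormedSpace ℝ X] [CompleteSpace X]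
  [NormedAddCommGroup Y] [NormedSpace ℝ Y]
  {E : Type*} [TopologicalSpace E] [ChartedSpace (X × Y) E] [IsManifold 𝓘(ℝ, X × Y) ∞ E]
  {U : Set (Jet X Y E 1)} {g : Equiv.Perm U}
  {G : Equiv.Perm (jetProj ⁻¹' U : Set (Jet X Y E 2))}

theorem Lifts.proj_coe {g : U → U}
    {G : (jetProj ⁻¹' U : Set (Jet X Y E 2)) → (jetProj ⁻¹' U : Set (Jet X Y E 2))}
    (h : Lifts U g G) (θ : (jetProj ⁻¹' U : Set (Jet X Y E 2))) :
    (⟨jetProj (G θ : Jet X Y E 2), (G θ).2⟩ : U) = g ⟨jetProj (θ : Jet X Y E 2), θ.2⟩ :=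
  Subtype.ext (h.proj θ θ.2)

/-- The Cartan distribution on first jets is spanned by the R-planes, and these are permuted. The
lift of the inverse provides preimages, which gives equality. -/
theorem Lifts.map_cartanSpace₁ (h : Lifts U g G) (h' : Lifts U g.symm G.symm) (ϑ : U) :
    (cartanSpace₁ X Y (ϑ : Jet X Y E 1)).map
      (tMap (Model₁ X Y) (Model₁ X Y) (extendMap U g) ϑ).toLinearMap =
        cartanSpace₁ X Y (g ϑ : Jet X Y E 1) := by
  rw [cartanSpace₁_eq, cartanSpace₁_eq, Submodule.map_iSup]
  simp only [Submodule.map_iSup]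
  refine le_antisymm (iSup₂_le fun θ hθ => ?_) (iSup₂_le fun θ hθ => ?_)
  · have hU : jetProj θ ∈ U := hθ ▸ ϑ.2
    rw [← hθ, h.map θ hU]
    refine le_iSup₂_of_le (f := fun (θ : Jet X Y E 2) (_ : jetProj θ = g ϑ) => rPlane θ)
      (G ⟨θ, hU⟩ : Jet X Y E 2) ?_ le_rfl
    rw [h.proj θ hU]
    congr 2
    exact Subtype.ext hθ
  · have hU : jetProj θ ∈ U := hθ ▸ (g ϑ).2
    have h1 : jetProj (G.symm ⟨θ, hU⟩ : Jet X Y E 2) = ϑ := by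
      rw [h'.proj θ hU]
      have : (⟨jetProj θ, hU⟩ : U) = g ϑ := Subtype.ext hθ
      rw [this, Equiv.symm_apply_apply]
    refine le_iSup₂_of_le (G.symm ⟨θ, hU⟩ : Jet X Y E 2) h1 ?_
    have h2 := h.map (G.symm ⟨θ, hU⟩ : Jet X Y E 2) (G.symm ⟨θ, hU⟩).2
    rw [h1, Subtype.coe_eta, Equiv.apply_symm_apply] at h2
    exact h2.ge

theorem Lifts.mem_distAut_cartan₁ (hU : IsOpen U) (h : Lifts U g G)
    (h' : Lifts U g.symm G.symm) : g ∈ distAut (V := Model₁ X Y) U (cartanSpace₁ X Y) :=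
  (mem_distAut_open_iff hU).2 ⟨⟨h.smooth, h.map_cartanSpace₁ h'⟩, h'.smooth,
    Lifts.map_cartanSpace₁ (g := g.symm) (G := G.symm) h' h⟩

theorem Lifts.preservesRPlanes (hU : IsOpen U) (h : Lifts U g G) : PreservesRPlanes U g := by
  intro ϑ
  refine ⟨extendMap U g, h.smooth.isLocalExtension hU ϑ, fun W hW => ?_⟩
  obtain ⟨θ, hθ, rfl⟩ := isRPlane_iff.1 hW
  have hθU : jetProj θ ∈ U := hθ ▸ ϑ.2
  refine isRPlane_iff.2 ⟨G ⟨θ, hθU⟩, ?_, ?_⟩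
  · rw [h.proj θ hθU, extendMap_coe]
    congr 2
    exact Subtype.ext hθ
  · have := h.map θ hθU
    rw [hθ] at this
    exact this

theorem Lifts.tMap_comp_dProj (hU : IsOpen U) (hG : SmoothOn (Model₂ X Y) (jetProj ⁻¹' U) G)
    (h : Lifts U g G) (θ : (jetProj ⁻¹' U : Set (Jet X Y E 2))) (w : Model₂ X Y) :
    dProj (G θ : Jet X Y E 2)
      (tMap (Model₂ X Y) (Model₂ X Y) (extendMap (jetProj ⁻¹' U) G) θ w) =
    tMap (Model₁ X Y) (Model₁ X Y) (extendMap U g) (jetProj (θ : Jet X Y E 2))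
      (dProj (θ : Jet X Y E 2) w) :=
  (congrArg (fun L : Model₂ X Y →L[ℝ] Model₁ X Y => L w)
    (tMap_dProj hU h.smooth hG h.proj θ θ.2)).symm

theorem Lifts.map_cartanSpace₂_le (hU : IsOpen U)
    (hG : SmoothOn (Model₂ X Y) (jetProj ⁻¹' U) G) (h : Lifts U g G)
    (θ : (jetProj ⁻¹' U : Set (Jet X Y E 2))) {w : Model₂ X Y} (hw : w ∈ cartanSpace₂ (θ : Jet X Y E 2)) :
    tMap (Model₂ X Y) (Model₂ X Y) (extendMap (jetProj ⁻¹' U) G) θ w ∈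
      cartanSpace₂ (G θ : Jet X Y E 2) := by
  rw [cartanSpace₂_eq, Submodule.mem_comap, ContinuousLinearMap.coe_coe] at hw ⊢
  rw [h.tMap_comp_dProj hU hG θ, ← h.map θ θ.2]
  exact Submodule.mem_map_of_mem hw

/-- The Cartan distribution on second jets is the preimage of the R-plane under dπ, the tangent maps
of g and G commute with dπ, and g carries R-planes as G prescribes. The inverse inclusion is the
same statement for the inverse maps. -/
theorem Lifts.mem_distAut_cartan₂ (hU : IsOpen U) (hG : SmoothOn (Model₂ X Y) (jetProj ⁻¹' U) G)
    (hG' : SmoothOn (Model₂ X Y) (jetProj ⁻¹' U) G.symm) (h : Lifts U g G)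
    (h' : Lifts U g.symm G.symm) : G ∈ distAut (V := Model₂ X Y) (jetProj ⁻¹' U) cartanSpace₂ := by
  have hU₂ := isOpen_preimage_jetProj (X := X) (Y := Y) hU
  have key : ∀ {g : Equiv.Perm U} {G : Equiv.Perm (jetProj ⁻¹' U : Set (Jet X Y E 2))},
      SmoothOn (Model₂ X Y) (jetProj ⁻¹' U) G → SmoothOn (Model₂ X Y) (jetProj ⁻¹' U) G.symm →
      Lifts U g G → Lifts U g.symm G.symm → ∀ θ : (jetProj ⁻¹' U : Set (Jet X Y E 2)),
      (cartanSpace₂ (θ : Jet X Y E 2)).map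
        (tMap (Model₂ X Y) (Model₂ X Y) (extendMap (jetProj ⁻¹' U) G) θ).toLinearMap =
      cartanSpace₂ (G θ : Jet X Y E 2) := by
    intro g G hG hG' h h' θ
    refine le_antisymm ?_ fun w hw => ?_
    · rintro _ ⟨w, hw, rfl⟩
      exact h.map_cartanSpace₂_le hU hG θ hw
    · have h1 := Lifts.map_cartanSpace₂_le (g := g.symm) (G := G.symm) hU hG' h' (G θ) hw
      rw [Equiv.symm_apply_apply] at h1
      refine ⟨_, h1, ?_⟩
      have h2 := tMap_extendMap_symm (V := Model₂ X Y) hU₂ (g := G.symm) hG' hG (G θ) w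
      rwa [Equiv.symm_symm, Equiv.symm_apply_apply] at h2
  exact (mem_distAut_open_iff hU₂).2 ⟨⟨hG, key hG hG' h h'⟩, hG',
    key (g := g.symm) (G := G.symm) hG' hG h' h⟩

theorem lifts_of_contact (hU : IsOpen U) (hg : SmoothOn (Model₁ X Y) U g)
    (hG : G ∈ distAut (V := Model₂ X Y) (jetProj ⁻¹' U) cartanSpace₂)
    (hp : ∀ (θ : Jet X Y E 2) (h : jetProj θ ∈ U),
      jetProj (G ⟨θ, h⟩ : Jet X Y E 2) = g ⟨jetProj θ, h⟩) : Lifts U g G := by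
  have hU₂ := isOpen_preimage_jetProj (X := X) (Y := Y) hU
  obtain ⟨⟨hGs, hGc⟩, -⟩ := (mem_distAut_open_iff hU₂).1 hG
  refine ⟨hg, hp, fun θ h => ?_⟩
  have h1 := congrArg (fun L : Model₂ X Y →L[ℝ] Model₁ X Y => (cartanSpace₂ θ).map L.toLinearMap)
    (tMap_dProj hU hg hGs hp θ h)
  rw [rPlane_eq_map, rPlane_eq_map, ← hGc ⟨θ, h⟩, ← Submodule.map_comp, ← Submodule.map_comp]
  exact h1

/-- For the construction of G, the image of the R-plane of θ is again an R-plane, and a second jet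
with that R-plane is taken as `G θ`. The lift of the inverse of g is inverse to G because a second
jet is determined by its R-plane. Smoothness of G plays no role here. -/
theorem exists_lifts_iff (hU : IsOpen U) :
    (∃ G : Equiv.Perm (jetProj ⁻¹' U : Set (Jet X Y E 2)), Lifts U g G ∧ Lifts U g.symm G.symm) ↔
      g ∈ distAut (V := Model₁ X Y) U (cartanSpace₁ X Y) ∧
        PreservesRPlanes U g ∧ PreservesRPlanes U g.symm := by
  constructor
  · rintro ⟨G, h, h'⟩
    exact ⟨h.mem_distAut_cartan₁ hU h', h.preservesRPlanes hU,
      Lifts.preservesRPlanes (g := g.symm) (G := G.symm) hU h'⟩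
  · rintro ⟨hg, hR, hR'⟩
    obtain ⟨⟨hgs, -⟩, hgs', -⟩ := (mem_distAut_open_iff hU).1 hg
    have hex : ∀ {g : Equiv.Perm U}, PreservesRPlanes U g →
        ∃ G : (jetProj ⁻¹' U : Set (Jet X Y E 2)) → (jetProj ⁻¹' U : Set (Jet X Y E 2)),
        ∀ (θ : Jet X Y E 2) (h : jetProj θ ∈ U),
          jetProj (G ⟨θ, h⟩ : Jet X Y E 2) = g ⟨jetProj θ, h⟩ ∧
          (rPlane θ).map (tMap (Model₁ X Y) (Model₁ X Y) (extendMap U g) (jetProj θ)).toLinearMap =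
            rPlane (G ⟨θ, h⟩ : Jet X Y E 2) := by
      intro g hR
      have : ∀ θ : (jetProj ⁻¹' U : Set (Jet X Y E 2)),
          ∃ θ' : (jetProj ⁻¹' U : Set (Jet X Y E 2)),
          jetProj (θ' : Jet X Y E 2) = g ⟨jetProj (θ : Jet X Y E 2), θ.2⟩ ∧
          (rPlane (θ : Jet X Y E 2)).map (tMap (Model₁ X Y) (Model₁ X Y) (extendMap U g)
            (jetProj (θ : Jet X Y E 2))).toLinearMap = rPlane (θ' : Jet X Y E 2) := by
        intro θ
        obtain ⟨F, hF, hW⟩ := hR ⟨jetProj (θ : Jet X Y E 2), θ.2⟩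
        obtain ⟨θ', h1, h2⟩ := isRPlane_iff.1 (hW _ (isRPlane_iff.2 ⟨θ, rfl, rfl⟩))
        rw [hF.apply] at h1
        refine ⟨⟨θ', by rw [mem_preimage, h1]; exact (g _).2⟩, h1, ?_⟩
        rw [← tMap_congr (hF.eventuallyEq hU)]
        exact h2
      choose G hG using this
      exact ⟨G, fun θ h => hG ⟨θ, h⟩⟩
    obtain ⟨G, hG⟩ := hex hR
    obtain ⟨G', hG'⟩ := hex hR'
    have hinv : ∀ {g : Equiv.Perm U} (_ : SmoothOn (Model₁ X Y) U g)
        (_ : SmoothOn (Model₁ X Y) U g.symm)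
        {G G' : (jetProj ⁻¹' U : Set (Jet X Y E 2)) → (jetProj ⁻¹' U : Set (Jet X Y E 2))}
        (_ : Lifts U g G) (_ : Lifts U g.symm G') (θ : (jetProj ⁻¹' U : Set (Jet X Y E 2))),
        G' (G θ) = θ := by
      intro g hgs hgs' G G' h h' θ
      -- Both second jets lie over the same first jet, and the R-plane of θ returns to itself under
      -- the composed tangent maps.
      have h1 : jetProj (G' (G θ) : Jet X Y E 2) = jetProj (θ : Jet X Y E 2) := by
        have := h'.proj_coe (G θ)
        rw [h.proj_coe θ, Equiv.symm_apply_apply] at this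
        exact congrArg Subtype.val this
      refine Subtype.ext (chart₂_injOn_fibre h1 ?_)
      have h2 := h'.map (G θ) (G θ).2
      rw [Subtype.coe_eta] at h2
      rw [← h2, ← h.map θ θ.2, ← Submodule.map_comp]
      refine Eq.trans ?_ (Submodule.map_id (rPlane (θ : Jet X Y E 2)))
      congr 1
      refine LinearMap.ext fun w => ?_
      have h3 := tMap_extendMap_symm (V := Model₁ X Y) hU hgs hgs' ⟨jetProj (θ : Jet X Y E 2), θ.2⟩ w
      rw [← h.proj θ θ.2] at h3
      exact h3
    have hL : Lifts U g G := ⟨hgs, fun θ h => (hG θ h).1, fun θ h => (hG θ h).2⟩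
    have hL' : Lifts U g.symm G' := ⟨hgs', fun θ h => (hG' θ h).1, fun θ h => (hG' θ h).2⟩
    exact ⟨⟨G, G', hinv hgs hgs' hL hL', hinv (g := g.symm) hgs' hgs hL' hL⟩, hL, hL'⟩

section Rep

variable {e e' : OpenPartialHomeomorph E (X × Y)}
  (he : e ∈ IsManifold.maximalAtlas 𝓘(ℝ, X × Y) ∞ E)
  (he' : e' ∈ IsManifold.maximalAtlas 𝓘(ℝ, X × Y) ∞ E)
  {F : Jet X Y E 1 → Jet X Y E 1} {θ θ' : Jet X Y E 2}
  (hF : ContMDiffAt 𝓘(ℝ, Model₁ X Y) 𝓘(ℝ, Model₁ X Y) ∞ F (jetProj θ))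
  (hp : jetProj θ' = F (jetProj θ))
  (hθ : θ ∈ (chart₂ he).source) (hθ' : θ' ∈ (chart₂ he').source)

include hp hθ hθ'

theorem rep_apply :
    chart₂ he' θ' = ((chart₁ he' (F ((chart₁ he).symm (dropSecond (chart₂ he θ))))).1,
      (chart₁ he' (F ((chart₁ he).symm (dropSecond (chart₂ he θ))))).2, (chart₂ he' θ').2.2) := by
  rw [← chart₁_jetProj he hθ, (chart₁ he).left_inv ((jetProj_mem_source he).2 hθ), ← hp,
    chart₁_jetProj he' hθ']
  rfl

include hF in
theorem map_rPlane_iff :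
    (rPlane θ).map (tMap (Model₁ X Y) (Model₁ X Y) F (jetProj θ)).toLinearMap = rPlane θ' ↔
      (rSpace (chart₂ he θ)).map
        (fderiv ℝ (fun v => chart₁ he' (F ((chart₁ he).symm v))) (dropSecond (chart₂ he θ))).toLinearMap
        = rSpace (chart₂ he' θ') := by
  have h1 := (jetProj_mem_source he).2 hθ
  have h2 : F (jetProj θ) ∈ (chart₁ he').source := hp ▸ (jetProj_mem_source he').2 hθ'
  have hr := rep_fderiv (chart₁_mem he) h1 (chart₁_mem he') hF h2
  rw [← chart₁_jetProj he hθ]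
  have e1 : (rSpace (chart₂ he θ)).map
      (fderiv ℝ (fun v => chart₁ he' (F ((chart₁ he).symm v))) (chart₁ he (jetProj θ))).toLinearMap =
      ((rPlane θ).map (tMap (Model₁ X Y) (Model₁ X Y) F (jetProj θ)).toLinearMap).map
        (cMap (chart₁ he') (F (jetProj θ))).toLinearMap := by
    ext w
    constructor
    · rintro ⟨u, hu, rfl⟩
      obtain ⟨u, rfl⟩ := cMap_surjective (chart₁_mem he) h1 u
      exact ⟨_, ⟨u, (mem_rPlane he hθ).2 hu, rfl⟩, (hr u).symm⟩
    · rintro ⟨_, ⟨u, hu, rfl⟩, rfl⟩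
      exact ⟨_, (mem_rPlane he hθ).1 hu, hr u⟩
  have e2 : rSpace (chart₂ he' θ') = (rPlane θ').map
        (cMap (chart₁ he') (F (jetProj θ))).toLinearMap := by
    ext w
    constructor
    · intro hw
      obtain ⟨u, rfl⟩ := cMap_surjective (chart₁_mem he') h2 w
      rw [← hp] at hw
      exact ⟨u, (mem_rPlane he' hθ').2 hw, rfl⟩
    · rintro ⟨u, hu, rfl⟩
      rw [← hp]
      exact (mem_rPlane he' hθ').1 hu
  rw [e1, e2]
  exact (Submodule.map_injective_of_injective (cMap_injective (chart₁_mem he') h2)).eq_iff.symm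

end Rep

section FiniteDimensional

variable [FiniteDimensional ℝ X]

theorem rep_fderiv_injective {V N : Type*} [NormedAddCommGroup V] [NormedSpace ℝ V]
    [TopologicalSpace N] [ChartedSpace V N] {c c' : OpenPartialHomeomorph N V}
    (hc : c ∈ IsManifold.maximalAtlas 𝓘(ℝ, V) ∞ N) (hc' : c' ∈ IsManifold.maximalAtlas 𝓘(ℝ, V) ∞ N)
    {p : N} (hp : p ∈ c.source) {F : N → N} (hF : ContMDiffAt 𝓘(ℝ, V) 𝓘(ℝ, V) ∞ F p)
    (hp' : F p ∈ c'.source) (hi : Function.Injective (tMap V V F p)) :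
    Function.Injective (fderiv ℝ (fun v => c' (F (c.symm v))) (c p)) := by
  rw [injective_iff_map_eq_zero]
  intro u hu
  obtain ⟨u, rfl⟩ := cMap_surjective hc hp u
  rw [rep_fderiv hc hp hc' hF hp'] at hu
  rw [hi ((cMap_injective hc' hp' (hu.trans (map_zero _).symm)).trans (map_zero _).symm), map_zero]

/-- In charts the representative of G is `prolongMap` of the representative of g, by
`prolongMap_spec`. Smoothness of the inverse of g supplies the injectivity of the tangent map which
that lemma requires. -/
theorem Lifts.smoothOn (hU : IsOpen U) (hg' : SmoothOn (Model₁ X Y) U g.symm) (h : Lifts U g G) :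
    SmoothOn (Model₂ X Y) (jetProj ⁻¹' U) G := by
  intro θ hθ
  have hU₂ := isOpen_preimage_jetProj (X := X) (Y := Y) hU
  obtain ⟨e, he, hs⟩ := exists_chart₂ θ
  obtain ⟨e', he', hs'⟩ := exists_chart₂ (G ⟨θ, hθ⟩ : Jet X Y E 2)
  have hFp : ∀ {q : Jet X Y E 2} (hq : jetProj q ∈ U),
      jetProj (G ⟨q, hq⟩ : Jet X Y E 2) = extendMap U g (jetProj q) := fun {q} hq => by
    rw [h.proj q hq, extendMap_of_mem g hq]
  have hev : ∀ᶠ q in 𝓝 θ, q ∈ (jetProj ⁻¹' U : Set (Jet X Y E 2)) ∧ q ∈ (chart₂ he).source ∧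
      extendMap U g (jetProj q) ∈ (chart₁ he').source := by
    refine (hU₂.eventually_mem hθ).and (((chart₂ he).open_source.eventually_mem hs).and ?_)
    have h1 : Tendsto (fun q => extendMap U g (jetProj q)) (𝓝 θ) (𝓝 (extendMap U g (jetProj θ))) :=
      ((h.smooth _ hθ).continuousAt.tendsto).comp (jetProj_contMDiff X Y E θ).continuousAt
    refine h1.eventually ((chart₁ he').open_source.mem_nhds ?_)
    rw [← hFp hθ]
    exact (jetProj_mem_source he').2 hs'
  have hspec : ∀ q (hq : jetProj q ∈ U), q ∈ (chart₂ he).source →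
      extendMap U g (jetProj q) ∈ (chart₁ he').source →
      (G ⟨q, hq⟩ : Jet X Y E 2) ∈ (chart₂ he').source ∧ _ := fun q hq h1 h2 => by
    have h3 : (G ⟨q, hq⟩ : Jet X Y E 2) ∈ (chart₂ he').source := by
      rw [← jetProj_mem_source he', hFp hq]; exact h2
    refine ⟨h3, ?_⟩
    have h4 := (map_rPlane_iff he he' (h.smooth _ hq) (hFp hq) h1 h3).1 (h.map q hq)
    have h5 := rep_apply he he' (hFp hq) h1 h3
    have h6 := rep_fderiv_injective (chart₁_mem he) (chart₁_mem he') ((jetProj_mem_source he).2 h1)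
      (h.smooth _ hq) h2
      (tMap_extendMap_injective hU h.smooth hg' ⟨jetProj q, hq⟩)
    rw [chart₁_jetProj he h1] at h6
    rw [h5] at h4
    have h7 := prolongMap_spec h6 h4
    exact (⟨h7.1, h7.2.trans h5.symm⟩ : _ ∧ _)
  have hb := hspec θ hθ hs hev.self_of_nhds.2.2
  refine contMDiffAt_of_rep (chart₂_mem he) hs (chart₂_mem he') ?_
    (prolongMap_contDiffAt ?_ hb.2.1) ?_
  · filter_upwards [hev] with q hq
    rw [extendMap_of_mem (U := jetProj ⁻¹' U) G hq.1]
    exact (hspec q hq.1 hq.2.1 hq.2.2).1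
  · rw [← chart₁_jetProj he hs]
    exact rep_contDiffAt (chart₁_mem he) ((jetProj_mem_source he).2 hs) (chart₁_mem he')
      (h.smooth _ hθ) hev.self_of_nhds.2.2
  · filter_upwards [hev] with q hq
    rw [extendMap_of_mem (U := jetProj ⁻¹' U) G hq.1]
    exact (hspec q hq.1 hq.2.1 hq.2.2).2.2.symm

/-- Bäcklund's theorem in coordinates: `fderiv_vertical_of_contact₁` keeps vertical vectors
vertical, and `exists_map_rSpace` then yields the second order coordinate of the image R-plane. -/
theorem preservesRPlanes_of_contact [FiniteDimensional ℝ Y] (hU : IsOpen U) (hY : Module.finrank ℝ Y ≠ 1)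
    (hg : g ∈ distAut (V := Model₁ X Y) U (cartanSpace₁ X Y)) : PreservesRPlanes U g := by
  obtain ⟨⟨hgs, hgc⟩, hgs', -⟩ := (mem_distAut_open_iff hU).1 hg
  intro ϑ
  refine ⟨extendMap U g, hgs.isLocalExtension hU ϑ, fun W hW => ?_⟩
  obtain ⟨θ, hθ, rfl⟩ := isRPlane_iff.1 hW
  obtain ⟨e, he, hs₂⟩ := exists_chart₂ θ
  obtain ⟨e', he', hs'⟩ := exists_chart₁ X Y (g ϑ : Jet X Y E 1)
  have hs : (ϑ : Jet X Y E 1) ∈ (chart₁ he).source := hθ ▸ (jetProj_mem_source he).2 hs₂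
  have hgϑ : extendMap U g ϑ = g ϑ := extendMap_coe _ _
  rw [← hgϑ] at hs'
  have hev : ∀ᶠ q in 𝓝 (ϑ : Jet X Y E 1), q ∈ U ∧ extendMap U g q ∈ (chart₁ he').source :=
    (hU.eventually_mem ϑ.2).and
      ((hgs ϑ ϑ.2).continuousAt.eventually ((chart₁ he').open_source.mem_nhds hs'))
  set r : Model₁ X Y → Model₁ X Y := fun v => chart₁ he' (extendMap U g ((chart₁ he).symm v)) with hr
  have hc : ∀ᶠ n in 𝓝 (chart₁ he ϑ), ∀ w ∈ contact₁ n, fderiv ℝ r n w ∈ contact₁ (r n) := by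
    filter_upwards [eventually_symm hs hev] with n hn
    have h1 := (chart₁ he).map_target hn.1
    have h2 := (chart₁ he).right_inv hn.1
    intro w hw
    obtain ⟨u, hu⟩ := cMap_surjective (chart₁_mem he) h1 w
    have h3 := rep_fderiv (chart₁_mem he) h1 (chart₁_mem he') (hgs _ hn.2.1) hn.2.2 u
    rw [h2, hu] at h3
    rw [hr, h3, ← mem_cartanSpace₁ he' hn.2.2]
    have h4 := hgc ⟨_, hn.2.1⟩
    rw [← extendMap_coe] at h4
    rw [← h4]
    exact Submodule.mem_map_of_mem ((mem_cartanSpace₁ he h1).2 (by rw [hu, h2]; exact hw))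
  have hrd : ContDiffAt ℝ ∞ r (chart₁ he ϑ) :=
    rep_contDiffAt (chart₁_mem he) hs (chart₁_mem he') (hgs _ ϑ.2) hs'
  have hi : Function.Injective (fderiv ℝ r (chart₁ he ϑ)) :=
    rep_fderiv_injective (chart₁_mem he) (chart₁_mem he') hs (hgs _ ϑ.2) hs'
      (tMap_extendMap_injective hU hgs hgs' ϑ)
  obtain ⟨q', hq'⟩ := exists_map_rSpace hrd hc hi (fderiv_vertical_of_contact₁ hY hrd hc hi)
    (chart₂ he θ).2.2
  obtain ⟨θ', h1, h2, h3⟩ := exists_second_jet he' hs' q'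
  refine isRPlane_iff.2 ⟨θ', h1, ?_⟩
  rw [← hθ] at h1 hq' ⊢
  refine (map_rPlane_iff he he' (by rw [hθ]; exact hgs _ ϑ.2) h1 hs₂ h2).2 ?_
  rw [h3, ← chart₁_jetProj he hs₂, ← hθ]
  have h4 : chart₂ he θ = ((chart₁ he (jetProj θ)).1, (chart₁ he (jetProj θ)).2,
      (chart₂ he θ).2.2) := by
    rw [chart₁_jetProj he hs₂]; rfl
  rw [h4]
  refine hq'.trans ?_
  rw [hr]
  simp only [(chart₁ he).left_inv ((jetProj_mem_source he).2 hs₂)]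

end FiniteDimensional

end Lifting

/-! ### External symmetries, their projection, and the theorem for a general section. -/

section Symmetries

variable {X Y : Type*} [NormedAddCommGroup X] [NormedSpace ℝ X] [CompleteSpace X]
  [NormedAddCommGroup Y] [NormedSpace ℝ Y]
  {E : Type*} [TopologicalSpace E] [ChartedSpace (X × Y) E] [IsManifold 𝓘(ℝ, X × Y) ∞ E]
  {U : Set (Jet X Y E 1)} {g : Equiv.Perm U}
  {G : Equiv.Perm (jetProj ⁻¹' U : Set (Jet X Y E 2))}
  {cov : Connection X Y E} {s : Jet X Y E 1 → Jet X Y E 2}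

namespace IsGeodSection

theorem map_grassSpace (hs : IsGeodSection cov s) (h : Lifts U g G)
    (hG : ∀ θ : (jetProj ⁻¹' U : Set (Jet X Y E 2)), (θ : Jet X Y E 2) ∈ totGeod cov →
      (G θ : Jet X Y E 2) ∈ totGeod cov) (ϑ : U) :
    (grassSpace cov (ϑ : Jet X Y E 1)).map
      (tMap (Model₁ X Y) (Model₁ X Y) (extendMap U g) ϑ).toLinearMap =
        grassSpace cov (g ϑ : Jet X Y E 1) := by
  have hU : jetProj (s ϑ) ∈ U := by rw [hs.proj]; exact ϑ.2
  have h1 := h.map (s ϑ) hU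
  have h2 : s (g ϑ : Jet X Y E 1) = G ⟨s ϑ, hU⟩ := by
    rw [← (hs.mem_iff _).1 (hG ⟨s ϑ, hU⟩ (hs.mem_totGeod _)), h.proj _ hU]
    congr 3
    exact Subtype.ext (hs.proj ϑ).symm
  rw [hs.proj] at h1
  rw [hs.grassSpace_eq, hs.grassSpace_eq, h1, h2]

/-- For θ in the equation, the R-plane of `G θ` is the image of the distribution at the first jet of
θ, hence the R-plane of the point of the equation over the first jet of `G θ`. Equal R-planes force
equal second jets. -/
theorem mem_totGeod_of_lifts (hs : IsGeodSection cov s) (h : Lifts U g G)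
    (hg : ∀ ϑ : U, (grassSpace cov (ϑ : Jet X Y E 1)).map
      (tMap (Model₁ X Y) (Model₁ X Y) (extendMap U g) ϑ).toLinearMap =
        grassSpace cov (g ϑ : Jet X Y E 1)) (θ : (jetProj ⁻¹' U : Set (Jet X Y E 2)))
    (hθ : (θ : Jet X Y E 2) ∈ totGeod cov) : (G θ : Jet X Y E 2) ∈ totGeod cov := by
  rw [hs.mem_iff]
  have h1 := h.map θ θ.2
  have h2 := hg ⟨jetProj (θ : Jet X Y E 2), θ.2⟩
  rw [hs.grassSpace_eq, hs.grassSpace_eq, (hs.mem_iff _).1 hθ, h1] at h2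
  refine chart₂_injOn_fibre (hs.proj _) ?_
  rw [Subtype.coe_eta] at h2
  rw [h2]
  congr 2
  exact h.proj θ θ.2

/-- The transformation of first jets induced by an external symmetry. -/
theorem exists_projection [FiniteDimensional ℝ X] [FiniteDimensional ℝ Y]
    (hs : IsGeodSection cov s) (hU : IsOpen U) :
    ∃ κ : externalSym cov (jetProj ⁻¹' U) →* Equiv.Perm U,
      ∀ G, Lifts U (κ G) (G : Equiv.Perm (jetProj ⁻¹' U : Set (Jet X Y E 2))) ∧
        Lifts U (κ G).symm (G : Equiv.Perm (jetProj ⁻¹' U : Set (Jet X Y E 2))).symm := by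
  have hmem : ∀ ϑ : U, s ϑ ∈ (jetProj ⁻¹' U : Set (Jet X Y E 2)) := fun ϑ => by
    rw [mem_preimage, hs.proj]; exact ϑ.2
  -- The point `s ϑ` serves as a representative of the fibre over ϑ; by `jetProj_eq_of_contact` any
  -- other point gives the same value.
  let k : externalSym cov (jetProj ⁻¹' U) → U → U := fun G ϑ =>
    ⟨jetProj ((G : Equiv.Perm (jetProj ⁻¹' U : Set (Jet X Y E 2))) ⟨s ϑ, hmem ϑ⟩ : Jet X Y E 2),
      ((G : Equiv.Perm (jetProj ⁻¹' U : Set (Jet X Y E 2))) ⟨s ϑ, hmem ϑ⟩).2⟩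
  have hk : ∀ (G : externalSym cov (jetProj ⁻¹' U)) (θ : Jet X Y E 2) (h : jetProj θ ∈ U),
      jetProj ((G : Equiv.Perm (jetProj ⁻¹' U : Set (Jet X Y E 2))) ⟨θ, h⟩ : Jet X Y E 2) =
        k G ⟨jetProj θ, h⟩ := fun G θ h =>
    jetProj_eq_of_contact hU G.2.1 ⟨θ, h⟩ ⟨s (jetProj θ), hmem ⟨_, h⟩⟩ (hs.proj _).symm
  -- A homomorphism from a group into the monoid of self-maps takes bijective values, so only
  -- multiplicativity is checked.
  let κ : externalSym cov (jetProj ⁻¹' U) →* Equiv.Perm U := MonoidHom.toHomPerm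
    { toFun := k
      map_one' := funext fun ϑ => Subtype.ext (hs.proj ϑ)
      map_mul' := fun G H => funext fun ϑ => Subtype.ext (hk G _ _) }
  have hsm : ∀ G, SmoothOn (Model₁ X Y) U (κ G) := fun G x hx => by
    obtain ⟨⟨hGs, -⟩, -⟩ := (mem_distAut_open_iff (isOpen_preimage_jetProj hU)).1 G.2.1
    refine ContMDiffAt.congr_of_eventuallyEq (f := fun x => jetProj (extendMap (jetProj ⁻¹' U)
      (G : Equiv.Perm (jetProj ⁻¹' U : Set (Jet X Y E 2))) (s x))) ?_ ?_
    · exact ContMDiffAt.comp x (g := jetProj) (f := fun x => extendMap (jetProj ⁻¹' U)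
        (G : Equiv.Perm (jetProj ⁻¹' U : Set (Jet X Y E 2))) (s x)) (jetProj_contMDiff X Y E _)
        (ContMDiffAt.comp x (hGs _ (hmem ⟨x, hx⟩)) (hs.smooth x))
    · filter_upwards [hU.mem_nhds hx] with y hy
      rw [extendMap_of_mem _ hy, extendMap_of_mem (U := jetProj ⁻¹' U) _ (hmem ⟨y, hy⟩)]
      rfl
  have hl : ∀ G, Lifts U (κ G) (G : Equiv.Perm (jetProj ⁻¹' U : Set (Jet X Y E 2))) := fun G =>
    lifts_of_contact hU (hsm G) G.2.1 (hk G)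
  refine ⟨κ, fun G => ⟨hl G, ?_⟩⟩
  have h1 := hl G⁻¹
  rw [map_inv] at h1
  exact h1

theorem projection_injective [FiniteDimensional ℝ X] [FiniteDimensional ℝ Y]
    {κ : externalSym cov (jetProj ⁻¹' U) →* Equiv.Perm U}
    (hκ : ∀ G, Lifts U (κ G) (G : Equiv.Perm (jetProj ⁻¹' U : Set (Jet X Y E 2)))) :
    Function.Injective κ := by
  intro G H h
  refine Subtype.ext (Equiv.ext fun θ => Subtype.ext (chart₂_injOn_fibre ?_ ?_))
  · have h1 := (hκ G).proj θ θ.2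
    have h2 := (hκ H).proj θ θ.2
    rw [h] at h1
    exact h1.trans h2.symm
  · have h1 := (hκ G).map θ θ.2
    have h2 := (hκ H).map θ θ.2
    rw [h] at h1
    exact h1.symm.trans h2

/-- The condition on second jets (the equation is preserved) and the condition on first jets (its
field of R-planes is preserved) are the same, because G moves second jets as g moves R-planes. -/
theorem projection_mem_grass (hs : IsGeodSection cov s) (hU : IsOpen U) (h : Lifts U g G)
    (h' : Lifts U g.symm G.symm) :
    g ∈ distAut (V := Model₁ X Y) U (grassSpace cov) ↔
      ∀ θ : (jetProj ⁻¹' U : Set (Jet X Y E 2)),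
        (G θ : Jet X Y E 2) ∈ totGeod cov ↔ (θ : Jet X Y E 2) ∈ totGeod cov := by
  rw [mem_distAut_open_iff hU]
  constructor
  · rintro ⟨⟨-, h1⟩, -, h2⟩ θ
    refine ⟨fun h3 => ?_, hs.mem_totGeod_of_lifts h h1 θ⟩
    have := hs.mem_totGeod_of_lifts (g := g.symm) (G := G.symm) h' h2 (G θ) h3
    rwa [Equiv.symm_apply_apply] at this
  · intro hG
    refine ⟨⟨h.smooth, hs.map_grassSpace h fun θ => (hG θ).2⟩, h'.smooth,
      hs.map_grassSpace (g := g.symm) (G := G.symm) h' fun θ hθ => ?_⟩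
    rw [← hG, Equiv.apply_symm_apply]
    exact hθ

theorem externalProjectsOnto_lieGrass [FiniteDimensional ℝ X] [FiniteDimensional ℝ Y]
    (hs : IsGeodSection cov s) (hU : IsOpen U) :
    ExternalProjectsOnto cov U (jetProj ⁻¹' U) (lieGrass cov U) := by
  obtain ⟨κ, hκ⟩ := hs.exists_projection hU
  have hinj := projection_injective fun G => (hκ G).1
  refine ⟨κ, hinj, fun G θ ϑ h => ?_, Subset.antisymm ?_ ?_⟩
  · rw [(hκ G).1.proj θ θ.2]
    congr 2
    exact Subtype.ext h
  · rintro _ ⟨G, rfl⟩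
    obtain ⟨h1, h2⟩ := (exists_lifts_iff hU).1 ⟨_, hκ G⟩
    exact ⟨⟨h1, (hs.projection_mem_grass hU (hκ G).1 (hκ G).2).2 G.2.2⟩, h2⟩
  · rintro g ⟨⟨h1, h2⟩, h3⟩
    obtain ⟨G, h, h'⟩ := (exists_lifts_iff hU).2 ⟨h1, h3⟩
    have hG : G ∈ externalSym cov (jetProj ⁻¹' U) :=
      ⟨h.mem_distAut_cartan₂ hU (h.smoothOn hU h'.smooth)
        (Lifts.smoothOn (g := g.symm) (G := G.symm) hU h.smooth h') h',
        (hs.projection_mem_grass hU h h').1 h2⟩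
    refine ⟨⟨G, hG⟩, Equiv.ext fun ϑ => Subtype.ext ?_⟩
    have hU : jetProj (s ϑ) ∈ U := by rw [hs.proj]; exact ϑ.2
    have e1 := (hκ ⟨G, hG⟩).1.proj (s ϑ) hU
    have e2 := h.proj (s ϑ) hU
    have e3 : (⟨jetProj (s ϑ), hU⟩ : U) = ϑ := Subtype.ext (hs.proj ϑ)
    rw [e3] at e1 e2
    exact e1.symm.trans e2

theorem lieGrass_eq_contactGrass [FiniteDimensional ℝ X] [FiniteDimensional ℝ Y]
    (cov : Connection X Y E) (hU : IsOpen U) (hY : Module.finrank ℝ Y ≠ 1) :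
    lieGrass cov U = contactGrass cov U :=
  Set.ext fun g => ⟨fun h => h.1, fun h => ⟨h, preservesRPlanes_of_contact hU hY h.1,
    preservesRPlanes_of_contact (g := g.symm) hU hY (inv_mem h.1)⟩⟩

/-- The homomorphism is the projection to first jets followed by the inverse of
`internalEquivGrass`, which makes its injectivity immediate. It is the restriction, since both
values lie in the equation over the same first jet. -/
theorem externalSubgroupOfInternal [FiniteDimensional ℝ X] [FiniteDimensional ℝ Y]
    (hs : IsGeodSection cov s) (hU : IsOpen U) :
    ExternalSubgroupOfInternal cov (jetProj ⁻¹' U) := by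
  obtain ⟨κ, hκ⟩ := hs.exists_projection hU
  have hinj := projection_injective fun G => (hκ G).1
  obtain ⟨ι, hι⟩ := hs.internalEquivGrass hU
  let κ' : externalSym cov (jetProj ⁻¹' U) →* distAut (V := Model₁ X Y) U (grassDist cov) :=
    κ.codRestrict _ fun G => (hs.projection_mem_grass hU (hκ G).1 (hκ G).2).2 G.2.2
  refine ⟨ι.symm.toMonoidHom.comp κ', ?_, ?_⟩
  · refine ι.symm.injective.comp fun G H h => hinj ?_
    exact congrArg Subtype.val h
  · rintro G t θ h
    have ht : jetProj (t : Jet X Y E 2) ∈ U := t.2.2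
    have h1 := hι (ι.symm (κ' G)) t ⟨_, ht⟩ rfl
    rw [MulEquiv.apply_symm_apply] at h1
    have h2 : jetProj ((G : Equiv.Perm (jetProj ⁻¹' U : Set (Jet X Y E 2))) θ : Jet X Y E 2) =
        jetProj ((ι.symm (κ' G) : Equiv.Perm ↥(totGeod cov ∩ jetProj ⁻¹' U)) t : Jet X Y E 2) := by
      rw [h1, (hκ G).1.proj θ θ.2]
      change _ = (κ G ⟨_, ht⟩ : Jet X Y E 1)
      congr 2
      exact Subtype.ext (congrArg jetProj h.symm)
    have h3 : ((G : Equiv.Perm (jetProj ⁻¹' U : Set (Jet X Y E 2))) θ : Jet X Y E 2) ∈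
        totGeod cov := (G.2.2 θ).2 (h ▸ t.2.1)
    change ((ι.symm (κ' G) : Equiv.Perm ↥(totGeod cov ∩ jetProj ⁻¹' U)) t : Jet X Y E 2) = _
    rw [← (hs.mem_iff _).1 h3, h2]
    exact ((hs.mem_iff _).1 ((ι.symm (κ' G) : Equiv.Perm ↥(totGeod cov ∩ jetProj ⁻¹' U)) t).2.1).symm

/-- The symmetries of the equation `totGeod cov` over the open set `U` of first jets. -/
theorem symmetries [FiniteDimensional ℝ X] [FiniteDimensional ℝ Y]
    (hs : IsGeodSection cov s) (hU : IsOpen U) :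
    ExternalSubgroupOfInternal cov (jetProj ⁻¹' U) ∧
      InternalEquivGrass cov U (jetProj ⁻¹' U) ∧
      ExternalProjectsOnto cov U (jetProj ⁻¹' U) (lieGrass cov U) ∧
      (Module.finrank ℝ Y ≠ 1 →
        ExternalProjectsOnto cov U (jetProj ⁻¹' U) (contactGrass cov U : Set _)) := by
  refine ⟨hs.externalSubgroupOfInternal hU, hs.internalEquivGrass hU,
    hs.externalProjectsOnto_lieGrass hU, fun hY => ?_⟩
  rw [← lieGrass_eq_contactGrass cov hU hY]
  exact hs.externalProjectsOnto_lieGrass hU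

end IsGeodSection

end Symmetries

/-! ### Vector fields in charts. -/

section Fields

variable {V N : Type*} [NormedAddCommGroup V] [NormedSpace ℝ V] [TopologicalSpace N]
  [ChartedSpace V N]

/-- The vector field `σ` is smooth at `q`. -/
def SmoothField [IsManifold 𝓘(ℝ, V) ∞ N] (σ : ∀ p : N, TangentSpace 𝓘(ℝ, V) p) (q : N) : Prop :=
  ContMDiffAt 𝓘(ℝ, V) 𝓘(ℝ, V).tangent ∞ (fun p => (⟨p, σ p⟩ : TangentBundle 𝓘(ℝ, V) N)) q

/-- The representative of the vector field `σ` in the chart `c`. -/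
def fieldRep (c : OpenPartialHomeomorph N V) (σ : ∀ p : N, TangentSpace 𝓘(ℝ, V) p) (v : V) : V :=
  cMap c (c.symm v) (σ (c.symm v))

theorem fieldRep_apply {c : OpenPartialHomeomorph N V} {q : N} (hq : q ∈ c.source)
    (σ : ∀ p : N, TangentSpace 𝓘(ℝ, V) p) : fieldRep c σ (c q) = cMap c q (σ q) := by
  rw [fieldRep, c.left_inv hq]

open Classical in
/-- The vector field with the representative `f` in the chart `c`, and zero elsewhere. -/
def fieldOf (c : OpenPartialHomeomorph N V) (f : V → V) (p : N) : TangentSpace 𝓘(ℝ, V) p :=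
  if p ∈ c.source then tMap V V c.symm (c p) (f (c p)) else (0 : V)

theorem fieldOf_of_mem {c : OpenPartialHomeomorph N V} (f : V → V) {p : N} (hp : p ∈ c.source) :
    fieldOf c f p = tMap V V c.symm (c p) (f (c p)) := if_pos hp

theorem fieldOf_of_notMem {c : OpenPartialHomeomorph N V} (f : V → V) {p : N} (hp : p ∉ c.source) :
    fieldOf c f p = (0 : V) := if_neg hp

variable {c c' : OpenPartialHomeomorph N V} (hc : c ∈ IsManifold.maximalAtlas 𝓘(ℝ, V) ∞ N)
  (hc' : c' ∈ IsManifold.maximalAtlas 𝓘(ℝ, V) ∞ N) {q : N} (hq : q ∈ c.source) (hq' : q ∈ c'.source)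

include hc hq

theorem cMap_fieldOf (f : V → V) : cMap c q (fieldOf c f q) = f (c q) := by
  rw [fieldOf_of_mem f hq, cMap_tMap_symm hc hq]

omit hq in
theorem fieldRep_fieldOf (f : V → V) {v : V} (hv : v ∈ c.target) :
    fieldRep c (fieldOf c f) v = f v := by
  rw [fieldRep, cMap_fieldOf hc (c.map_target hv), c.right_inv hv]

include hc' hq'

theorem cMap_eq_fderiv_cMap (w : V) :
    cMap c' q w = fderiv ℝ (fun v => c' (c.symm v)) (c q) (cMap c q w) := by
  have h := rep_fderiv hc hq hc' (F := fun p => p) contMDiffAt_id hq' w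
  rw [h, tMap_id]
  rfl

theorem fieldRep_change (σ : ∀ p : N, TangentSpace 𝓘(ℝ, V) p) :
    fieldRep c' σ (c' q) =
      fderiv ℝ (fun v => c' (c.symm v)) (c q) (fieldRep c σ (c q)) := by
  rw [fieldRep_apply hq, fieldRep_apply hq']
  exact cMap_eq_fderiv_cMap hc hc' hq hq' (σ q)

theorem transition_contDiffAt : ContDiffAt ℝ ∞ (fun v => c' (c.symm v)) (c q) :=
  rep_contDiffAt hc hq hc' (F := fun p => p) contMDiffAt_id hq'

theorem contDiffAt_fieldRep_of {σ : ∀ p : N, TangentSpace 𝓘(ℝ, V) p}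
    (h : ContDiffAt ℝ ∞ (fieldRep c σ) (c q)) : ContDiffAt ℝ ∞ (fieldRep c' σ) (c' q) := by
  have h1 : ContDiffAt ℝ ∞ (fun v => c (c'.symm v)) (c' q) :=
    transition_contDiffAt hc' hc hq' hq
  have h2 : ContDiffAt ℝ ∞ (fderiv ℝ (fun v => c' (c.symm v))) (c (c'.symm (c' q))) := by
    rw [c'.left_inv hq']
    exact (transition_contDiffAt hc hc' hq hq').fderiv_right (m := ∞) (by simp)
  have h3 : ContDiffAt ℝ ∞ (fieldRep c σ) (c (c'.symm (c' q))) := by rwa [c'.left_inv hq']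
  have h4 : ContDiffAt ℝ ∞ (fun v => fderiv ℝ (fun v => c' (c.symm v)) (c (c'.symm v))
      (fieldRep c σ (c (c'.symm v)))) (c' q) :=
    (ContDiffAt.comp (c' q) (f := fun v => c (c'.symm v)) h2 h1).clm_apply
      (ContDiffAt.comp (c' q) (f := fun v => c (c'.symm v)) h3 h1)
  refine h4.congr_of_eventuallyEq ?_
  filter_upwards [eventually_symm hq' (c.open_source.eventually_mem hq)] with v hv
  have := fieldRep_change hc hc' hv.2 (c'.map_target hv.1) σ
  rwa [c'.right_inv hv.1] at this

omit hc' hq'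

variable [IsManifold 𝓘(ℝ, V) ∞ N]

/-- In the preferred chart at q the tangent bundle is trivialized by the tangent map of the chart,
so the statement holds there; `contDiffAt_fieldRep_of` passes to any other chart. -/
theorem smoothField_iff {σ : ∀ p : N, TangentSpace 𝓘(ℝ, V) p} :
    SmoothField σ q ↔ ContDiffAt ℝ ∞ (fieldRep c σ) (c q) := by
  have hc₀ : chartAt V q ∈ IsManifold.maximalAtlas 𝓘(ℝ, V) ∞ N :=
    IsManifold.chart_mem_maximalAtlas q
  have hq₀ := mem_chart_source V q
  have h1 : SmoothField σ q ↔
      ContMDiffAt 𝓘(ℝ, V) 𝓘(ℝ, V) ∞ (fun p => cMap (chartAt V q) p (σ p)) q := by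
    rw [SmoothField]
    refine (Bundle.contMDiffAt_section q).trans (Filter.EventuallyEq.contMDiffAt_iff ?_)
    filter_upwards [(chartAt V q).open_source.mem_nhds hq₀] with p hp
    have h2 := TangentBundle.continuousLinearMapAt_trivializationAt (I := 𝓘(ℝ, V)) hp
    have h3 := congrArg (fun L : TangentSpace 𝓘(ℝ, V) p →L[ℝ] V => L (σ p)) h2
    refine Eq.trans ?_ h3
    rw [Bundle.Trivialization.continuousLinearMapAt_apply,
      Bundle.Trivialization.coe_linearMapAt_of_mem _ (by simpa using hp)]
  have h2 : ContMDiffAt 𝓘(ℝ, V) 𝓘(ℝ, V) ∞ (fun p => cMap (chartAt V q) p (σ p)) q ↔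
      ContDiffAt ℝ ∞ (fieldRep (chartAt V q) σ) (chartAt V q q) := by
    constructor
    · intro h
      rw [← contMDiffAt_iff_contDiffAt]
      refine ContMDiffAt.comp (chartAt V q q) (g := fun p => cMap (chartAt V q) p (σ p))
        (f := (chartAt V q).symm) ?_ (chart_symm_contMDiffAt hc₀ hq₀)
      rwa [(chartAt V q).left_inv hq₀]
    · intro h
      refine (ContMDiffAt.comp q (contMDiffAt_iff_contDiffAt.2 h)
        (chart_contMDiffAt hc₀ hq₀)).congr_of_eventuallyEq ?_
      filter_upwards [(chartAt V q).open_source.mem_nhds hq₀] with p hp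
      exact (fieldRep_apply hp σ).symm
  rw [h1, h2]
  exact ⟨contDiffAt_fieldRep_of hc₀ hc hq₀ hq, contDiffAt_fieldRep_of hc hc₀ hq hq₀⟩

theorem smoothField_fieldOf {f : V → V} (hf : ContDiffAt ℝ ∞ f (c q)) :
    SmoothField (fieldOf c f) q := by
  rw [smoothField_iff hc hq]
  refine hf.congr_of_eventuallyEq ?_
  filter_upwards [c.open_target.mem_nhds (c.map_source hq)] with v hv
  exact fieldRep_fieldOf hc f hv

/-- A vector field on the manifold with a given constant representative near a point. -/
theorem exists_smoothField [FiniteDimensional ℝ V] [T2Space N] (u : V) :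
    ∃ σ : ∀ p : N, TangentSpace 𝓘(ℝ, V) p, (∀ p, SmoothField σ p) ∧
      ∀ᶠ p in 𝓝 q, cMap c p (σ p) = u := by
  obtain ⟨r, hr, hb⟩ := Metric.nhds_basis_closedBall.mem_iff.1
    (c.open_target.mem_nhds (c.map_source hq))
  -- The bump function is one near `c q` and supported in a closed ball inside the target of the
  -- chart.
  let ρ : ContDiffBump (c q) := ⟨r / 2, r, by positivity, by linarith⟩
  refine ⟨fieldOf c fun v => ρ v • u, fun p => ?_, ?_⟩
  · by_cases hp : p ∈ c.source
    · exact smoothField_fieldOf hc hp (ρ.contDiff.contDiffAt.smul contDiffAt_const)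
    · have hK : IsCompact (c.symm '' Metric.closedBall (c q) r) :=
        have := FiniteDimensional.proper ℝ V
        (isCompact_closedBall (c q) r).image_of_continuousOn (c.continuousOn_symm.mono hb)
      have hpK : p ∉ c.symm '' Metric.closedBall (c q) r := by
        rintro ⟨v, hv, rfl⟩
        exact hp (c.map_target (hb hv))
      have hz : SmoothField (fun p : N => (0 : TangentSpace 𝓘(ℝ, V) p)) p :=
        Bundle.contMDiff_zeroSection ℝ (TangentSpace 𝓘(ℝ, V) : N → Type _) p
      refine ContMDiffAt.congr_of_eventuallyEq hz ?_
      filter_upwards [hK.isClosed.isOpen_compl.mem_nhds hpK] with x hx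
      have : fieldOf c (fun v => ρ v • u) x = (0 : V) := by
        by_cases hxs : x ∈ c.source
        · have h0 : ρ (c x) = 0 := by
            rw [← Function.notMem_support, ρ.support_eq]
            exact fun h => hx ⟨c x, Metric.ball_subset_closedBall h, c.left_inv hxs⟩
          rw [fieldOf_of_mem _ hxs, h0, zero_smul, map_zero]
        · exact fieldOf_of_notMem _ hxs
      rw [this]
      rfl
  · filter_upwards [c.open_source.mem_nhds hq,
      (c.continuousAt hq).eventually (ρ.eventuallyEq_one)] with p hp h1
    rw [cMap_fieldOf hc hp, h1]
    exact one_smul ℝ u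

end Fields

/-! ### Christoffel symbols and their change of chart. -/

section Symbols

variable {V N : Type*} [NormedAddCommGroup V] [NormedSpace ℝ V] [TopologicalSpace N]
  [ChartedSpace V N]

variable (V N) in
/-- Operators of the type of a covariant derivative on the tangent bundle of `N`. -/
abbrev FieldOp : Type _ :=
  (∀ p : N, TangentSpace 𝓘(ℝ, V) p) →
    ∀ p : N, TangentSpace 𝓘(ℝ, V) p →L[ℝ] TangentSpace 𝓘(ℝ, V) p

/-- The value of an operator on vector fields as a map of the model space. -/
def covMap (cov : FieldOp V N) (σ : ∀ p : N, TangentSpace 𝓘(ℝ, V) p) (q : N) : V →L[ℝ] V := cov σ q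

variable [IsManifold 𝓘(ℝ, V) ∞ N]

/-- Near the point `p`, the operator `cov` is given in the chart `c` by the smooth and symmetric
Christoffel symbols `Γ`. -/
structure HasSymbolsAt (cov : FieldOp V N) (c : OpenPartialHomeomorph N V) (p : N)
    (Γ : V → V →L[ℝ] V →L[ℝ] V) : Prop where
  smooth : ∀ᶠ v in 𝓝 (c p), ContDiffAt ℝ ∞ Γ v
  symm : ∀ᶠ v in 𝓝 (c p), ∀ u w, Γ v u w = Γ v w u
  formula : ∀ᶠ q in 𝓝 p, ∀ σ : ∀ p : N, TangentSpace 𝓘(ℝ, V) p, SmoothField σ q → ∀ w : V,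
    cMap c q (covMap cov σ q w) =
      fderiv ℝ (fieldRep c σ) (c q) (cMap c q w) + Γ (c q) (cMap c q (σ q)) (cMap c q w)

theorem HasSymbolsAt.eventually {cov : FieldOp V N} {c : OpenPartialHomeomorph N V} {p : N}
    (hp : p ∈ c.source) {Γ : V → V →L[ℝ] V →L[ℝ] V} (h : HasSymbolsAt cov c p Γ) :
    ∀ᶠ q in 𝓝 p, HasSymbolsAt cov c q Γ := by
  have hc := c.continuousAt hp
  filter_upwards [hc.eventually h.smooth.eventually_nhds, hc.eventually h.symm.eventually_nhds,
    h.formula.eventually_nhds] with q h1 h2 h3 using ⟨h1, h2, h3⟩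

variable {c c' : OpenPartialHomeomorph N V}

/-- Change of chart for Christoffel symbols. -/
theorem HasSymbolsAt.change (hc : c ∈ IsManifold.maximalAtlas 𝓘(ℝ, V) ∞ N)
    (hc' : c' ∈ IsManifold.maximalAtlas 𝓘(ℝ, V) ∞ N) {cov : FieldOp V N}
    {p : N} (hp : p ∈ c.source) (hp' : p ∈ c'.source) {Γ : V → V →L[ℝ] V →L[ℝ] V}
    (h : HasSymbolsAt cov c p Γ) : ∃ Γ', HasSymbolsAt cov c' p Γ' := by
  set ψ : V → V := fun v => c' (c.symm v) with hψ
  set χ : V → V := fun v => c (c'.symm v) with hχ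
  have hχp : χ (c' p) = c p := by rw [hχ]; simp only [c'.left_inv hp']
  have hd : ∀ᶠ v in 𝓝 (c' p), ContDiffAt ℝ ∞ χ v ∧ ContDiffAt ℝ ∞ ψ (χ v) := by
    filter_upwards [eventually_symm hp' (c.open_source.eventually_mem hp)] with v hv
    have h1 := transition_contDiffAt hc' hc (c'.map_target hv.1) hv.2
    rw [c'.right_inv hv.1] at h1
    exact ⟨h1, transition_contDiffAt hc hc' hv.2 (c'.map_target hv.1)⟩
  have hχt : Tendsto χ (𝓝 (c' p)) (𝓝 (c p)) := by
    rw [← hχp]; exact hd.self_of_nhds.1.continuousAt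
  -- The classical transformation law. The second derivative of the transition ψ compensates the
  -- term that arises when the new representative dψ(σ) is differentiated.
  refine ⟨fun v => bilPull (bilPush (fderiv ℝ ψ (χ v)) (Γ (χ v)) - fderiv ℝ (fderiv ℝ ψ) (χ v))
    (fderiv ℝ χ v), ?_, ?_, ?_⟩
  · filter_upwards [hd, hχt.eventually h.smooth] with v hv hΓ
    have hψ1 : ContDiffAt ℝ ∞ (fderiv ℝ ψ) (χ v) := hv.2.fderiv_right (m := ∞) (by simp)
    exact bilPull_contDiffAt (ContDiffAt.sub (bilPush_contDiffAt
      (ContDiffAt.comp v (f := χ) hψ1 hv.1) (ContDiffAt.comp v (f := χ) hΓ hv.1))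
      (ContDiffAt.comp v (f := χ) (hψ1.fderiv_right (m := ∞) (by simp)) hv.1))
      (hv.1.fderiv_right (m := ∞) (by simp))
  · filter_upwards [hd, hχt.eventually h.symm] with v hv hΓ u w
    simp only [bilPull_apply, sub_apply, bilPush_apply, hΓ (fderiv ℝ χ v u)]
    congr 1
    have hs := hv.2.isSymmSndFDerivAt (by simpa using two_le_infty)
    exact hs.eq _ _
  · filter_upwards [h.formula, c.open_source.mem_nhds hp, c'.open_source.mem_nhds hp'] with q hf
      hq hq' σ hσ w
    have hS : DifferentiableAt ℝ (fieldRep c σ) (c q) :=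
      ((smoothField_iff hc hq).1 hσ).differentiableAt (by simp)
    have hψq : ContDiffAt ℝ ∞ ψ (c q) := transition_contDiffAt hc hc' hq hq'
    have hχq : ContDiffAt ℝ ∞ χ (c' q) := transition_contDiffAt hc' hc hq' hq
    have hχc : χ (c' q) = c q := by rw [hχ]; simp only [c'.left_inv hq']
    have e1 : ∀ w, fderiv ℝ χ (c' q) (cMap c' q w) = cMap c q w := fun w =>
      (cMap_eq_fderiv_cMap hc' hc hq' hq w).symm
    have e2 : ∀ w, cMap c' q w = fderiv ℝ ψ (c q) (cMap c q w) :=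
      cMap_eq_fderiv_cMap hc hc' hq hq'
    have e3 : fieldRep c' σ =ᶠ[𝓝 (c' q)] fun v => fderiv ℝ ψ (χ v) (fieldRep c σ (χ v)) := by
      filter_upwards [eventually_symm hq' (c.open_source.eventually_mem hq)] with v hv
      have := fieldRep_change hc hc' hv.2 (c'.map_target hv.1) σ
      rwa [c'.right_inv hv.1] at this
    have e4 := ((hψq.fderiv_right (m := ∞) (by simp)).differentiableAt
      (by simp)).hasFDerivAt.clm_apply hS.hasFDerivAt
    have e5 := HasFDerivAt.comp (c' q) (f := χ) (g := fun v => fderiv ℝ ψ v (fieldRep c σ v))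
      (by rw [hχc]; exact e4) (hχq.differentiableAt (by simp)).hasFDerivAt
    have e6 : fieldRep c σ (c q) = cMap c q (σ q) := fieldRep_apply hq σ
    rw [e3.fderiv_eq]
    have e7 : fderiv ℝ (fun v => fderiv ℝ ψ (χ v) (fieldRep c σ (χ v))) (c' q) = _ := e5.fderiv
    have e8 : fderiv ℝ χ (c' q) (cMap c' q (σ q)) = cMap c q (σ q) := e1 (σ q)
    rw [e7, ContinuousLinearMap.comp_apply, e1 w]
    simp only [add_apply, ContinuousLinearMap.comp_apply,
      ContinuousLinearMap.flip_apply, bilPull_apply, sub_apply, bilPush_apply, hχc, e8, e1 w, e6]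
    rw [e2 (covMap cov σ q w), hf σ hσ w, map_add]
    have hs := hψq.isSymmSndFDerivAt (by simpa using two_le_infty)
    have h9 : fderiv ℝ (fderiv ℝ ψ) (c q) (cMap c q w) (cMap c q (σ q)) =
      fderiv ℝ (fderiv ℝ ψ) (c q) (cMap c q (σ q)) (cMap c q w) := hs.eq _ _
    rw [h9]
    abel

end Symbols

/-! ### The Leibniz rule for finite combinations of fields. -/

section CovariantDerivative

variable {V N : Type*} [NormedAddCommGroup V] [NormedSpace ℝ V] [TopologicalSpace N]
  [ChartedSpace V N] [IsManifold 𝓘(ℝ, V) ∞ N]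
  (cov : CovariantDerivative 𝓘(ℝ, V) V (TangentSpace 𝓘(ℝ, V) : N → Type _))

theorem SmoothField.mdifferentiableAt {σ : ∀ p : N, TangentSpace 𝓘(ℝ, V) p} {q : N}
    (h : SmoothField σ q) : MDifferentiableAt 𝓘(ℝ, V) 𝓘(ℝ, V).tangent
      (fun p => (⟨p, σ p⟩ : TangentBundle 𝓘(ℝ, V) N)) q :=
  ContMDiffAt.mdifferentiableAt h (by simp)

theorem covMap_sum_smul {ι : Type*} (s : Finset ι) {g : ι → N → ℝ}
    {B : ι → ∀ p : N, TangentSpace 𝓘(ℝ, V) p} {q : N}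
    (hg : ∀ i, ContMDiffAt 𝓘(ℝ, V) 𝓘(ℝ) ∞ (g i) q) (hB : ∀ i, SmoothField (B i) q) (w : V) :
    SmoothField (fun p => ∑ i ∈ s, g i p • B i p) q ∧
    covMap cov (fun p => ∑ i ∈ s, g i p • B i p) q w =
      ∑ i ∈ s, (g i q • covMap cov (B i) q w + tMap V ℝ (g i) q w • id (α := V) (B i q)) := by
  classical
  have hsm : ∀ i, SmoothField (g i • B i) q := fun i => ContMDiffAt.smul_section (hg i) (hB i)
  have hsum : ∀ s : Finset ι, SmoothField (fun p => ∑ i ∈ s, g i p • B i p) q := fun s =>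
    ContMDiffAt.sum_section (fun i _ => hsm i)
  refine ⟨hsum s, ?_⟩
  induction s using Finset.induction_on with
  | empty =>
    have : (fun p : N => ∑ i ∈ (∅ : Finset ι), g i p • B i p) = 0 := funext fun p => by simp
    rw [this, covMap, CovariantDerivative.zero]
    rfl
  | insert i s hi ih =>
    have : (fun p : N => ∑ i ∈ insert i s, g i p • B i p) =
        g i • B i + fun p => ∑ i ∈ s, g i p • B i p := funext fun p => by
      rw [Finset.sum_insert hi]; rfl
    have h1 := cov.isCovariantDerivativeOnUniv.add (hsm i).mdifferentiableAt
      (hsum s).mdifferentiableAt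
    have h2 := cov.isCovariantDerivativeOnUniv.leibniz (hB i).mdifferentiableAt
      ((hg i).mdifferentiableAt (by simp))
    rw [this, Finset.sum_insert hi, ← ih, covMap, h1, h2]
    rfl

end CovariantDerivative

/-! ### Christoffel symbols of a smooth torsion-free covariant derivative. -/

section Existence

variable {V N : Type*} [NormedAddCommGroup V] [NormedSpace ℝ V] [TopologicalSpace N]
  [ChartedSpace V N] [IsManifold 𝓘(ℝ, V) ∞ N] {c : OpenPartialHomeomorph N V}
  (hc : c ∈ IsManifold.maximalAtlas 𝓘(ℝ, V) ∞ N)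

include hc

/-- Vector fields with constant representatives in a chart commute. -/
theorem mlieBracket_fieldOf_const [CompleteSpace V] {q : N} (hq : q ∈ c.source) (u w : V) :
    VectorField.mlieBracket 𝓘(ℝ, V) (fieldOf c fun _ => u) (fieldOf c fun _ => w) q =
      (0 : V) := by
  have hinv : ∀ v ∈ c.target, (mfderiv 𝓘(ℝ, V) 𝓘(ℝ, V) c.symm v).IsInvertible := fun v hv =>
    ContinuousLinearMap.IsInvertible.of_inverse (g := mfderiv 𝓘(ℝ, V) 𝓘(ℝ, V) c (c.symm v))
      (ContinuousLinearMap.ext fun w => by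
        have := tMap_symm_cMap hc (c.map_target hv) w
        rw [c.right_inv hv] at this
        exact this)
      (ContinuousLinearMap.ext fun w => by
        have := cMap_tMap_symm hc (c.map_target hv) w
        rw [c.right_inv hv] at this
        exact this)
  have hpull : ∀ u : V, VectorField.mpullback 𝓘(ℝ, V) 𝓘(ℝ, V) c.symm (fieldOf c fun _ => u)
      =ᶠ[𝓝 (c q)] fun _ => u := fun u => by
    filter_upwards [c.open_target.mem_nhds (c.map_source hq)] with v hv
    refine (hinv v hv).inverse_apply_eq.2 ?_
    rw [fieldOf_of_mem _ (c.map_target hv), c.right_inv hv]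
    rfl
  have hs : ∀ u : V, SmoothField (fieldOf c fun _ => u) (c.symm (c q)) := fun u => by
    rw [c.left_inv hq]
    exact smoothField_fieldOf hc hq contDiffAt_const
  have : IsManifold 𝓘(ℝ, V) (minSmoothness ℝ 2) N :=
    IsManifold.of_le (n := ∞) (by simpa using two_le_infty)
  have h1 := VectorField.mpullback_mlieBracket (hs u).mdifferentiableAt (hs w).mdifferentiableAt
    (chart_symm_contMDiffAt hc hq) (n := ∞) (by simpa using two_le_infty)
  have h2 : VectorField.mlieBracket 𝓘(ℝ, V) (fun x : V => (u : TangentSpace 𝓘(ℝ, V) x))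
      (fun x : V => (w : TangentSpace 𝓘(ℝ, V) x)) (c q) = (0 : V) := by
    have h4 := congrFun (VectorField.mlieBracketWithin_eq_lieBracketWithin (𝕜 := ℝ)
      (V := fun x : V => (u : TangentSpace 𝓘(ℝ, V) x))
      (W := fun x : V => (w : TangentSpace 𝓘(ℝ, V) x)) (s := univ)) (c q)
    refine (congrFun (VectorField.mlieBracketWithin_univ (I := 𝓘(ℝ, V))
      (V := fun x : V => (u : TangentSpace 𝓘(ℝ, V) x))
      (W := fun x : V => (w : TangentSpace 𝓘(ℝ, V) x))) (c q)).symm.trans (h4.trans ?_)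
    change fderivWithin ℝ (fun _ : V => w) univ (c q) u -
      fderivWithin ℝ (fun _ : V => u) univ (c q) w = 0
    simp
  have h3 := ((hinv _ (c.map_source hq)).inverse_apply_eq).1
    (h1.trans (((hpull u).mlieBracket_vectorField_eq (hpull w)).trans h2))
  rw [c.left_inv hq] at h3
  exact h3.trans (map_zero (tMap V V c.symm (c q)))

variable [FiniteDimensional ℝ V]
  (cov : CovariantDerivative 𝓘(ℝ, V) V (TangentSpace 𝓘(ℝ, V) : N → Type _))

/-- In finite dimension a family of linear maps is smooth when its values on constant vectors are,
and these values are representatives of the derivative of σ along smooth fields. -/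
theorem contDiffOn_covMap [CovariantDerivative.ContMDiffCovariantDerivative cov ∞]
    {σ : ∀ p : N, TangentSpace 𝓘(ℝ, V) p} (hσ : ∀ p, SmoothField σ p) :
    ContDiffOn ℝ ∞ (fun v => (cMap c (c.symm v)).comp
      ((covMap cov σ (c.symm v)).comp (tMap V V c.symm v))) c.target := by
  rw [contDiffOn_clm_apply]
  intro u v hv
  have hq := c.map_target hv
  have h0 := (CovariantDerivative.ContMDiffCovariantDerivative.contMDiff (cov := cov) (k := ∞)).contMDiff
    (σ := σ) (fun p _ => (hσ p).contMDiffWithinAt)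
  have h1 : SmoothField (fun q => cov σ q (fieldOf c (fun _ => u) q)) (c.symm v) :=
    ContMDiffAt.clm_bundle_apply (h0.contMDiffAt univ_mem)
      (smoothField_fieldOf hc hq contDiffAt_const)
  rw [smoothField_iff hc hq, c.right_inv hv] at h1
  refine (h1.congr_of_eventuallyEq ?_).contDiffWithinAt
  filter_upwards [c.open_target.mem_nhds hv] with y hy
  rw [fieldRep, fieldOf_of_mem _ (c.map_target hy), c.right_inv hy]
  rfl

/-- Christoffel symbols of a smooth torsion-free covariant derivative. -/
theorem exists_hasSymbolsAt [T2Space N] [CovariantDerivative.ContMDiffCovariantDerivative cov ∞]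
    (htor : cov.torsion = 0) {p : N} (hp : p ∈ c.source) : ∃ Γ, HasSymbolsAt cov c p Γ := by
  let b := Module.finBasis ℝ V
  -- A frame of globally smooth fields which are constant in the chart near p; `contDiffOn_covMap`
  -- needs them smooth everywhere.
  choose B hBs hBc using fun i => exists_smoothField hc hp (b i)
  let ξ : Fin (Module.finrank ℝ V) → V →L[ℝ] ℝ := fun i => LinearMap.toContinuousLinearMap (b.coord i)
  have hξ : ∀ u, ∑ i, ξ i u • b i = u := fun u => b.sum_repr u
  let Λ : Fin (Module.finrank ℝ V) → V → V →L[ℝ] V := fun i v => (cMap c (c.symm v)).comp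
    ((covMap cov (B i) (c.symm v)).comp (tMap V V c.symm v))
  -- The first argument is the value of the field, the second the direction of differentiation: the
  -- symbols expand the value in the frame and apply the derivatives of the frame fields.
  let Γ : V → V →L[ℝ] V →L[ℝ] V := fun v => ∑ i, (ξ i).smulRight (Λ i v)
  have hΓ : ∀ v u w, Γ v u w = ∑ i, ξ i u • Λ i v w := fun v u w => by
    simp [Γ]
  have hBc' : ∀ᶠ q in 𝓝 p, ∀ᶠ x in 𝓝 q, ∀ i, cMap c x (B i x) = b i :=
    (eventually_all.2 hBc).eventually_nhds
  have hformula : ∀ᶠ q in 𝓝 p, ∀ σ : ∀ p : N, TangentSpace 𝓘(ℝ, V) p, SmoothField σ q → ∀ w : V,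
      cMap c q (covMap cov σ q w) =
        fderiv ℝ (fieldRep c σ) (c q) (cMap c q w) + Γ (c q) (cMap c q (σ q)) (cMap c q w) := by
    filter_upwards [hBc', c.open_source.mem_nhds hp] with q hBq hq σ hσ w
    have hS := (smoothField_iff hc hq).1 hσ
    have hSd : HasFDerivAt (fieldRep c σ) (fderiv ℝ (fieldRep c σ) (c q)) (c q) :=
      (hS.differentiableAt (by simp)).hasFDerivAt
    have hSq : fieldRep c σ (c q) = cMap c q (σ q) := fieldRep_apply hq σ
    have hgS : ∀ i, ContDiffAt ℝ ∞ (fun v => ξ i (fieldRep c σ v)) (c q) := fun i =>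
      (ξ i).contDiff.contDiffAt.comp (c q) hS
    have hg : ∀ i, ContMDiffAt 𝓘(ℝ, V) 𝓘(ℝ) ∞ (fun x => ξ i (fieldRep c σ (c x))) q := fun i =>
      ContMDiffAt.comp q (g := fun v => ξ i (fieldRep c σ v))
        (contMDiffAt_iff_contDiffAt.2 (hgS i)) (chart_contMDiffAt hc hq)
    have hdg : ∀ i, tMap V ℝ (fun x => ξ i (fieldRep c σ (c x))) q w =
        ξ i (fderiv ℝ (fieldRep c σ) (c q) (cMap c q w)) := fun i => by
      have h : HasFDerivAt (fun v => ξ i (fieldRep c σ v))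
        ((ξ i).comp (fderiv ℝ (fieldRep c σ) (c q))) (c q) := (ξ i).hasFDerivAt.comp (c q) hSd
      rw [tMap_comp (F := c) (G := fun v => ξ i (fieldRep c σ v))
        (contMDiffAt_iff_contDiffAt.2 (hgS i)) (chart_contMDiffAt hc hq), tMap_eq_fderiv, h.fderiv]
      rfl
    obtain ⟨h1, h2⟩ := covMap_sum_smul cov Finset.univ (B := B) hg (fun i => hBs i q) w
    -- Near q every field is a combination of the frame, so locality and the Leibniz rule give the
    -- formula: the coefficients contribute the derivative term, the frame fields the symbols.
    have hev : ∀ᶠ x in 𝓝 q, σ x = ∑ i, ξ i (fieldRep c σ (c x)) • B i x := by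
      filter_upwards [hBq, c.open_source.mem_nhds hq] with x hx hxs
      refine cMap_injective hc hxs ?_
      have h3 : cMap c x (∑ i, ξ i (fieldRep c σ (c x)) • id (α := V) (B i x)) = cMap c x (σ x) := by
        rw [map_sum, ← fieldRep_apply hxs σ]
        conv_rhs => rw [← hξ (fieldRep c σ (c x))]
        refine Finset.sum_congr rfl fun i _ => ?_
        rw [map_smul]
        congr 1
        exact hx i
      exact h3.symm
    have h3 : covMap cov σ q = covMap cov (fun x => ∑ i, ξ i (fieldRep c σ (c x)) • B i x) q :=
      cov.isCovariantDerivativeOnUniv.congr_of_eventuallyEq hσ.mdifferentiableAt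
        h1.mdifferentiableAt univ_mem hev
    rw [h3, h2, Finset.sum_add_distrib, map_add, map_sum, map_sum, add_comm, hΓ]
    congr 1
    · conv_rhs => rw [← hξ (fderiv ℝ (fieldRep c σ) (c q) (cMap c q w))]
      refine Finset.sum_congr rfl fun i _ => ?_
      rw [map_smul, hdg]
      congr 1
      exact hBq.self_of_nhds i
    · refine Finset.sum_congr rfl fun i _ => ?_
      rw [map_smul, hSq]
      congr 1
      change _ = cMap c (c.symm (c q)) (covMap cov (B i) (c.symm (c q))
        (tMap V V c.symm (c q) (cMap c q w)))
      rw [tMap_symm_cMap hc hq, c.left_inv hq]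
  refine ⟨Γ, ?_, ?_, hformula⟩
  · filter_upwards [c.open_target.mem_nhds (c.map_source hp)] with v hv
    refine ContDiffAt.sum fun i _ => ?_
    exact contDiffAt_const.smulRight
      ((contDiffOn_covMap hc cov (hBs i)).contDiffAt (c.open_target.mem_nhds hv))
  · filter_upwards [eventually_symm hp hformula] with v ⟨hv, hf⟩ u w
    have hq := c.map_target hv
    have hs : ∀ u : V, SmoothField (fieldOf c fun _ => u) (c.symm v) := fun u =>
      smoothField_fieldOf hc hq contDiffAt_const
    have hconst : ∀ u w : V, cMap c (c.symm v) (covMap cov (fieldOf c fun _ => u) (c.symm v)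
        (fieldOf c (fun _ => w) (c.symm v))) = Γ v u w := fun u w => by
      have h1 := hf _ (hs u) (fieldOf c (fun _ => w) (c.symm v))
      have h2 : fieldRep c (fieldOf c fun _ => u) =ᶠ[𝓝 (c (c.symm v))] fun _ => u := by
        rw [c.right_inv hv]
        filter_upwards [c.open_target.mem_nhds hv] with y hy using fieldRep_fieldOf hc _ hy
      rw [h2.fderiv_eq, fderiv_fun_const, cMap_fieldOf hc hq, cMap_fieldOf hc hq,
        c.right_inv hv] at h1
      simpa using h1
    rw [← hconst, ← hconst]
    congr 1
    -- Fields with constant representatives commute, so vanishing torsion makes the symbols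
    -- symmetric.
    have h1 := cov.torsion_eq_zero_iff.1 htor (hs w).mdifferentiableAt (hs u).mdifferentiableAt
    rw [mlieBracket_fieldOf_const hc hq] at h1
    exact sub_eq_zero.1 h1

end Existence

/-! ### The equation of totally geodesic submanifolds in coordinates, and its section. -/

section TotallyGeodesic

variable {X Y : Type*} [NormedAddCommGroup X] [NormedSpace ℝ X]
  [NormedAddCommGroup Y] [NormedSpace ℝ Y]
  {E : Type*} [TopologicalSpace E] [ChartedSpace (X × Y) E]
  {e : OpenPartialHomeomorph E (X × Y)} {L : Set E} {p : E} {f : X → Y}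

/-- The linear map with kernel the graph of `a`. -/
def normalForm (a : X →L[ℝ] Y) : X × Y →L[ℝ] Y :=
  a.comp (ContinuousLinearMap.fst ℝ X Y) - ContinuousLinearMap.snd ℝ X Y

theorem normalForm_apply (a : X →L[ℝ] Y) (w : X × Y) : normalForm a w = a w.1 - w.2 := rfl

theorem normalForm_eq_zero {a : X →L[ℝ] Y} {w : X × Y} : normalForm a w = 0 ↔ w = (w.1, a w.1) := by
  rw [normalForm_apply, sub_eq_zero]
  exact ⟨fun h => Prod.ext rfl h.symm, fun h => (congrArg Prod.snd h).symm⟩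

omit [TopologicalSpace E] [ChartedSpace (X × Y) E] in
theorem hasFDerivAt_pair {x : X} (hf : DifferentiableAt ℝ f x) :
    HasFDerivAt (fun x => (x, f x)) ((ContinuousLinearMap.id ℝ X).prod (fderiv ℝ f x)) x :=
  (hasFDerivAt_id _).prodMk hf.hasFDerivAt

theorem IsGraphAt.mem_tanSpace (h : IsGraphAt e L p f) {w : X × Y} :
    w ∈ tanSpace (X × Y) L p ↔ normalForm (fderiv ℝ f (e p).1) (cMap e p w) = 0 := by
  have h1 : ∀ᶠ x in 𝓝 (e p).1, ContDiffAt ℝ ∞ (fun x => (x, f x)) x := by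
    filter_upwards [h.smooth] with x hx using contDiffAt_id.prodMk hx
  rw [mem_tangentTo_iff h.chart h.source (h := fun x => (x, f x)) h1 h.pair
    (h.eventually_target.and h.eventually_mem) (ContinuousLinearMap.fst ℝ X Y) rfl
    (by filter_upwards [h.graph] with q hq hL using Prod.ext rfl (hq.1 hL)),
    (hasFDerivAt_pair (h.smoothAt.differentiableAt (by simp))).fderiv, normalForm_eq_zero]
  constructor
  · rintro ⟨v, hv⟩
    rw [← hv]
    rfl
  · exact fun h => ⟨_, h.symm⟩

variable [IsManifold 𝓘(ℝ, X × Y) ∞ E] {cov : Connection X Y E}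

/-- The second fundamental form in coordinates. -/
theorem IsGraphAt.secondFundForm_eq_zero [CompleteSpace X] {A : PointedSubmanifold X Y E}
    (h : IsGraphAt e A.carrier A.pt f)
    {Γ : X × Y → X × Y →L[ℝ] X × Y →L[ℝ] X × Y} (hΓ : HasSymbolsAt cov e A.pt Γ)
    {σ : ∀ p : E, TangentSpace 𝓘(ℝ, X × Y) p} (hσ : SmoothField σ A.pt)
    (hσL : ∀ᶠ q in 𝓝 A.pt, q ∈ A.carrier → σ q ∈ tangentTo (V := X × Y) A.carrier q)
    {w : X × Y} {s t : X} (hs : cMap e A.pt (σ A.pt) = (s, fderiv ℝ f (e A.pt).1 s))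
    (ht : cMap e A.pt w = (t, fderiv ℝ f (e A.pt).1 t)) :
    secondFundForm cov A w σ = 0 ↔ fderiv ℝ (fderiv ℝ f) (e A.pt).1 t s =
      normalForm (fderiv ℝ f (e A.pt).1) (Γ (e A.pt) (s, fderiv ℝ f (e A.pt).1 s)
        (t, fderiv ℝ f (e A.pt).1 t)) := by
  have h0 : secondFundForm cov A w σ = 0 ↔
      covMap cov σ A.pt w ∈ tanSpace (X × Y) A.carrier A.pt :=
    Submodule.Quotient.mk_eq_zero _
  rw [h0, h.mem_tanSpace, hΓ.formula.self_of_nhds σ hσ w, hs, ht, map_add]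
  set x₀ := (e A.pt).1 with hx₀
  have hF : DifferentiableAt ℝ (fieldRep e σ) (e A.pt) :=
    ((smoothField_iff h.chart h.source).1 hσ).differentiableAt (by simp)
  have hF₀ : fieldRep e σ (x₀, f x₀) = (s, fderiv ℝ f x₀ s) := by
    rw [h.pair, fieldRep_apply h.source, hs]
  have h1 : HasFDerivAt (fun x => fieldRep e σ (x, f x)) _ x₀ :=
    HasFDerivAt.comp x₀ (g := fieldRep e σ) (f := fun x => (x, f x))
      (by rw [h.pair]; exact hF.hasFDerivAt)
      (hasFDerivAt_pair (h.smoothAt.differentiableAt (by simp)))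
  have h2 : HasFDerivAt (fderiv ℝ f) (fderiv ℝ (fderiv ℝ f) x₀) x₀ :=
    ((h.smoothAt.fderiv_right (m := ∞) (by simp)).differentiableAt (by simp)).hasFDerivAt
  have h3 : HasFDerivAt (fun x => normalForm (fderiv ℝ f x) (fieldRep e σ (x, f x))) _ x₀ :=
    (h2.clm_apply h1.fst).sub h1.snd
  -- Tangency of σ along the submanifold says that the normal component vanishes on the graph. Its
  -- derivative in the direction t expresses the normal part of the derivative of σ as minus the
  -- second derivative of f.
  have h4 : (fun x => normalForm (fderiv ℝ f x) (fieldRep e σ (x, f x))) =ᶠ[𝓝 x₀] fun _ => 0 := by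
    filter_upwards [h.eventually_target, h.eventually_mem, h.tendsto_symm.eventually hσL,
      h.tendsto_symm.eventually h.eventually] with x hx hL hσx hg
    have h5 := (hg hL).mem_tanSpace.1 (hσx hL)
    rw [← fieldRep_apply (hg hL).source, e.right_inv hx] at h5
    exact h5
  have h5 := congrArg (fun T : X →L[ℝ] Y => T t)
    (h3.unique ((hasFDerivAt_const (0 : Y) x₀).congr_of_eventuallyEq h4))
  simp only [sub_apply, add_apply, ContinuousLinearMap.comp_apply, ContinuousLinearMap.flip_apply,
    zero_apply, hF₀] at h5
  have h6 : fderiv ℝ (fderiv ℝ f) x₀ t s +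
      normalForm (fderiv ℝ f x₀) (fderiv ℝ (fieldRep e σ) (e A.pt) (t, fderiv ℝ f x₀ t)) = 0 := by
    rw [← h5, normalForm_apply]
    simp
    abel
  rw [← neg_eq_iff_add_eq_zero.2 h6, neg_add_eq_zero]

/-- The second derivative, in terms of a first jet, of the function whose graph is totally
geodesic to second order, for the Christoffel symbols `Γ`. -/
def geodCoord (Γ : X × Y → X × Y →L[ℝ] X × Y →L[ℝ] X × Y) (m : (X × Y) × (X →L[ℝ] Y)) :
    SymBilin X Y :=
  symmetrize (bilPush (normalForm m.2)
    (bilPull (Γ m.1) ((ContinuousLinearMap.id ℝ X).prod m.2)))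

omit [ChartedSpace (X × Y) E] [TopologicalSpace E] [IsManifold 𝓘(ℝ, X × Y) ∞ E] in
theorem geodCoord_contDiffAt {Γ : X × Y → X × Y →L[ℝ] X × Y →L[ℝ] X × Y}
    {m : (X × Y) × (X →L[ℝ] Y)} (hΓ : ContDiffAt ℝ ∞ Γ m.1) : ContDiffAt ℝ ∞ (geodCoord Γ) m := by
  refine ContDiffAt.comp m symmetrize_contDiff.contDiffAt
    (bilPush_contDiffAt ?_ (bilPull_contDiffAt ?_ ?_))
  · exact (contDiffAt_snd.clm_comp contDiffAt_const).sub contDiffAt_const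
  · exact ContDiffAt.comp m hΓ contDiffAt_fst
  · have : (fun m : (X × Y) × (X →L[ℝ] Y) => (ContinuousLinearMap.id ℝ X).prod m.2) =
      fun m => (ContinuousLinearMap.inl ℝ X Y) + (ContinuousLinearMap.inr ℝ X Y).comp m.2 := by
      ext m v <;> simp
    rw [this]
    exact contDiffAt_const.add (contDiffAt_const.clm_comp contDiffAt_snd)

variable [CompleteSpace X] (he : e ∈ IsManifold.maximalAtlas 𝓘(ℝ, X × Y) ∞ E)

/-- By `IsGraphAt.secondFundForm_eq_zero` each pair of tangent vectors yields one scalar-free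
equation for f''(t, s), independent of the extension σ. All pairs occur, so the form vanishes
exactly when the whole second derivative is the one prescribed by the first jet. -/
theorem secondFundForm_eq_zero_iff {A : PointedSubmanifold X Y E}
    (hA : jet 2 A ∈ (chart₂ he).source) {Γ : X × Y → X × Y →L[ℝ] X × Y →L[ℝ] X × Y}
    (hΓ : HasSymbolsAt cov e (e.symm (chart₁ he (jet 1 A)).1) Γ) :
    (∀ v ∈ tangentTo (V := X × Y) A.carrier A.pt, ∀ σ : ∀ p : E, TangentSpace 𝓘(ℝ, X × Y) p,
      SmoothField σ A.pt →
      (∀ᶠ p in 𝓝 A.pt, p ∈ A.carrier → σ p ∈ tangentTo (V := X × Y) A.carrier p) →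
      secondFundForm cov A v σ = 0) ↔
    (chart₂ he (jet 2 A)).2.2 = geodCoord Γ (chart₁ he (jet 1 A)) := by
  obtain ⟨_, f, h, rfl⟩ := hA
  rw [show chart₂ he (jet 2 A) = _ from chart₂_apply he ⟨f, h, rfl⟩]
  have h1 : chart₁ he (jet 1 A) = (e A.pt, fderiv ℝ f (e A.pt).1) := chart₁_apply he ⟨f, h, rfl⟩
  rw [h1] at hΓ ⊢
  have hΓ' : HasSymbolsAt cov e A.pt Γ := by rwa [e.left_inv h.source] at hΓ
  have hs2 := h.smoothAt.isSymmSndFDerivAt (by simpa using two_le_infty)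
  have h2 : (symmetrize (fderiv ℝ (fderiv ℝ f) (e A.pt).1) : SymBilin X Y) =
      geodCoord Γ (e A.pt, fderiv ℝ f (e A.pt).1) ↔
      ∀ s t, fderiv ℝ (fderiv ℝ f) (e A.pt).1 t s =
      normalForm (fderiv ℝ f (e A.pt).1) (Γ (e A.pt) (s, fderiv ℝ f (e A.pt).1 s)
        (t, fderiv ℝ f (e A.pt).1 t)) := by
    rw [← SymBilin.incl_injective.eq_iff, incl_symmetrize fun u v => hs2.eq u v, geodCoord,
      incl_symmetrize fun u v => by
        simp only [bilPush_apply, bilPull_apply]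
        rw [hΓ'.symm.self_of_nhds]]
    constructor
    · intro h3 s t
      rw [hs2.eq t s, h3]
      rfl
    · intro h3
      refine ContinuousLinearMap.ext fun s => ContinuousLinearMap.ext fun t => ?_
      rw [← hs2.eq t s]
      exact h3 s t
  refine Iff.trans ?_ h2.symm
  constructor
  · intro h3 s t
    obtain ⟨w, hw⟩ := cMap_surjective h.chart h.source (t, fderiv ℝ f (e A.pt).1 t)
    -- The field (s, f'(x) s), constant in the `Y` coordinate, is tangent to the graph and has the
    -- prescribed value at the point.
    have hr : ∀ z : X × Y, z.1 = (e A.pt).1 →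
        ContDiffAt ℝ ∞ (fun z : X × Y => (s, fderiv ℝ f z.1 s)) z := fun z hz => by
      have h4 : ContDiffAt ℝ ∞ (fderiv ℝ f) z.1 := by
        rw [hz]; exact h.smoothAt.fderiv_right (m := ∞) (by simp)
      exact contDiffAt_const.prodMk
        ((ContDiffAt.comp z h4 contDiffAt_fst).clm_apply contDiffAt_const)
    have hσ := smoothField_fieldOf h.chart h.source (hr (e A.pt) rfl)
    have hσL : ∀ᶠ q in 𝓝 A.pt, q ∈ A.carrier →
        fieldOf e (fun z : X × Y => (s, fderiv ℝ f z.1 s)) q ∈ tangentTo (V := X × Y) A.carrier q := by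
      filter_upwards [h.eventually] with q hq hL
      refine (hq hL).mem_tanSpace.2 ?_
      rw [cMap_fieldOf h.chart (hq hL).source, normalForm_eq_zero]
    refine (h.secondFundForm_eq_zero hΓ' hσ hσL ?_ hw).1 (h3 w ?_ _ hσ hσL)
    · rw [cMap_fieldOf h.chart h.source]
    · refine h.mem_tanSpace.2 ?_
      rw [hw, normalForm_eq_zero]
  · intro h3 v hv σ hσ hσL
    exact (h.secondFundForm_eq_zero hΓ' hσ hσL
      (normalForm_eq_zero.1 (h.mem_tanSpace.1 (hσL.self_of_nhds h.mem)))
      (normalForm_eq_zero.1 (h.mem_tanSpace.1 hv))).2 (h3 _ _)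

/-- The coordinate condition depends on the second jet only, so some representative satisfies it if
and only if all do. It has exactly one solution over each first jet, and this solution is smooth in
the first jet. -/
theorem mem_totGeod_iff {θ : Jet X Y E 2} (hθ : θ ∈ (chart₂ he).source)
    {Γ : X × Y → X × Y →L[ℝ] X × Y →L[ℝ] X × Y}
    (hΓ : HasSymbolsAt cov e (e.symm (chart₁ he (jetProj θ)).1) Γ) :
    θ ∈ totGeod cov ↔ (chart₂ he θ).2.2 = geodCoord Γ (chart₁ he (jetProj θ)) := by
  constructor
  · rintro ⟨A, rfl, hA⟩
    exact (secondFundForm_eq_zero_iff he hθ hΓ).1 hA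
  · induction θ using Quot.ind with
    | mk A => exact fun h => ⟨A, rfl, (secondFundForm_eq_zero_iff he hθ hΓ).2 h⟩

/-- The section of second jets defined by an operator with Christoffel symbols. -/
theorem exists_isGeodSection (hcov : ∀ (e : OpenPartialHomeomorph E (X × Y)) (p : E),
    e ∈ IsManifold.maximalAtlas 𝓘(ℝ, X × Y) ∞ E → p ∈ e.source → ∃ Γ, HasSymbolsAt cov e p Γ) :
    ∃ s, IsGeodSection cov s := by
  have hbase : ∀ {e : OpenPartialHomeomorph E (X × Y)}
      {he : e ∈ IsManifold.maximalAtlas 𝓘(ℝ, X × Y) ∞ E} {ϑ : Jet X Y E 1},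
      ϑ ∈ (chart₁ he).source → (chart₁ he ϑ).1 ∈ e.target := fun {e he ϑ} h =>
    (mem_chart₁_target he).1 ((chart₁ he).map_source h)
  have hex : ∀ ϑ : Jet X Y E 1, ∃ θ, jetProj θ = ϑ ∧ θ ∈ totGeod cov := fun ϑ => by
    obtain ⟨e, he, h⟩ := exists_chart₁ X Y ϑ
    obtain ⟨Γ, hΓ⟩ := hcov e _ he (e.map_target (hbase h))
    obtain ⟨θ, rfl, h1, h2⟩ := exists_second_jet he h (geodCoord Γ (chart₁ he ϑ))
    refine ⟨θ, rfl, (mem_totGeod_iff he h1 hΓ).2 ?_⟩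
    rw [h2]
  have huniq : ∀ θ θ' : Jet X Y E 2, jetProj θ = jetProj θ' → θ ∈ totGeod cov →
      θ' ∈ totGeod cov → θ = θ' := fun θ θ' hp hθ hθ' => by
    obtain ⟨e, he, h⟩ := exists_chart₂ θ
    have h' : θ' ∈ (chart₂ he).source :=
      (jetProj_mem_source he).1 (hp ▸ (jetProj_mem_source he).2 h)
    obtain ⟨Γ, hΓ⟩ := hcov e _ he (e.map_target (hbase ((jetProj_mem_source he).2 h)))
    have h1 := (mem_totGeod_iff he h hΓ).1 hθ
    have h2 := (mem_totGeod_iff he h' (hp ▸ hΓ)).1 hθ'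
    refine (chart₂ he).injOn h h' ?_
    have h3 := congrArg (chart₁ he) hp
    rw [chart₁_jetProj he h, chart₁_jetProj he h'] at h3
    refine Prod.ext (congrArg Prod.fst h3 :) (Prod.ext (congrArg Prod.snd h3 :) ?_)
    rw [h1, h2, hp]
  choose s hs hsg using hex
  refine ⟨s, hs, fun ϑ => ?_, fun θ => ⟨fun h => huniq _ _ (hs _) (hsg _) h, fun h => h ▸ hsg _⟩⟩
  obtain ⟨e, he, h⟩ := exists_chart₁ X Y ϑ
  have hp := e.map_target (hbase h)
  obtain ⟨Γ, hΓ⟩ := hcov e _ he hp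
  have hsrc : ∀ ϑ, ϑ ∈ (chart₁ he).source → s ϑ ∈ (chart₂ he).source := fun ϑ h =>
    (jetProj_mem_source he).1 ((hs ϑ).symm ▸ h)
  have hcont : Tendsto (fun ϑ => e.symm (chart₁ he ϑ).1) (𝓝 ϑ) (𝓝 (e.symm (chart₁ he ϑ).1)) :=
    (e.continuousAt_symm (hbase h)).tendsto.comp ((chart₁ he).continuousAt h).fst
  have hev := (chart₁ he).open_source.eventually_mem h
  refine contMDiffAt_of_rep (chart₁_mem he) h (chart₂_mem he)
    (R := fun m => (m.1, m.2, geodCoord Γ m)) (hev.mono fun ϑ h => hsrc ϑ h) ?_ ?_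
  · have h1 := hΓ.smooth.self_of_nhds
    rw [e.right_inv (hbase h)] at h1
    exact contDiffAt_fst.prodMk (contDiffAt_snd.prodMk (geodCoord_contDiffAt h1))
  · filter_upwards [hev, hcont.eventually (hΓ.eventually hp)] with ϑ h hΓ
    have h1 := (mem_totGeod_iff he (hsrc ϑ h) (by rw [hs]; exact hΓ)).1 (hsg ϑ)
    have h2 := chart₁_jetProj he (hsrc ϑ h)
    rw [hs] at h1 h2
    rw [h2] at h1 ⊢
    exact Prod.ext rfl (Prod.ext rfl h1)

end TotallyGeodesic

/-! ### Tangent spaces through the preferred chart at a point. -/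

section OwnChart

variable {V N : Type*} [NormedAddCommGroup V] [NormedSpace ℝ V] [TopologicalSpace N]
  [ChartedSpace V N] {c : OpenPartialHomeomorph N V}

/-- The tangent space at p is the model space by means of the preferred chart at p, so the tangent
map of another chart is the derivative of the transition. This makes the comparison with products
possible. -/
theorem cMap_eq_fderiv (hc : c ∈ IsManifold.maximalAtlas 𝓘(ℝ, V) ∞ N) {p : N} (hp : p ∈ c.source) :
    cMap c p = fderiv ℝ (fun v => c ((chartAt V p).symm v)) (chartAt V p p) := by
  have h := (chart_contMDiffAt hc hp).mdifferentiableAt (by simp)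
  refine h.mfderiv.trans ?_
  simp [writtenInExtChartAt, Function.comp_def]
  rfl

theorem chart_transition_differentiableAt [IsManifold 𝓘(ℝ, V) ∞ N]
    (hc : c ∈ IsManifold.maximalAtlas 𝓘(ℝ, V) ∞ N) {p : N} (hp : p ∈ c.source) :
    DifferentiableAt ℝ (fun v => c ((chartAt V p).symm v)) (chartAt V p p) :=
  (transition_contDiffAt (IsManifold.chart_mem_maximalAtlas p) hc
    (mem_chart_source V p) hp).differentiableAt (by simp)

/-- The derivative of a function with values in a tangent space, in a chart of the latter. -/
theorem cMap_tMap_of_eq {V' N' : Type*} [NormedAddCommGroup V'] [NormedSpace ℝ V']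
    [TopologicalSpace N'] [ChartedSpace V' N'] {c' : OpenPartialHomeomorph N' V'}
    (hc : c ∈ IsManifold.maximalAtlas 𝓘(ℝ, V) ∞ N) {p : N} (hp : p ∈ c.source)
    (hc' : c' ∈ IsManifold.maximalAtlas 𝓘(ℝ, V') ∞ N') {q : N'} (hq : q ∈ c'.source)
    {g : N' → V} {F : V' → V} (hF : ContDiffAt ℝ ∞ F (c' q))
    (h : ∀ᶠ y in 𝓝 q, cMap c p (g y) = F (c' y)) (w : V') :
    cMap c p (tMap V' V g q w) = fderiv ℝ F (c' q) (cMap c' q w) := by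
  have hL : ∀ (L : V →L[ℝ] V) (v : V), ContMDiffAt 𝓘(ℝ, V) 𝓘(ℝ, V) ∞ L v := fun L v =>
    contMDiffAt_iff_contDiffAt.2 L.contDiff.contDiffAt
  have h1 : ContMDiffAt 𝓘(ℝ, V') 𝓘(ℝ, V) ∞ (fun y => F (c' y)) q :=
    ContMDiffAt.comp q (contMDiffAt_iff_contDiffAt.2 hF) (chart_contMDiffAt hc' hq)
  have h2 : ContMDiffAt 𝓘(ℝ, V') 𝓘(ℝ, V) ∞ g q := by
    refine (ContMDiffAt.comp q (hL (tMap V V c.symm (c p)) _) h1).congr_of_eventuallyEq ?_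
    filter_upwards [h] with y hy
    rw [Function.comp_apply, ← hy, tMap_symm_cMap hc hp]
  have h3 := tMap_comp (hL (cMap c p) (g q)) h2
  rw [tMap_congr h, tMap_comp (contMDiffAt_iff_contDiffAt.2 hF) (chart_contMDiffAt hc' hq),
    tMap_eq_fderiv, tMap_eq_fderiv, ContinuousLinearMap.fderiv] at h3
  exact (congrArg (fun T : V' →L[ℝ] V => T w) h3).symm

end OwnChart

/-! ### The direct sum of two connections. -/

section DirectSum

variable {X Z : Type*} [NormedAddCommGroup X] [NormedSpace ℝ X]
  [NormedAddCommGroup Z] [NormedSpace ℝ Z]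
  {M : Type*} [TopologicalSpace M] [ChartedSpace X M] [IsManifold 𝓘(ℝ, X) ∞ M]
  {E : Type*} [TopologicalSpace E] [ChartedSpace Z E] [IsManifold 𝓘(ℝ, Z) ∞ E]

theorem prod_chart_mem (x : M) (y : E) : (chartAt X x).prod (chartAt Z y) ∈
    IsManifold.maximalAtlas 𝓘(ℝ, X × Z) ∞ (M × E) :=
  IsManifold.chart_mem_maximalAtlas (I := 𝓘(ℝ, X × Z)) (n := ∞) (x, y)

variable {c : OpenPartialHomeomorph M X} (hc : c ∈ IsManifold.maximalAtlas 𝓘(ℝ, X) ∞ M)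
  {c' : OpenPartialHomeomorph E Z} (hc' : c' ∈ IsManifold.maximalAtlas 𝓘(ℝ, Z) ∞ E)
  (hC : c.prod c' ∈ IsManifold.maximalAtlas 𝓘(ℝ, X × Z) ∞ (M × E))
  {x : M} (hx : x ∈ c.source) {y : E} (hy : y ∈ c'.source)

include hc hc' hC hx hy

/-- The preferred chart of the product at (x, y) is the product of the preferred charts, so the
transition maps, and with them the tangent maps of the charts, split. -/
theorem cMap_prod (w : X × Z) : cMap (c.prod c') (x, y) w = (cMap c x w.1, cMap c' y w.2) := by
  rw [cMap_eq_fderiv hC ⟨hx, hy⟩, cMap_eq_fderiv hc hx, cMap_eq_fderiv hc' hy]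
  have h := HasFDerivAt.prodMap (p := (chartAt X x x, chartAt Z y y))
    (chart_transition_differentiableAt hc hx).hasFDerivAt
    (chart_transition_differentiableAt hc' hy).hasFDerivAt
  exact congrArg (fun T : X × Z →L[ℝ] X × Z => T w) h.fderiv

theorem fieldRep_prod {σ : ∀ q : M × E, TangentSpace 𝓘(ℝ, X × Z) q} :
    fieldRep (c.prod c') σ (c x, c' y) =
      (cMap c x (σ (x, y) : X × Z).1, cMap c' y (σ (x, y) : X × Z).2) :=
  (fieldRep_apply (c := c.prod c') (q := (x, y)) ⟨hx, hy⟩ σ).trans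
    (cMap_prod hc hc' hC hx hy (σ (x, y)))

omit hx in
theorem fieldRep_slice_fst {σ : ∀ q : M × E, TangentSpace 𝓘(ℝ, X × Z) q} {u : X}
    (hu : u ∈ c.target) : fieldRep c (fun x => (σ (x, y) : X × Z).1) u =
      (fieldRep (c.prod c') σ (u, c' y)).1 := by
  have h := fieldRep_prod hc hc' hC (c.map_target hu) hy (σ := σ)
  rw [c.right_inv hu] at h
  rw [h]
  rfl

omit hy in
theorem fieldRep_slice_snd {σ : ∀ q : M × E, TangentSpace 𝓘(ℝ, X × Z) q} {u : Z}
    (hu : u ∈ c'.target) : fieldRep c' (fun y => (σ (x, y) : X × Z).2) u =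
      (fieldRep (c.prod c') σ (c x, u)).2 := by
  have h := fieldRep_prod hc hc' hC hx (c'.map_target hu) (σ := σ)
  rw [c'.right_inv hu] at h
  rw [h]
  rfl

variable {Θ : CovariantDerivative 𝓘(ℝ, X) X (TangentSpace 𝓘(ℝ, X) : M → Type _)}
  {Γ : CovariantDerivative 𝓘(ℝ, Z) Z (TangentSpace 𝓘(ℝ, Z) : E → Type _)}

/-- In a product chart the four blocks of `directSum` are the four partial derivatives of the
representative of σ; the two diagonal blocks also contribute the symbols of the factors. -/
theorem cMap_directSum {ΓM : X → X →L[ℝ] X →L[ℝ] X} (hM : HasSymbolsAt (Θ : FieldOp X M) c x ΓM)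
    {ΓE : Z → Z →L[ℝ] Z →L[ℝ] Z} (hE : HasSymbolsAt (Γ : FieldOp Z E) c' y ΓE)
    {σ : ∀ q : M × E, TangentSpace 𝓘(ℝ, X × Z) q} (hσ : SmoothField σ (x, y)) (w : X × Z) :
    cMap (c.prod c') (x, y) (covMap (directSum Θ Γ) σ (x, y) w) =
      fderiv ℝ (fieldRep (c.prod c') σ) (c x, c' y) (cMap c x w.1, cMap c' y w.2) +
        (ΓM (c x) (cMap c x (σ (x, y) : X × Z).1) (cMap c x w.1),
          ΓE (c' y) (cMap c' y (σ (x, y) : X × Z).2) (cMap c' y w.2)) := by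
  set F := fieldRep (c.prod c') σ with hFdef
  have hF : ContDiffAt ℝ ∞ F (c x, c' y) :=
    (smoothField_iff hC (q := (x, y)) ⟨hx, hy⟩).1 hσ
  have hFd := (hF.differentiableAt (by simp)).hasFDerivAt
  have hi : ContDiffAt ℝ ∞ (fun u : X => (u, c' y)) (c x) := contDiffAt_id.prodMk contDiffAt_const
  have hj : ContDiffAt ℝ ∞ (fun v : Z => (c x, v)) (c' y) := contDiffAt_const.prodMk contDiffAt_id
  have hFi := ContDiffAt.comp (c x) (f := fun u : X => (u, c' y)) hF hi
  have hFj := ContDiffAt.comp (c' y) (f := fun v : Z => (c x, v)) hF hj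
  have hdi : HasFDerivAt (fun u : X => F (u, c' y))
      ((fderiv ℝ F (c x, c' y)).comp (ContinuousLinearMap.inl ℝ X Z)) (c x) :=
    HasFDerivAt.comp (c x) (f := fun u : X => (u, c' y)) hFd (hasFDerivAt_prodMk_left _ _)
  have hdj : HasFDerivAt (fun v : Z => F (c x, v))
      ((fderiv ℝ F (c x, c' y)).comp (ContinuousLinearMap.inr ℝ X Z)) (c' y) :=
    HasFDerivAt.comp (c' y) (f := fun v : Z => (c x, v)) hFd (hasFDerivAt_prodMk_right _ _)
  have hS1 : fieldRep c (fun x => (σ (x, y) : X × Z).1) =ᶠ[𝓝 (c x)] fun u => (F (u, c' y)).1 := by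
    filter_upwards [c.open_target.mem_nhds (c.map_source hx)] with u hu using
      fieldRep_slice_fst hc hc' hC hy hu
  have hS2 : fieldRep c' (fun y => (σ (x, y) : X × Z).2) =ᶠ[𝓝 (c' y)] fun v => (F (c x, v)).2 := by
    filter_upwards [c'.open_target.mem_nhds (c'.map_source hy)] with u hu using
      fieldRep_slice_snd hc hc' hC hx hu
  have hs1 : SmoothField (fun x => ((σ (x, y) : X × Z).1 : TangentSpace 𝓘(ℝ, X) x)) x :=
    (smoothField_iff hc hx).2 (hFi.fst.congr_of_eventuallyEq hS1)
  have hs2 : SmoothField (fun y => ((σ (x, y) : X × Z).2 : TangentSpace 𝓘(ℝ, Z) y)) y :=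
    (smoothField_iff hc' hy).2 (hFj.snd.congr_of_eventuallyEq hS2)
  have h1 := hM.formula.self_of_nhds _ hs1 w.1
  have h2 := hE.formula.self_of_nhds _ hs2 w.2
  have hd1 : HasFDerivAt (fun u : X => (F (u, c' y)).1) _ (c x) := hdi.fst
  have hd2 : HasFDerivAt (fun u : X => (F (u, c' y)).2) _ (c x) := hdi.snd
  have hd3 : HasFDerivAt (fun v : Z => (F (c x, v)).1) _ (c' y) := hdj.fst
  have hd4 : HasFDerivAt (fun v : Z => (F (c x, v)).2) _ (c' y) := hdj.snd
  rw [hS1.fderiv_eq, hd1.fderiv] at h1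
  rw [hS2.fderiv_eq, hd4.fderiv] at h2
  have h3 := cMap_tMap_of_eq hc hx hc' hy (g := fun y : E => (σ (x, y) : X × Z).1)
    (F := fun v => (F (c x, v)).1) hFj.fst (by
      filter_upwards [c'.open_source.mem_nhds hy] with z hz
      rw [hFdef, fieldRep_prod hc hc' hC hx hz]) w.2
  have h4 := cMap_tMap_of_eq hc' hy hc hx (g := fun x : M => (σ (x, y) : X × Z).2)
    (F := fun u => (F (u, c' y)).2) hFi.snd (by
      filter_upwards [c.open_source.mem_nhds hx] with z hz
      rw [hFdef, fieldRep_prod hc hc' hC hz hy]) w.1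
  rw [hd3.fderiv] at h3
  rw [hd2.fderiv] at h4
  rw [cMap_prod hc hc' hC hx hy]
  have h5 : covMap (directSum Θ Γ) σ (x, y) w =
      (covMap (Θ : FieldOp X M) (fun x => (σ (x, y) : X × Z).1) x w.1 +
        tMap Z X (fun y : E => (σ (x, y) : X × Z).1) y w.2,
      tMap X Z (fun x : M => (σ (x, y) : X × Z).2) x w.1 +
        covMap (Γ : FieldOp Z E) (fun y => (σ (x, y) : X × Z).2) y w.2) := rfl
  have h6 : fderiv ℝ F (c x, c' y) (cMap c x w.1, cMap c' y w.2) =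
      fderiv ℝ F (c x, c' y) (cMap c x w.1, 0) + fderiv ℝ F (c x, c' y) (0, cMap c' y w.2) := by
    rw [← map_add]; simp
  rw [h5, h6, map_add, map_add, h1, h2, h3, h4]
  refine Prod.ext ?_ ?_
  · simp only [ContinuousLinearMap.comp_apply, ContinuousLinearMap.inl_apply,
      ContinuousLinearMap.inr_apply, ContinuousLinearMap.coe_fst', Prod.fst_add]
    abel
  · simp only [ContinuousLinearMap.comp_apply, ContinuousLinearMap.inl_apply,
      ContinuousLinearMap.inr_apply, ContinuousLinearMap.coe_snd', Prod.snd_add]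
    abel

theorem HasSymbolsAt.directSum {ΓM : X → X →L[ℝ] X →L[ℝ] X}
    (hM : HasSymbolsAt (Θ : FieldOp X M) c x ΓM)
    {ΓE : Z → Z →L[ℝ] Z →L[ℝ] Z} (hE : HasSymbolsAt (Γ : FieldOp Z E) c' y ΓE) :
    HasSymbolsAt (SubmanifoldJet.directSum Θ Γ) (c.prod c') (x, y) fun z =>
      bilPush (ContinuousLinearMap.inl ℝ X Z) (bilPull (ΓM z.1) (ContinuousLinearMap.fst ℝ X Z)) +
      bilPush (ContinuousLinearMap.inr ℝ X Z) (bilPull (ΓE z.2) (ContinuousLinearMap.snd ℝ X Z)) := by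
  have hz : 𝓝 ((c.prod c') (x, y)) = 𝓝 (c x) ×ˢ 𝓝 (c' y) := nhds_prod_eq
  refine ⟨?_, ?_, ?_⟩
  · rw [hz]
    filter_upwards [hM.smooth.prod_mk hE.smooth] with z hz
    exact (bilPush_contDiffAt contDiffAt_const (bilPull_contDiffAt
      (ContDiffAt.comp z hz.1 contDiffAt_fst) contDiffAt_const)).add
      (bilPush_contDiffAt contDiffAt_const (bilPull_contDiffAt
      (ContDiffAt.comp z hz.2 contDiffAt_snd) contDiffAt_const))
  · rw [hz]
    filter_upwards [hM.symm.prod_mk hE.symm] with z hz u w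
    simp only [add_apply, bilPush_apply, bilPull_apply]
    rw [hz.1, hz.2]
  · rw [nhds_prod_eq]
    filter_upwards [((hM.eventually hx).and (c.open_source.eventually_mem hx)).prod_mk
      ((hE.eventually hy).and (c'.open_source.eventually_mem hy))] with q hq σ hσ w
    obtain ⟨⟨h1, h2⟩, h3, h4⟩ := hq
    rw [show q = (q.1, q.2) from rfl, cMap_directSum hc hc' hC h2 h4 h1 h3 hσ,
      cMap_prod hc hc' hC h2 h4]
    congr 1
    have h5 : ∀ s : X × Z, (ΓM (c q.1) (cMap c q.1 s.1) (cMap c q.1 w.1),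
        ΓE (c' q.2) (cMap c' q.2 s.2) (cMap c' q.2 w.2)) =
        (bilPush (ContinuousLinearMap.inl ℝ X Z)
          (bilPull (ΓM (c q.1)) (ContinuousLinearMap.fst ℝ X Z)) +
        bilPush (ContinuousLinearMap.inr ℝ X Z)
          (bilPull (ΓE (c' q.2)) (ContinuousLinearMap.snd ℝ X Z)))
        (cMap (c.prod c') (q.1, q.2) s) (cMap c q.1 w.1, cMap c' q.2 w.2) := fun s => by
      rw [cMap_prod hc hc' hC h2 h4]
      simp [bilPush_apply, bilPull_apply]
    exact h5 (σ (q.1, q.2))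

omit hc hc' hC hx hy

/-- The symbols are computed in the product of preferred charts and carried to an arbitrary divided
chart, which need not be a product, by `HasSymbolsAt.change`. -/
theorem exists_hasSymbolsAt_directSum
    (hΘ : ∀ (c : OpenPartialHomeomorph M X) (p : M),
      c ∈ IsManifold.maximalAtlas 𝓘(ℝ, X) ∞ M → p ∈ c.source →
      ∃ S, HasSymbolsAt (Θ : FieldOp X M) c p S)
    (hΓ : ∀ (c : OpenPartialHomeomorph E Z) (p : E),
      c ∈ IsManifold.maximalAtlas 𝓘(ℝ, Z) ∞ E → p ∈ c.source →
      ∃ S, HasSymbolsAt (Γ : FieldOp Z E) c p S)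
    (e : OpenPartialHomeomorph (M × E) (X × Z)) (p : M × E)
    (he : e ∈ IsManifold.maximalAtlas 𝓘(ℝ, X × Z) ∞ (M × E)) (hp : p ∈ e.source) :
    ∃ S, HasSymbolsAt (SubmanifoldJet.directSum Θ Γ) e p S := by
  have hc := IsManifold.chart_mem_maximalAtlas (I := 𝓘(ℝ, X)) (n := ∞) p.1
  have hc' := IsManifold.chart_mem_maximalAtlas (I := 𝓘(ℝ, Z)) (n := ∞) p.2
  obtain ⟨S, hS⟩ := hΘ _ p.1 hc (mem_chart_source X p.1)
  obtain ⟨S', hS'⟩ := hΓ _ p.2 hc' (mem_chart_source Z p.2)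
  have hC := prod_chart_mem (X := X) (Z := Z) p.1 p.2
  have hx := mem_chart_source X p.1
  have hy := mem_chart_source Z p.2
  exact (HasSymbolsAt.directSum hc hc' hC hx hy hS hS').change hC he ⟨hx, hy⟩ hp

end DirectSum

/-! ### Jets of sections and immersions as open sets defined by a condition on slopes. -/

section SectionJets

variable {X Z : Type*} [NormedAddCommGroup X] [NormedSpace ℝ X]
  [NormedAddCommGroup Z] [NormedSpace ℝ Z]

theorem IsGraphAt.congr {N : Type*} [TopologicalSpace N] [ChartedSpace (X × Z) N]
    {e : OpenPartialHomeomorph N (X × Z)} {L : Set N} {p : N} {f g : X → Z}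
    (h : IsGraphAt e L p f) (hfg : g =ᶠ[𝓝 (e p).1] f) : IsGraphAt e L p g := by
  refine ⟨h.chart, h.source, h.mem, ?_, ?_⟩
  · filter_upwards [h.smooth, hfg.eventually_nhds] with x h1 h2 using h1.congr_of_eventuallyEq h2
  · filter_upwards [h.graph, (e.continuousAt h.source).fst.eventually hfg] with q h1 h2
    rw [h2, h1]

variable {M : Type*} [TopologicalSpace M] [ChartedSpace X M]
  {E : Type*} [TopologicalSpace E] [ChartedSpace Z E]

variable (M E) in
/-- The space of the `r`-jets of the graphs of the maps whose tangent maps satisfy `Q`. -/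
def sectionJetsOf (Q : (X →L[ℝ] Z) → Prop) (r : ℕ) : Set (Jet X Z (M × E) r) :=
  {θ | ∃ A : PointedSubmanifold X Z (M × E), jet r A = θ ∧ ∃ (O : Set M) (s : M → E),
    IsOpen O ∧ ContMDiffOn 𝓘(ℝ, X) 𝓘(ℝ, Z) ∞ s O ∧ (∀ x ∈ O, Q (tMap X Z s x)) ∧
    A.carrier = (fun x => (x, s x)) '' O}

theorem sectionJets_eq (r : ℕ) : sectionJets X Z M E r = sectionJetsOf M E (fun _ => True) r := by
  refine Set.ext fun θ => exists_congr fun A => and_congr_right fun _ => exists₂_congr fun O s => ?_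
  simp

variable {c : OpenPartialHomeomorph M X} {c' : OpenPartialHomeomorph E Z}

theorem isGraphAt_section (hc : c ∈ IsManifold.maximalAtlas 𝓘(ℝ, X) ∞ M)
    (hc' : c' ∈ IsManifold.maximalAtlas 𝓘(ℝ, Z) ∞ E)
    (hC : c.prod c' ∈ IsManifold.maximalAtlas 𝓘(ℝ, X × Z) ∞ (M × E))
    {s : M → E} {O : Set M} (hO : IsOpen O) (hs : ContMDiffOn 𝓘(ℝ, X) 𝓘(ℝ, Z) ∞ s O) {x : M}
    (hxO : x ∈ O) (hx : x ∈ c.source) (hsx : s x ∈ c'.source) :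
    IsGraphAt (c.prod c') ((fun x => (x, s x)) '' O) (x, s x) fun u => c' (s (c.symm u)) := by
  have hsc := (hs.contMDiffAt (hO.mem_nhds hxO)).continuousAt.eventually
    (c'.open_source.eventually_mem hsx)
  have hev := (c.open_source.eventually_mem hx).and ((hO.eventually_mem hxO).and hsc)
  refine ⟨hC, ⟨hx, hsx⟩, ⟨x, hxO, rfl⟩, ?_, ?_⟩
  · change ∀ᶠ u in 𝓝 (c x), _
    filter_upwards [eventually_symm hx hev] with u ⟨hu, h1, h2, h3⟩
    have := rep_contDiffAt hc h1 hc' (hs.contMDiffAt (hO.mem_nhds h2)) h3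
    rwa [c.right_inv hu] at this
  · rw [nhds_prod_eq]
    filter_upwards [hev.prod_mk (c'.open_source.eventually_mem hsx)] with q ⟨⟨h1, h2, h3⟩, h4⟩
    change _ ↔ c' q.2 = c' (s (c.symm (c q.1)))
    rw [c.left_inv h1, c'.injOn.eq_iff h4 h3]
    constructor
    · rintro ⟨y, hy, rfl⟩
      rfl
    · exact fun h => ⟨q.1, h2, Prod.ext rfl h.symm⟩

variable {Q : (X →L[ℝ] Z) → Prop}
  (hQ : ∀ (a b : X →L[ℝ] Z) (A : X →L[ℝ] X) (B : Z →L[ℝ] Z), Function.Bijective A →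
    Function.Bijective B → (∀ v, b (A v) = B (a v)) → (Q a ↔ Q b))

include hQ

theorem tMap_iff_fderiv_rep (hc : c ∈ IsManifold.maximalAtlas 𝓘(ℝ, X) ∞ M)
    (hc' : c' ∈ IsManifold.maximalAtlas 𝓘(ℝ, Z) ∞ E) {s : M → E} {x : M}
    (hs : ContMDiffAt 𝓘(ℝ, X) 𝓘(ℝ, Z) ∞ s x) (hx : x ∈ c.source) (hsx : s x ∈ c'.source) :
    Q (tMap X Z s x) ↔ Q (fderiv ℝ (fun u => c' (s (c.symm u))) (c x)) :=
  hQ _ _ (cMap c x) (cMap c' (s x)) ⟨cMap_injective hc hx, cMap_surjective hc hx⟩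
    ⟨cMap_injective hc' hsx, cMap_surjective hc' hsx⟩ (rep_fderiv hc hx hc' hs hsx)

variable [CompleteSpace X] [IsManifold 𝓘(ℝ, X) ∞ M] [IsManifold 𝓘(ℝ, Z) ∞ E]
  {r : ℕ} {K : Type*} [NormedAddCommGroup K] [NormedSpace ℝ K] (J : JetCoord X Z r K)

theorem exists_coord_of_mem_sectionJetsOf {θ : Jet X Z (M × E) r} (hθ : θ ∈ sectionJetsOf M E Q r) :
    ∃ (x : M) (y : E) (m : (X × Z) × K),
      HasCoord J ((chartAt X x).prod (chartAt Z y)) θ m ∧ Q (J.lin m.2) := by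
  obtain ⟨⟨L, hL, p, hp⟩, rfl, O, s, hO, hs, hsQ, rfl : L = _⟩ := hθ
  obtain ⟨x, hx, rfl⟩ := hp
  have hc := IsManifold.chart_mem_maximalAtlas (I := 𝓘(ℝ, X)) (n := ∞) x
  have hc' := IsManifold.chart_mem_maximalAtlas (I := 𝓘(ℝ, Z)) (n := ∞) (s x)
  have hxs := mem_chart_source X x
  have hys := mem_chart_source Z (s x)
  have hg := isGraphAt_section hc hc' (prod_chart_mem (X := X) (Z := Z) x (s x)) hO hs hx hxs hys
  refine ⟨x, s x, _, ⟨_, hg, rfl⟩, ?_⟩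
  change Q (J.lin (J.D _ _))
  rw [J.lin_D]
  exact (tMap_iff_fderiv_rep hQ hc hc' (hs.contMDiffAt (hO.mem_nhds hx)) hxs hys).1 (hsQ x hx)

/-- The polynomial representative with the given coordinates is a section over a small open set.
Since the condition is open and holds at the point, it persists on that set. -/
theorem mem_sectionJetsOf_of_coord (hQo : IsOpen {a | Q a}) {x₀ : M} {y₀ : E}
    {θ : Jet X Z (M × E) r} {m : (X × Z) × K}
    (h : HasCoord J ((chartAt X x₀).prod (chartAt Z y₀)) θ m) (hm : Q (J.lin m.2)) :
    θ ∈ sectionJetsOf M E Q r := by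
  have hc := IsManifold.chart_mem_maximalAtlas (I := 𝓘(ℝ, X)) (n := ∞) x₀
  have hc' := IsManifold.chart_mem_maximalAtlas (I := 𝓘(ℝ, Z)) (n := ∞) y₀
  have hC := prod_chart_mem (X := X) (Z := Z) x₀ y₀
  set c := chartAt X x₀
  set c' := chartAt Z y₀
  obtain ⟨⟨x, y⟩, ⟨hx, hy⟩, hmp⟩ : ∃ p : M × E, p ∈ (c.prod c').source ∧ m.1 = (c p.1, c' p.2) := by
    induction θ using Quot.ind with
    | mk A =>
      obtain ⟨g, hg, rfl⟩ := h
      exact ⟨A.pt, hg.source, rfl⟩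
  have hx : x ∈ c.source := hx
  have hy : y ∈ c'.source := hy
  set f := J.P m.1 m.2 with hfdef
  have hf : ContDiff ℝ ∞ f := J.P_smooth _ _
  have hfx : f (c x) = c' y := by
    have := J.P_val m.1 m.2
    rw [hmp] at this
    rw [hfdef, hmp]
    exact this
  have hfD : J.D f (c x) = m.2 := by
    have := J.P_D m.1 m.2
    rw [hmp] at this
    rw [hfdef, hmp]
    exact this
  -- The domain is cut down so that f stays in the chart of the fibre and its slopes satisfy `Q`.
  let T : Set X := {u | f u ∈ c'.target ∧ Q (fderiv ℝ f u)}
  have hT : IsOpen T := (c'.open_target.preimage hf.continuous).inter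
    (hQo.preimage (hf.continuous_fderiv (by simp)))
  let O : Set M := c.source ∩ c ⁻¹' T
  have hO : IsOpen O := c.isOpen_inter_preimage hT
  let s : M → E := fun x => c'.symm (f (c x))
  have hs : ContMDiffOn 𝓘(ℝ, X) 𝓘(ℝ, Z) ∞ s O := fun z hz =>
    (ContMDiffAt.comp z (g := c'.symm) (f := fun x => f (c x))
      (contMDiffAt_symm_of_mem_maximalAtlas hc' hz.2.1)
      (ContMDiffAt.comp z (contMDiffAt_iff_contDiffAt.2 hf.contDiffAt)
        (chart_contMDiffAt hc hz.1))).contMDiffWithinAt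
  have hss : ∀ z ∈ O, s z ∈ c'.source := fun z hz => c'.map_target hz.2.1
  have hrep : ∀ z ∈ O, (fun u => c' (s (c.symm u))) =ᶠ[𝓝 (c z)] f := fun z hz => by
    filter_upwards [eventually_symm hz.1 (hO.eventually_mem hz)] with u ⟨h1, h2⟩
    have h3 := h2.2.1
    rw [c.right_inv h1] at h3
    change c' (c'.symm (f (c (c.symm u)))) = _
    rw [c.right_inv h1, c'.right_inv h3]
  have hgr : ∀ z ∈ O, IsGraphAt (c.prod c') ((fun x => (x, s x)) '' O) (z, s z) f := fun z hz =>
    (isGraphAt_section hc hc' hC hO hs hz hz.1 (hss z hz)).congr (hrep z hz).symm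
  have hxO : x ∈ O := by
    refine ⟨hx, ?_, ?_⟩
    · rw [hfx]; exact c'.map_source hy
    · rw [← J.lin_D, hfD]; exact hm
  refine ⟨⟨(fun x => (x, s x)) '' O, ?_, (x, s x), ⟨x, hxO, rfl⟩⟩, ?_, O, s, hO, hs, ?_, rfl⟩
  · rintro _ ⟨z, hz, rfl⟩
    exact ⟨_, _, hgr z hz⟩
  · refine HasCoord.inj (J := J) (m := m) ⟨f, hgr x hxO, ?_⟩ h
    refine Prod.ext ?_ hfD.symm
    rw [hmp]
    refine Prod.ext rfl ?_
    change c' y = c' (c'.symm (f (c x)))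
    rw [hfx, c'.left_inv hy]
  · intro z hz
    rw [tMap_iff_fderiv_rep hQ hc hc' (hs.contMDiffAt (hO.mem_nhds hz)) hz.1 (hss z hz),
      (hrep z hz).fderiv_eq]
    exact hz.2.2

/-- In product charts membership is a condition on the slope, which is part of the first jet. Hence
the open sets of second jets are full preimages, the form in which the general theorem is stated. -/
theorem sectionJetsOf_two (hQo : IsOpen {a | Q a}) :
    sectionJetsOf M E Q 2 = jetProj ⁻¹' sectionJetsOf M E Q 1 := by
  ext θ
  constructor
  · intro h
    obtain ⟨x, y, m, hm, hmQ⟩ := exists_coord_of_mem_sectionJetsOf hQ (secondJetCoord X Z) h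
    exact mem_sectionJetsOf_of_coord hQ (firstJetCoord X Z) hQo (hasCoord_jetProj hm) hmQ
  · intro h
    obtain ⟨x, y, m, hm, hmQ⟩ := exists_coord_of_mem_sectionJetsOf hQ (firstJetCoord X Z) h
    obtain ⟨m', hm'⟩ := hm.exists_second
    refine mem_sectionJetsOf_of_coord hQ (secondJetCoord X Z) hQo hm' ?_
    rw [hm.unique (hasCoord_jetProj hm')] at hmQ
    exact hmQ

theorem isOpen_sectionJetsOf (hQo : IsOpen {a | Q a}) : IsOpen (sectionJetsOf M E Q 1) := by
  rw [isOpen_iff_mem_nhds]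
  intro θ hθ
  obtain ⟨x, y, m, hm, hmQ⟩ := exists_coord_of_mem_sectionJetsOf hQ (firstJetCoord X Z) hθ
  have hC := prod_chart_mem (X := X) (Z := Z) x y
  have hθs : θ ∈ (chart₁ hC).source := ⟨m, hm⟩
  have h1 : (chart₁ hC).source ∩ chart₁ hC ⁻¹' {m | Q m.2} ∈ 𝓝 θ := by
    refine ((chart₁ hC).isOpen_inter_preimage (hQo.preimage continuous_snd)).mem_nhds ⟨hθs, ?_⟩
    rw [mem_preimage, chart₁_apply hC hm]
    exact hmQ
  filter_upwards [h1] with θ' h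
  exact mem_sectionJetsOf_of_coord hQ (firstJetCoord X Z) hQo (hasCoord_chart₁ hC h.1) h.2

end SectionJets

/-! ### The two conditions on slopes: none, and injectivity. -/

section Open

variable {X Z : Type*} [NormedAddCommGroup X] [NormedSpace ℝ X] [FiniteDimensional ℝ X]
  [NormedAddCommGroup Z] [NormedSpace ℝ Z] 
  {M : Type*} [TopologicalSpace M] [ChartedSpace X M] [IsManifold 𝓘(ℝ, X) ∞ M]
  {E : Type*} [TopologicalSpace E] [ChartedSpace Z E] [IsManifold 𝓘(ℝ, Z) ∞ E] [CompleteSpace X]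

omit [FiniteDimensional ℝ X] [CompleteSpace X] in
theorem injective_iff_of_bijective (a b : X →L[ℝ] Z) (A : X →L[ℝ] X) (B : Z →L[ℝ] Z)
    (hA : Function.Bijective A) (hB : Function.Bijective B) (h : ∀ v, b (A v) = B (a v)) :
    Function.Injective a ↔ Function.Injective b := by
  have h1 : b ∘ A = B ∘ a := funext h
  rw [← hB.1.of_comp_iff, ← h1, Function.Injective.of_comp_iff' b hA]

omit [FiniteDimensional ℝ X] in
variable (X Z M E) in
theorem isOpen_sectionJets : IsOpen (sectionJets X Z M E 1) ∧
    sectionJets X Z M E 2 = jetProj ⁻¹' sectionJets X Z M E 1 := by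
  rw [sectionJets_eq, sectionJets_eq]
  have h : ∀ (a b : X →L[ℝ] Z) (A : X →L[ℝ] X) (B : Z →L[ℝ] Z), Function.Bijective A →
    Function.Bijective B → (∀ v, b (A v) = B (a v)) → (True ↔ True) := fun _ _ _ _ _ _ _ => Iff.rfl
  exact ⟨isOpen_sectionJetsOf h isOpen_const, sectionJetsOf_two h isOpen_const⟩

variable (X Z M E) in
theorem isOpen_immersionJets : IsOpen (immersionJets X Z M E 1) ∧
    immersionJets X Z M E 2 = jetProj ⁻¹' immersionJets X Z M E 1 :=
  ⟨isOpen_sectionJetsOf injective_iff_of_bijective ContinuousLinearMap.isOpen_injective,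
    sectionJetsOf_two injective_iff_of_bijective ContinuousLinearMap.isOpen_injective⟩

end Open

end SubmanifoldJet

end

/-! ### The theorem in the three situations. -/

open SubmanifoldJet
theorem mainTheorem8
    (n m : ℕ)
    {E : Type*} [TopologicalSpace E] [T2Space E] [SecondCountableTopology E]
    [ChartedSpace (EuclideanSpace ℝ (Fin n) × EuclideanSpace ℝ (Fin m)) E]
    [IsManifold 𝓘(ℝ, EuclideanSpace ℝ (Fin n) × EuclideanSpace ℝ (Fin m)) ∞ E]
    (Γ : CovariantDerivative 𝓘(ℝ, EuclideanSpace ℝ (Fin n) × EuclideanSpace ℝ (Fin m))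
      (EuclideanSpace ℝ (Fin n) × EuclideanSpace ℝ (Fin m))
      (TangentSpace 𝓘(ℝ, EuclideanSpace ℝ (Fin n) × EuclideanSpace ℝ (Fin m)) : E → Type _))
    [CovariantDerivative.ContMDiffCovariantDerivative Γ ∞]
    (hΓ : Γ.torsion = 0)
    {M : Type*} [TopologicalSpace M] [T2Space M] [SecondCountableTopology M]
    [ChartedSpace (EuclideanSpace ℝ (Fin n)) M]
    [IsManifold 𝓘(ℝ, EuclideanSpace ℝ (Fin n)) ∞ M]
    (Θ : CovariantDerivative 𝓘(ℝ, EuclideanSpace ℝ (Fin n)) (EuclideanSpace ℝ (Fin n))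
      (TangentSpace 𝓘(ℝ, EuclideanSpace ℝ (Fin n)) : M → Type _))
    [CovariantDerivative.ContMDiffCovariantDerivative Θ ∞]
    (hΘ : Θ.torsion = 0) :
    (ExternalSubgroupOfInternal Γ univ ∧
      InternalEquivGrass Γ univ univ ∧
      ExternalProjectsOnto Γ univ univ (lieGrass Γ univ) ∧
      (m ≠ 1 → ExternalProjectsOnto Γ univ univ (contactGrass Γ univ : Set _))) ∧
    (ExternalSubgroupOfInternal (directSum Θ Γ)
        (immersionJets (EuclideanSpace ℝ (Fin n))
          (EuclideanSpace ℝ (Fin n) × EuclideanSpace ℝ (Fin m)) M E 2) ∧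
      InternalEquivGrass (directSum Θ Γ)
        (immersionJets (EuclideanSpace ℝ (Fin n))
          (EuclideanSpace ℝ (Fin n) × EuclideanSpace ℝ (Fin m)) M E 1)
        (immersionJets (EuclideanSpace ℝ (Fin n))
          (EuclideanSpace ℝ (Fin n) × EuclideanSpace ℝ (Fin m)) M E 2) ∧
      ExternalProjectsOnto (directSum Θ Γ)
        (immersionJets (EuclideanSpace ℝ (Fin n))
          (EuclideanSpace ℝ (Fin n) × EuclideanSpace ℝ (Fin m)) M E 1)
        (immersionJets (EuclideanSpace ℝ (Fin n))
          (EuclideanSpace ℝ (Fin n) × EuclideanSpace ℝ (Fin m)) M E 2)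
        (lieGrass (directSum Θ Γ) (immersionJets (EuclideanSpace ℝ (Fin n))
          (EuclideanSpace ℝ (Fin n) × EuclideanSpace ℝ (Fin m)) M E 1)) ∧
      (n + m ≠ 1 → ExternalProjectsOnto (directSum Θ Γ)
        (immersionJets (EuclideanSpace ℝ (Fin n))
          (EuclideanSpace ℝ (Fin n) × EuclideanSpace ℝ (Fin m)) M E 1)
        (immersionJets (EuclideanSpace ℝ (Fin n))
          (EuclideanSpace ℝ (Fin n) × EuclideanSpace ℝ (Fin m)) M E 2)
        (contactGrass (directSum Θ Γ) (immersionJets (EuclideanSpace ℝ (Fin n))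
          (EuclideanSpace ℝ (Fin n) × EuclideanSpace ℝ (Fin m)) M E 1) : Set _))) ∧
    (ExternalSubgroupOfInternal (directSum Θ Γ)
        (sectionJets (EuclideanSpace ℝ (Fin n))
          (EuclideanSpace ℝ (Fin n) × EuclideanSpace ℝ (Fin m)) M E 2) ∧
      InternalEquivGrass (directSum Θ Γ)
        (sectionJets (EuclideanSpace ℝ (Fin n))
          (EuclideanSpace ℝ (Fin n) × EuclideanSpace ℝ (Fin m)) M E 1)
        (sectionJets (EuclideanSpace ℝ (Fin n))
          (EuclideanSpace ℝ (Fin n) × EuclideanSpace ℝ (Fin m)) M E 2) ∧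
      ExternalProjectsOnto (directSum Θ Γ)
        (sectionJets (EuclideanSpace ℝ (Fin n))
          (EuclideanSpace ℝ (Fin n) × EuclideanSpace ℝ (Fin m)) M E 1)
        (sectionJets (EuclideanSpace ℝ (Fin n))
          (EuclideanSpace ℝ (Fin n) × EuclideanSpace ℝ (Fin m)) M E 2)
        (lieGrass (directSum Θ Γ) (sectionJets (EuclideanSpace ℝ (Fin n))
          (EuclideanSpace ℝ (Fin n) × EuclideanSpace ℝ (Fin m)) M E 1)) ∧
      (n + m ≠ 1 → ExternalProjectsOnto (directSum Θ Γ)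
        (sectionJets (EuclideanSpace ℝ (Fin n))
          (EuclideanSpace ℝ (Fin n) × EuclideanSpace ℝ (Fin m)) M E 1)
        (sectionJets (EuclideanSpace ℝ (Fin n))
          (EuclideanSpace ℝ (Fin n) × EuclideanSpace ℝ (Fin m)) M E 2)
        (contactGrass (directSum Θ Γ) (sectionJets (EuclideanSpace ℝ (Fin n))
          (EuclideanSpace ℝ (Fin n) × EuclideanSpace ℝ (Fin m)) M E 1) : Set _))) := by
  have hE := fun (e : OpenPartialHomeomorph E (EuclideanSpace ℝ (Fin n) × EuclideanSpace ℝ (Fin m)))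
    p he hp => exists_hasSymbolsAt (c := e) he Γ hΓ (p := p) hp
  have hM := fun (c : OpenPartialHomeomorph M (EuclideanSpace ℝ (Fin n)))
    p hc hp => exists_hasSymbolsAt (c := c) hc Θ hΘ (p := p) hp
  obtain ⟨s, hs⟩ := exists_isGeodSection hE
  obtain ⟨s', hs'⟩ := exists_isGeodSection (exists_hasSymbolsAt_directSum hM hE)
  -- In situations (ii) and (iii) the fibre is the whole model space of E, so the codimension k is n
  -- + m.
  have hrank : Module.finrank ℝ (EuclideanSpace ℝ (Fin n) × EuclideanSpace ℝ (Fin m)) = n + m := by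
    simp
  obtain ⟨hI, hI'⟩ := isOpen_immersionJets (EuclideanSpace ℝ (Fin n))
    (EuclideanSpace ℝ (Fin n) × EuclideanSpace ℝ (Fin m)) M E
  obtain ⟨hS, hS'⟩ := isOpen_sectionJets (EuclideanSpace ℝ (Fin n))
    (EuclideanSpace ℝ (Fin n) × EuclideanSpace ℝ (Fin m)) M E
  refine ⟨?_, ?_, ?_⟩
  · have h := hs.symmetries isOpen_univ
    rwa [finrank_euclideanSpace_fin, preimage_univ] at h
  · rw [hI', ← hrank]
    exact hs'.symmetries hI
  · rw [hS', ← hrank]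
    exact hs'.symmetries hS
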